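/- Let $m\ge 2$ be an integer and, for $a=(a_1,\dots,a_m)\in\mathbb C^m$, let $\varphi_a(z)=z^m+a_1z^{m-1}+\dots+a_{m-1}z+a_m$. There are polynomials $r_m$, $A_{m,N}$ ($1\le N\le m+2$), $B_{m,N}$, $C_{m,N}$, $D_{m,N}$ ($N\ge1$) in $(a_1,\dots,a_m)$ with complex coefficients and a function $y_m(z,a)$ such that the following holds. (0) For every $a\in\mathbb C^m$, $y_m(\cdot,a)$ is a solution of $y'''(z)=\varphi_a(z)\,y(z)$ on $\mathbb C$, where the derivatives are with respect to $z$. (1) $y_m(z,a)$ is an entire function of $(z,a_1,\dots,a_m)\in\mathbb C^{1+m}$. (2) Put $$E_m(z,a)=\frac{3}{m+3}z^{\frac{m+3}{3}}+\sum_{N=1}^{m+2}A_{m,N}\,z^{\frac{m+3-N}{3}}.$$ In the open sector $-\frac{7\pi}{m+3}<\arg z<\frac{\pi}{m+3}$ one has $$y_m(z,a)\cong z^{r_m}\Bigl(1+\sum_{N=1}^{\infty}B_{m,N}z^{-\frac N3}\Bigr)\exp(E_m(z,a)).$$ (3) In the same sector, $$y_m'(z,a)\cong z^{\frac m3+r_m}\Bigl(1+\sum_{N=1}^{\infty}C_{m,N}z^{-\frac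 N3}\Bigr)\exp(E_m(z,a)),$$ $$y_m''(z,a)\cong z^{\frac{2m}3+r_m}\Bigl(1+\sum_{N=1}^{\infty}D_{m,N}z^{-\frac N3}\Bigr)\exp(E_m(z,a)).$$ Here all powers are $z^c=\exp(c(\log|z|+i\arg z))$, with the argument that lies in the sector, and $f(z,a)\cong z^{s(a)}\bigl(1+\sum_{N\ge1}B_N(a)z^{-N/3}\bigr)\exp(E(z,a))$ means that, for every $n\ge0$, $$z^{-s(a)}e^{-E(z,a)}f(z,a)=1+\sum_{N=1}^{n}B_N(a)z^{-\frac N3}+O\bigl(|z|^{-\frac{n+1}3}\bigr)$$ as $z\to\infty$ in any closed subsector $\alpha\le\arg z\le\beta$ of the open sector, uniformly in $z$ in that subsector and in $a$ in any compact subset of $\mathbb C^m$. -/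

import Mathlib

/-- The monic polynomial `φ(z) = z^m + a₁ z^(m-1) + ⋯ + a_(m-1) z + a_m`.
The coefficient `a_(j+1)` is `a j`, for `j : Fin m`. -/
noncomputable def monicPoly {m : ℕ} (a : Fin m → ℂ) (z : ℂ) : ℂ :=
  z ^ m + ∑ j : Fin m, a j * z ^ (m - 1 - (j : ℕ))

/-- The point `z = ρ e^{iθ}`, with modulus `ρ > 0` and chosen argument `θ`. -/
noncomputable def polarPoint (ρ θ : ℝ) : ℂ :=
  (ρ : ℂ) * Complex.exp ((θ : ℂ) * Complex.I)

/-- The power `z^c = exp (c (log ρ + iθ))` of `z = ρ e^{iθ}` that belongs to the argument `θ`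
(which need not be the principal one). -/
noncomputable def polarPow (ρ θ : ℝ) (c : ℂ) : ℂ :=
  Complex.exp (c * ((Real.log ρ : ℂ) + (θ : ℂ) * Complex.I))

/-- `E_m(z,a) = 3/(m+3) z^{(m+3)/3} + ∑_{N=1}^{m+2} A_N(a) z^{(m+3-N)/3}` at `z = ρ e^{iθ}`. -/
noncomputable def expPart {m : ℕ} (A : ℕ → MvPolynomial (Fin m) ℂ)
    (ρ θ : ℝ) (a : Fin m → ℂ) : ℂ :=
  3 / ((m : ℂ) + 3) * polarPow ρ θ (((m : ℂ) + 3) / 3)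
    + ∑ N ∈ Finset.Icc 1 (m + 2),
        MvPolynomial.eval a (A N) * polarPow ρ θ (((m : ℂ) + 3 - (N : ℂ)) / 3)

/-- The asymptotic representation
`f(z,a) ≅ z^{s(a)} (1 + ∑_{N ≥ 1} B_N(a) z^{-N/3}) exp (E(z,a))`
in the open sector `lo < arg z < hi`: on every closed subsector `α ≤ arg z ≤ β` and for `a` in
every compact set `K`, the function `z^{-s(a)} exp (-E(z,a)) f(z,a)` differs from the `n`-th
partial sum of the series by `O(|z|^{-(n+1)/3})` as `z → ∞`, uniformly in `arg z` and `a`,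
for every `n`. The argument `θ` of `z` in the sector fixes the branch of all powers. -/
def HasSectorExpansion {m : ℕ} (lo hi : ℝ) (f : ℂ → (Fin m → ℂ) → ℂ)
    (s : (Fin m → ℂ) → ℂ) (B : ℕ → MvPolynomial (Fin m) ℂ)
    (E : ℝ → ℝ → (Fin m → ℂ) → ℂ) : Prop :=
  ∀ K : Set (Fin m → ℂ), IsCompact K →
  ∀ α β : ℝ, lo < α → β < hi →
  ∀ n : ℕ, ∃ M R : ℝ, 0 < R ∧
    ∀ a ∈ K, ∀ ρ : ℝ, R ≤ ρ → ∀ θ ∈ Set.Icc α β,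
      ‖polarPow ρ θ (-s a) * Complex.exp (-E ρ θ a) * f (polarPoint ρ θ) a
          - (1 + ∑ N ∈ Finset.Icc 1 n,
              MvPolynomial.eval a (B N) * polarPow ρ θ (-(N : ℂ) / 3))‖
        ≤ M * ρ ^ (-((n : ℝ) + 1) / 3)

/-! Write ζ = log z, h = z^{-1/3}, X = z^{(m+3)/3}, so that X h^{m+3} = 1. Formal side. The
quotients y'/y and y''/y satisfy a Riccati system. Scaled by z^{-m/3} and z^{-2m/3}, they become
power series σ, τ in h with coefficients polynomial in a. Eliminating τ leaves a cubic equation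
perturbed at order h^{m+3}, solvable coefficient by coefficient because the derivative of f³ at 1 is
the unit 3 (`exists_formal_riccati`). The primitive of X σ dζ consists of E_m (indices below m+3), a
term r_m ζ (index m+3) and a tail in positive powers of h. The exponential of the tail is the
amplitude series; the three expansions are the amplitude times 1, σ and τ.

Analytic side. Dividing a true solution by the exponential of the truncated phase gives U, and the
defects of y' and y'' from their approximations, multiplied by X², give P and S. Then dU/dζ = P/X,
while P + ω²S and P + ωS decouple to leading order with rates X(ω-1) and X(ω²-1)
(`exists_hasDerivAt_coordG_bound`). In the variable q = e^{3πi/4} z^{(m+3)/4} the open sector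
becomes the plane slit along the negative axis, and X = -q^{4/3}. Along horizontal lines the rates
are positive multiples of q^{1/3}(1-ω) and q^{1/3}(1-ω²). Since |arg q|/3 < π/3 and 1-ω, 1-ω² have
arguments ∓π/6, both rates have positive real part on the whole slit plane
(`exists_re_cubeRoot_ge`). Defects are thus repelled as Re q grows, and a Gronwall argument bounds
the energy at the start of a path by the energy at its end (`energy_gronwall`,
`exists_energy_transfer`).

Construction. Let V_j be the solution with U = 1, P = S = 0 at q = j. The transfer estimate makes
its coefficients in a fundamental system entire in (z,a) a Cauchy sequence, uniformly for a in
compact sets; the limit is the required entire solution (`exists_limit_solution`). It does not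
depend on the truncation order: the V_j also have vanishing energy at infinity for every finer
truncation. Transferring this to an arbitrary point of a closed subsector gives the approximation to
every order (`exists_recessive_solution`), which `hasSectorExpansion_of_factor` turns into the
asymptotic series. -/

/-! ### Formal power series solutions -/

open PowerSeries in
/-- A functional equation `P f = 0` for power series whose `n`-th coefficient determines the
`n`-th coefficient of `f` through a unit has a solution with constant coefficient `1`. -/
theorem exists_powerSeries_root {R : Type*} [CommRing R] (P : R⟦X⟧ → R⟦X⟧) (d c : ℕ → R)
    (hdc : ∀ n, 1 ≤ n → c n * d n = 1)
    (hP : ∀ n, 1 ≤ n → ∀ f g, constantCoeff f = 1 → constantCoeff g = 1 → X ^ n ∣ f - g →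
      X ^ (n + 1) ∣ P f - P g - C (c n) * (f - g))
    (h0 : X ∣ P 1) : ∃ f, constantCoeff f = 1 ∧ P f = 0 := by
  -- Newton iteration with the linearization frozen at its leading coefficient: each step corrects
  -- one further coefficient, so the iterates stabilize.
  let g : ℕ → R⟦X⟧ := fun n => Nat.rec 1 (fun k f => f - C (d (k + 1)) * P f) n
  have gs : ∀ k, g (k + 1) = g k - C (d (k + 1)) * P (g k) := fun k => rfl
  have inv : ∀ k, constantCoeff (g k) = 1 ∧ X ^ (k + 1) ∣ P (g k) := by
    intro k
    induction k with
    | zero => exact ⟨by simp [g], by simpa [g] using h0⟩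
    | succ k ih =>
      obtain ⟨h1, h2⟩ := ih
      have h3 : constantCoeff (P (g k)) = 0 := by
        rw [← X_dvd_iff]
        exact (dvd_pow_self X (by omega)).trans h2
      have h4 : constantCoeff (g (k + 1)) = 1 := by
        rw [gs]; simp [h1, h3]
      refine ⟨h4, ?_⟩
      have h5 : g (k + 1) - g k = -(C (d (k + 1)) * P (g k)) := by rw [gs]; ring
      have h6 : X ^ (k + 1) ∣ g (k + 1) - g k := by
        rw [h5]; exact (h2.mul_left _).neg_right
      have h7 := hP (k + 1) (by omega) _ _ h4 h1 h6
      rw [h5] at h7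
      have h8 : C (c (k + 1)) * C (d (k + 1)) = (1 : R⟦X⟧) := by
        rw [← map_mul, hdc _ (by omega), map_one]
      have h9 : P (g (k + 1)) - P (g k) - C (c (k + 1)) * -(C (d (k + 1)) * P (g k))
          = P (g (k + 1)) := by
        linear_combination P (g k) * h8
      rwa [h9] at h7
  have hdvd : ∀ k, X ^ (k + 1) ∣ g (k + 1) - g k := by
    intro k
    have : g (k + 1) - g k = -(C (d (k + 1)) * P (g k)) := by rw [gs]; ring
    rw [this]; exact ((inv k).2.mul_left _).neg_right
  have far : ∀ k j, X ^ (k + 1) ∣ g (k + j) - g k := by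
    intro k j
    induction j with
    | zero => simp
    | succ j ih =>
      have := (pow_dvd_pow X (by omega : k + 1 ≤ k + j + 1)).trans (hdvd (k + j))
      have h := dvd_add this ih
      rw [sub_add_sub_cancel] at h
      exact h
  let f : R⟦X⟧ := mk fun k => coeff k (g k)
  have hf : ∀ k, X ^ (k + 1) ∣ f - g k := by
    intro k
    rw [X_pow_dvd_iff]
    intro i hi
    have h := far i (k - i)
    rw [X_pow_dvd_iff] at h
    have h := h i (by omega)
    rw [show i + (k - i) = k by omega, map_sub, sub_eq_zero] at h
    simp [f, h]
  have hf1 : constantCoeff f = 1 := by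
    have := (inv 0).1
    rw [← coeff_zero_eq_constantCoeff_apply] at this ⊢
    simpa [f] using this
  refine ⟨f, hf1, ?_⟩
  ext k
  have h1 := hP (k + 1) (by omega) f (g k) hf1 (inv k).1 (hf k)
  have h2 : X ^ (k + 1) ∣ P f := by
    have h3 := dvd_add (dvd_add ((pow_dvd_pow X (by omega : k + 1 ≤ k + 1 + 1)).trans h1)
      ((hf k).mul_left (C (c (k + 1))))) (inv k).2
    convert h3 using 1
    ring
  rw [X_pow_dvd_iff] at h2
  simpa using h2 k (by omega)

open PowerSeries in
/-- The operator `z d/dz` on power series in `h = z^{-1/3}`. -/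
noncomputable def eulerOp {m : ℕ} (f : (MvPolynomial (Fin m) ℂ)⟦X⟧) :
    (MvPolynomial (Fin m) ℂ)⟦X⟧ :=
  C (MvPolynomial.C (-1 / 3)) * (X * d⁄dX _ f)

open PowerSeries in
theorem X_pow_dvd_X_mul_derivative {R : Type*} [CommRing R] {n : ℕ} {f : R⟦X⟧} (h : X ^ n ∣ f) :
    X ^ n ∣ X * d⁄dX R f := by
  obtain ⟨e, rfl⟩ := h
  rcases n with _ | n
  · simp
  · rw [Derivation.leibniz, derivative_pow, derivative_X]
    simp only [smul_eq_mul, Nat.add_sub_cancel]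
    exact ⟨X * d⁄dX R e + e * ((n + 1 : ℕ) : R⟦X⟧), by ring⟩

open PowerSeries in
theorem X_pow_dvd_eulerOp {m n : ℕ} {f : (MvPolynomial (Fin m) ℂ)⟦X⟧} (h : X ^ n ∣ f) :
    X ^ n ∣ eulerOp f :=
  (X_pow_dvd_X_mul_derivative h).mul_left _

open PowerSeries in
theorem eulerOp_sub {m : ℕ} (f g : (MvPolynomial (Fin m) ℂ)⟦X⟧) :
    eulerOp (f - g) = eulerOp f - eulerOp g := by
  simp only [eulerOp, map_sub]; ring

/-- The polynomial `z^{-m} φ_a(z)` in `h = z^{-1/3}`. -/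
noncomputable def normalizedPotential (m : ℕ) : Polynomial (MvPolynomial (Fin m) ℂ) :=
  1 + ∑ j : Fin m, Polynomial.C (MvPolynomial.X j) * Polynomial.X ^ (3 * ((j : ℕ) + 1))

open PowerSeries in
/-- The formal Riccati equation: formal series `σ = z^{-m/3} y'/y` and `τ = z^{-2m/3} y''/y`. -/
theorem exists_formal_riccati (m : ℕ) : ∃ σ τ : (MvPolynomial (Fin m) ℂ)⟦X⟧,
    constantCoeff σ = 1 ∧
    τ - σ ^ 2 - X ^ (m + 3) * (C (MvPolynomial.C ((m : ℂ) / 3)) * σ + eulerOp σ) = 0 ∧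
    ((normalizedPotential m : Polynomial (MvPolynomial (Fin m) ℂ)) : (MvPolynomial (Fin m) ℂ)⟦X⟧)
      - σ * τ - X ^ (m + 3) * (C (MvPolynomial.C (2 * (m : ℂ) / 3)) * τ + eulerOp τ) = 0 := by
  set κ : (MvPolynomial (Fin m) ℂ)⟦X⟧ := C (MvPolynomial.C ((m : ℂ) / 3))
  set κ' : (MvPolynomial (Fin m) ℂ)⟦X⟧ := C (MvPolynomial.C (2 * (m : ℂ) / 3))
  -- The first equation gives τ = T σ; substituted in the second, it leaves P σ = 0, whose leading
  -- part is σ³ minus the normalized potential. Hence the constant 3 below.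
  let T : (MvPolynomial (Fin m) ℂ)⟦X⟧ → (MvPolynomial (Fin m) ℂ)⟦X⟧ := fun f =>
    f ^ 2 + X ^ (m + 3) * (κ * f + eulerOp f)
  let P : (MvPolynomial (Fin m) ℂ)⟦X⟧ → (MvPolynomial (Fin m) ℂ)⟦X⟧ := fun f =>
    f * T f + X ^ (m + 3) * (κ' * T f + eulerOp (T f))
      - ((normalizedPotential m : Polynomial (MvPolynomial (Fin m) ℂ)) :
          (MvPolynomial (Fin m) ℂ)⟦X⟧)
  obtain ⟨σ, h1, h2⟩ := exists_powerSeries_root P (fun _ => MvPolynomial.C (1 / 3))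
    (fun _ => 3) (by
      intro n _
      rw [show (3 : MvPolynomial (Fin m) ℂ) = MvPolynomial.C 3 by rw [map_ofNat], ← map_mul]
      norm_num) (by
      intro n hn f g hf hg hfg
      have hE := X_pow_dvd_eulerOp hfg
      rw [eulerOp_sub] at hE
      have hT : X ^ n ∣ T f - T g := by
        have : T f - T g = (f + g) * (f - g) + X ^ (m + 3) * κ * (f - g)
            + X ^ (m + 3) * (eulerOp f - eulerOp g) := by
          simp only [T]; ring
        rw [this]
        exact dvd_add (dvd_add (hfg.mul_left _) (hfg.mul_left _)) (hE.mul_left _)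
      have hET := X_pow_dvd_eulerOp hT
      rw [eulerOp_sub] at hET
      have hX : X ∣ f ^ 2 + f * g + g ^ 2 - 3 := by
        rw [X_dvd_iff]
        simp only [map_sub, map_add, map_mul, map_pow, hf, hg, map_ofNat]; norm_num
      have key : P f - P g - C 3 * (f - g) = (f ^ 2 + f * g + g ^ 2 - 3) * (f - g)
          + X * (X ^ (m + 2) * (f * (κ * (f - g) + (eulerOp f - eulerOp g))
            + (κ * g + eulerOp g) * (f - g) + κ' * (T f - T g)
            + (eulerOp (T f) - eulerOp (T g)))) := by
        simp only [P, map_ofNat]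
        simp only [T]; ring
      rw [key, pow_succ']
      refine dvd_add (mul_dvd_mul hX hfg) (mul_dvd_mul_left _ (Dvd.dvd.mul_left ?_ _))
      exact dvd_add (dvd_add (dvd_add ((dvd_add (hfg.mul_left _) hE).mul_left _)
        (hfg.mul_left _)) (hT.mul_left _)) hET) (by
      have hψ : X ∣ (1 : (MvPolynomial (Fin m) ℂ)⟦X⟧) - ((normalizedPotential m :
          Polynomial (MvPolynomial (Fin m) ℂ)) : (MvPolynomial (Fin m) ℂ)⟦X⟧) := by
        rw [X_dvd_iff]
        have : (normalizedPotential m).coeff 0 = 1 := by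
          simp [normalizedPotential, Polynomial.coeff_X_pow]
        simp [this]
      have : P 1 = X * (X ^ (m + 2) * (κ + eulerOp 1 + κ' * T 1 + eulerOp (T 1)))
          + (1 - ((normalizedPotential m :
          Polynomial (MvPolynomial (Fin m) ℂ)) : (MvPolynomial (Fin m) ℂ)⟦X⟧)) := by
        simp only [P]
        rw [show T 1 = 1 + X ^ (m + 3) * (κ + eulerOp 1) by simp [T]]
        ring
      rw [this]
      exact dvd_add (dvd_mul_right _ _) hψ)
  refine ⟨σ, T σ, h1, ?_, ?_⟩
  · simp only [T]; ring
  · rw [← neg_eq_zero, ← h2]; simp only [P]; ring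

open PowerSeries in
/-- The formal exponential: a solution `B` of `B' = G B` with `B(0) = 1`. -/
theorem exists_formal_exp {m : ℕ} (G : (MvPolynomial (Fin m) ℂ)⟦X⟧) :
    ∃ B : (MvPolynomial (Fin m) ℂ)⟦X⟧, constantCoeff B = 1 ∧ d⁄dX _ B = G * B := by
  -- Multiplication by X aligns the indices: the n-th coefficient of X B' is n times that of B,
  -- whereas X G B involves only earlier coefficients.
  obtain ⟨B, h1, h2⟩ := exists_powerSeries_root
    (fun B : (MvPolynomial (Fin m) ℂ)⟦X⟧ => X * d⁄dX _ B - X * (G * B))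
    (fun n => MvPolynomial.C (1 / n)) (fun n => MvPolynomial.C n) (by
      intro n hn
      rw [← map_mul]
      have : (n : ℂ) ≠ 0 := by exact_mod_cast (by omega : n ≠ 0)
      rw [mul_one_div_cancel this, map_one]) (by
      rintro n hn f g - - ⟨e, he⟩
      obtain ⟨k, rfl⟩ : ∃ k, n = k + 1 := ⟨n - 1, by omega⟩
      have h3 : d⁄dX _ f - d⁄dX _ g = X ^ (k + 1) * d⁄dX _ e
          + e * (((k + 1 : ℕ) : (MvPolynomial (Fin m) ℂ)⟦X⟧) * X ^ k) := by
        rw [← map_sub, he, Derivation.leibniz, derivative_pow, derivative_X]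
        simp
      have h4 : C (MvPolynomial.C ((k + 1 : ℕ) : ℂ)) = (((k + 1 : ℕ) :
          (MvPolynomial (Fin m) ℂ)⟦X⟧)) := by simp
      refine ⟨d⁄dX _ e - G * e, ?_⟩
      rw [h4]
      linear_combination X * h3 - (X * G + ((k + 1 : ℕ) : (MvPolynomial (Fin m) ℂ)⟦X⟧)) * he) (by simp)
  refine ⟨B, h1, ?_⟩
  have : X * (d⁄dX _ B - G * B) = 0 := by rw [← h2]; ring
  rcases mul_eq_zero.mp this with h | h
  · exact absurd h X_ne_zero
  · exact sub_eq_zero.mp h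

/-! ### Holomorphic limits on normed spaces -/

/-- This is Cauchy's estimate on the complex line t ↦ y + t v: the circle of radius r/(4‖v‖) in t
stays inside the ball of radius r. -/
theorem norm_fderiv_le_of_forall_mem_ball {E : Type*} [NormedAddCommGroup E]
    [NormedSpace ℂ E] {f : E → ℂ} (hf : Differentiable ℂ f) {x y : E} {r M : ℝ} (hr : 0 < r)
    (hM : ∀ w ∈ Metric.ball x r, ‖f w‖ ≤ M) (hy : y ∈ Metric.ball x (r / 2)) :
    ‖fderiv ℂ f y‖ ≤ M / (r / 4) := by
  have hM0 : 0 ≤ M := (norm_nonneg _).trans (hM x (Metric.mem_ball_self hr))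
  refine ContinuousLinearMap.opNorm_le_bound _ (by positivity) fun v => ?_
  by_cases hv : v = 0
  · simp [hv]
  have hv' : 0 < ‖v‖ := norm_pos_iff.mpr hv
  have hg : ∀ t : ℂ, HasDerivAt (fun t : ℂ => f (y + t • v)) (fderiv ℂ f (y + t • v) v) t := by
    intro t
    have h1 : HasDerivAt (fun t : ℂ => y + t • v) v t := by
      simpa using ((hasDerivAt_id t).smul_const v).const_add y
    exact (hf (y + t • v)).hasFDerivAt.comp_hasDerivAt t h1
  have h2 := Complex.norm_deriv_le_of_forall_mem_sphere_norm_le (c := 0) (R := r / 4 / ‖v‖)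
    (C := M) (f := fun t : ℂ => f (y + t • v)) (by positivity)
    (Differentiable.diffContOnCl fun t => (hg t).differentiableAt) (by
      intro t ht
      apply hM
      rw [mem_sphere_zero_iff_norm] at ht
      rw [Metric.mem_ball, dist_eq_norm] at hy ⊢
      have h3 : ‖t • v‖ = r / 4 := by rw [norm_smul, ht]; field_simp
      calc ‖y + t • v - x‖ = ‖(y - x) + t • v‖ := by congr 1; abel
        _ ≤ ‖y - x‖ + ‖t • v‖ := norm_add_le _ _
        _ < r := by rw [h3]; linarith)
  rw [(hg 0).deriv] at h2
  simp only [zero_smul, add_zero] at h2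
  calc ‖fderiv ℂ f y v‖ ≤ M / (r / 4 / ‖v‖) := h2
    _ = M / (r / 4) * ‖v‖ := by field_simp

/-- A locally uniform limit of holomorphic functions on a complex normed space is holomorphic. -/
theorem differentiable_of_locally_tendstoUniformlyOn {E : Type*} [NormedAddCommGroup E]
    [NormedSpace ℂ E] {F : ℕ → E → ℂ} {f : E → ℂ} (hF : ∀ n, Differentiable ℂ (F n))
    (hf : ∀ x, ∃ r > 0, TendstoUniformlyOn F f Filter.atTop (Metric.ball x r)) :
    Differentiable ℂ f := by
  intro x
  obtain ⟨r, hr, hunif⟩ := hf x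
  -- Cauchy's estimate, applied to differences, passes the uniform Cauchy property to the
  -- derivatives on the half ball.
  have hc : UniformCauchySeqOn (fun n => fderiv ℂ (F n)) Filter.atTop (Metric.ball x (r / 2)) := by
    rw [Metric.uniformCauchySeqOn_iff]
    intro ε hε
    obtain ⟨N, hN⟩ := Metric.uniformCauchySeqOn_iff.mp hunif.uniformCauchySeqOn (ε / 2 * (r / 4))
      (by positivity)
    refine ⟨N, fun n hn k hk y hy => ?_⟩
    have h1 := norm_fderiv_le_of_forall_mem_ball ((hF n).sub (hF k)) hr
      (M := ε / 2 * (r / 4)) (fun w hw => by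
        have := hN n hn k hk w hw
        rw [dist_eq_norm] at this
        exact this.le) hy
    rw [fderiv_sub (hF n y) (hF k y), mul_div_cancel_right₀ _ (by positivity)] at h1
    rw [dist_eq_norm]
    linarith
  have hlim : ∀ y, ∃ L, y ∈ Metric.ball x (r / 2) →
      Filter.Tendsto (fun n => fderiv ℂ (F n) y) Filter.atTop (nhds L) := by
    intro y
    by_cases hy : y ∈ Metric.ball x (r / 2)
    · obtain ⟨L, hL⟩ := cauchySeq_tendsto_of_complete (hc.cauchySeq hy)
      exact ⟨L, fun _ => hL⟩
    · exact ⟨0, fun h => absurd h hy⟩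
  choose g hg using hlim
  have hu := hc.tendstoUniformlyOn_of_tendsto hg
  exact (hasFDerivAt_of_tendstoUniformlyOn Metric.isOpen_ball hu
    (fun n y _ => (hF n y).hasFDerivAt)
    (fun y hy => hunif.tendsto_at (Metric.ball_subset_ball (by linarith) hy))
    (Metric.mem_ball_self (by positivity))).differentiableAt

/-! ### Polynomials in one variable with coefficients polynomial in a -/

/-- Antiderivative, vanishing at `0`, of a polynomial over a `ℂ`-algebra. -/
noncomputable def polyIntegral {R : Type*} [CommRing R] [Algebra ℂ R] (p : Polynomial R) :
    Polynomial R :=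
  p.sum fun n c => Polynomial.monomial (n + 1) ((1 / ((n : ℂ) + 1)) • c)

theorem derivative_polyIntegral {R : Type*} [CommRing R] [Algebra ℂ R] (p : Polynomial R) :
    Polynomial.derivative (polyIntegral p) = p := by
  conv_rhs => rw [← p.sum_monomial_eq]
  rw [polyIntegral, Polynomial.sum_def, Polynomial.sum_def, Polynomial.derivative_sum]
  refine Finset.sum_congr rfl fun n _ => ?_
  rw [Polynomial.derivative_monomial]
  have h : ((n : ℂ) + 1) ≠ 0 := by exact_mod_cast Nat.succ_ne_zero n
  congr 1
  rw [smul_mul_assoc, mul_comm, ← nsmul_eq_mul, ← Nat.cast_smul_eq_nsmul ℂ, smul_smul]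
  push_cast
  rw [one_div, inv_mul_cancel₀ h, one_smul]

theorem coeff_zero_polyIntegral {R : Type*} [CommRing R] [Algebra ℂ R] (p : Polynomial R) :
    (polyIntegral p).coeff 0 = 0 := by
  rw [polyIntegral, Polynomial.sum_def, Polynomial.finsetSum_coeff]
  exact Finset.sum_eq_zero fun n _ => by simp [Polynomial.coeff_monomial]

/-- Evaluation of a polynomial in one variable whose coefficients are polynomials in `a`. -/
noncomputable def evalAt {m : ℕ} (a : Fin m → ℂ) (h : ℂ) :
    Polynomial (MvPolynomial (Fin m) ℂ) →+* ℂ :=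
  Polynomial.eval₂RingHom (MvPolynomial.eval a) h

theorem evalAt_X {m : ℕ} (a : Fin m → ℂ) (h : ℂ) : evalAt a h Polynomial.X = h := by
  simp [evalAt]

theorem evalAt_C {m : ℕ} (a : Fin m → ℂ) (h : ℂ) (c : MvPolynomial (Fin m) ℂ) :
    evalAt a h (Polynomial.C c) = MvPolynomial.eval a c := by
  simp [evalAt]

theorem evalAt_zero {m : ℕ} (a : Fin m → ℂ) (p : Polynomial (MvPolynomial (Fin m) ℂ)) :
    evalAt a 0 p = MvPolynomial.eval a (p.coeff 0) := by
  simp [evalAt, Polynomial.eval₂_at_zero]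

theorem hasDerivAt_evalAt {m : ℕ} (a : Fin m → ℂ) (h : ℂ)
    (p : Polynomial (MvPolynomial (Fin m) ℂ)) :
    HasDerivAt (fun h => evalAt a h p) (evalAt a h (Polynomial.derivative p)) h := by
  have := (p.map (MvPolynomial.eval a)).hasDerivAt h
  simpa [evalAt, Polynomial.eval_map, Polynomial.derivative_map] using this

theorem differentiable_mvPolynomial_eval {m : ℕ} (p : MvPolynomial (Fin m) ℂ) :
    Differentiable ℂ fun a : Fin m → ℂ => MvPolynomial.eval a p := by
  induction p using MvPolynomial.induction_on with
  | C c => simp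
  | add p q hp hq => simp only [map_add]; exact hp.add hq
  | mul_X p j hp =>
    simp only [map_mul, MvPolynomial.eval_X]
    exact hp.mul (differentiable_apply j)

theorem differentiable_evalAt {m : ℕ} (p : Polynomial (MvPolynomial (Fin m) ℂ)) :
    Differentiable ℂ fun x : ℂ × (Fin m → ℂ) => evalAt x.2 x.1 p := by
  induction p using Polynomial.induction_on' with
  | add p q hp hq => simp only [map_add]; exact hp.add hq
  | monomial n c =>
    have : (fun x : ℂ × (Fin m → ℂ) => evalAt x.2 x.1 (Polynomial.monomial n c))
        = fun x => MvPolynomial.eval x.2 c * x.1 ^ n := by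
      ext x; simp [evalAt]
    rw [this]
    exact ((differentiable_mvPolynomial_eval c).comp differentiable_snd).mul
      (differentiable_fst.pow n)

theorem exists_norm_evalAt_le {m : ℕ} {K : Set (Fin m → ℂ)} (hK : IsCompact K) (R : ℝ)
    (p : Polynomial (MvPolynomial (Fin m) ℂ)) :
    ∃ C, 0 ≤ C ∧ ∀ a ∈ K, ∀ h : ℂ, ‖h‖ ≤ R → ‖evalAt a h p‖ ≤ C := by
  obtain ⟨C, hC⟩ := ((isCompact_closedBall (0 : ℂ) R).prod hK).exists_bound_of_continuousOn
    (differentiable_evalAt p).continuous.continuousOn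
  exact ⟨max C 0, le_max_right _ _, fun a ha h hh =>
    (hC (h, a) ⟨by simpa using hh, ha⟩).trans (le_max_left _ _)⟩

theorem exists_norm_evalAt_le_pow {m k : ℕ} {K : Set (Fin m → ℂ)} (hK : IsCompact K)
    {p : Polynomial (MvPolynomial (Fin m) ℂ)} (hp : Polynomial.X ^ k ∣ p) :
    ∃ C, 0 ≤ C ∧ ∀ a ∈ K, ∀ h : ℂ, ‖h‖ ≤ 1 → ‖evalAt a h p‖ ≤ C * ‖h‖ ^ k := by
  obtain ⟨q, rfl⟩ := hp
  obtain ⟨C, hC0, hC⟩ := exists_norm_evalAt_le hK 1 q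
  refine ⟨C, hC0, fun a ha h hh => ?_⟩
  rw [map_mul, map_pow, evalAt_X, norm_mul, norm_pow, mul_comm]
  exact mul_le_mul_of_nonneg_right (hC a ha h hh) (by positivity)

/-! ### A fundamental system entire in (z, a) -/

/-- `V = (y, y', y'')` for a solution `y` of `y''' = φ_a y`. -/
def IsSolution {m : ℕ} (a : Fin m → ℂ) (V : ℂ → Fin 3 → ℂ) : Prop :=
  ∀ z, HasDerivAt (fun w => V w 0) (V z 1) z ∧ HasDerivAt (fun w => V w 1) (V z 2) z ∧
    HasDerivAt (fun w => V w 2) (monicPoly a z * V z 0) z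

/-- The polynomial `φ_a(z)` in `z` and `a`. -/
noncomputable def potential (m : ℕ) : Polynomial (MvPolynomial (Fin m) ℂ) :=
  Polynomial.X ^ m +
    ∑ j : Fin m, Polynomial.C (MvPolynomial.X j) * Polynomial.X ^ (m - 1 - (j : ℕ))

theorem evalAt_potential {m : ℕ} (a : Fin m → ℂ) (z : ℂ) :
    evalAt a z (potential m) = monicPoly a z := by
  simp [potential, monicPoly, evalAt_X, evalAt_C]

/-- Picard iterates for the system of `(y, y', y'')` with initial vector the `i`-th unit vector. -/
noncomputable def picard (m : ℕ) (i : Fin 3) : ℕ → Fin 3 → Polynomial (MvPolynomial (Fin m) ℂ)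
  | 0 => fun c => if i = c then 1 else 0
  | k + 1 => ![polyIntegral (picard m i k 1), polyIntegral (picard m i k 2),
      polyIntegral (potential m * picard m i k 0)]

/-- Integration along the segment from 0 to z, compared with the explicit primitive of the bound.
This is the inductive step behind the factorial decay of the Picard terms. -/
theorem norm_evalAt_le_of_derivative {m : ℕ} (a : Fin m → ℂ)
    (p : Polynomial (MvPolynomial (Fin m) ℂ)) (hp : p.coeff 0 = 0) {L ρ : ℝ} (k : ℕ)
    (hb : ∀ z : ℂ, ‖z‖ ≤ ρ → ‖evalAt a z (Polynomial.derivative p)‖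
      ≤ L * ((L * ‖z‖) ^ k / k.factorial)) (z : ℂ) (hz : ‖z‖ ≤ ρ) :
    ‖evalAt a z p‖ ≤ (L * ‖z‖) ^ (k + 1) / (k + 1).factorial := by
  have hf : ∀ t : ℝ, HasDerivAt (fun t : ℝ => evalAt a (t * z) p)
      (evalAt a (t * z) (Polynomial.derivative p) * z) t := by
    intro t
    have h1 : HasDerivAt (fun t : ℝ => (t : ℂ) * z) z t := by
      simpa using (Complex.ofRealCLM.hasDerivAt (x := t)).mul_const z
    exact (hasDerivAt_evalAt a (t * z) p).comp t h1
  have hB : ∀ t : ℝ, HasDerivAt (fun t : ℝ => (L * ‖z‖) ^ (k + 1) * t ^ (k + 1)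
      / (k + 1).factorial) (L * ((L * (‖z‖ * t)) ^ k / k.factorial) * ‖z‖) t := by
    intro t
    have := ((hasDerivAt_pow (k + 1) t).const_mul ((L * ‖z‖) ^ (k + 1))).div_const
      ((k + 1).factorial : ℝ)
    convert! this using 1
    rw [Nat.factorial_succ]
    push_cast
    have h1 : ((k : ℝ) + 1) ≠ 0 := by positivity
    have h2 : (k.factorial : ℝ) ≠ 0 := by positivity
    field_simp
    ring_nf
  have := image_norm_le_of_norm_deriv_right_le_deriv_boundary (a := 0) (b := 1)
    (fun t _ => (hf t).continuousAt.continuousWithinAt)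
    (fun t _ => (hf t).hasDerivWithinAt) (by simp [evalAt_zero, hp]) hB (by
      intro t ht
      have ht0 : 0 ≤ t := ht.1
      have h1 : ‖(t : ℂ) * z‖ = ‖z‖ * t := by
        rw [norm_mul, Complex.norm_real, Real.norm_of_nonneg ht0, mul_comm]
      rw [norm_mul]
      refine mul_le_mul_of_nonneg_right ?_ (norm_nonneg z)
      rw [← h1]
      apply hb
      rw [h1]
      nlinarith [norm_nonneg z, ht.2]) (Set.right_mem_Icc.mpr zero_le_one)
  simpa using this

/-- The condition 1 ≤ L lets the two rows of the system with coefficient 1 share the bound of the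
row containing the potential. -/
theorem norm_evalAt_picard_le {m : ℕ} (a : Fin m → ℂ) (i : Fin 3) {L ρ : ℝ} (hL : 1 ≤ L)
    (hφ : ∀ z : ℂ, ‖z‖ ≤ ρ → ‖monicPoly a z‖ ≤ L) (k : ℕ) (c : Fin 3) (z : ℂ) (hz : ‖z‖ ≤ ρ) :
    ‖evalAt a z (picard m i k c)‖ ≤ (L * ‖z‖) ^ k / k.factorial := by
  induction k generalizing c z with
  | zero =>
    simp only [picard]
    split_ifs <;> simp
  | succ k ih =>
    have h0 : ∀ w : ℂ, 0 ≤ (L * ‖w‖) ^ k / k.factorial := fun w => by positivity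
    have h1 : ∀ (c : Fin 3) (w : ℂ), ‖w‖ ≤ ρ → ‖evalAt a w (picard m i k c)‖
        ≤ L * ((L * ‖w‖) ^ k / k.factorial) := fun c w hw =>
      (ih c w hw).trans (le_mul_of_one_le_left (h0 w) hL)
    fin_cases c <;> simp only [picard, Fin.zero_eta, Fin.mk_one, Fin.reduceFinMk,
      Matrix.cons_val_zero, Matrix.cons_val_one, Matrix.cons_val]
    · refine norm_evalAt_le_of_derivative a _ (coeff_zero_polyIntegral _) k (fun w hw => ?_) z hz
      rw [derivative_polyIntegral]; exact h1 1 w hw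
    · refine norm_evalAt_le_of_derivative a _ (coeff_zero_polyIntegral _) k (fun w hw => ?_) z hz
      rw [derivative_polyIntegral]; exact h1 2 w hw
    · refine norm_evalAt_le_of_derivative a _ (coeff_zero_polyIntegral _) k (fun w hw => ?_) z hz
      rw [derivative_polyIntegral, map_mul, evalAt_potential, norm_mul]
      exact mul_le_mul (hφ w hw) (ih 0 w hw) (norm_nonneg _) (by linarith)

theorem exists_monicPoly_bound {m : ℕ} {K : Set (Fin m → ℂ)} (hK : IsCompact K) (ρ : ℝ) :
    ∃ L, 1 ≤ L ∧ ∀ a ∈ K, ∀ z : ℂ, ‖z‖ ≤ ρ → ‖monicPoly a z‖ ≤ L := by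
  obtain ⟨C, -, hC⟩ := exists_norm_evalAt_le hK ρ (potential m)
  refine ⟨max C 1, le_max_right _ _, fun a ha z hz => ?_⟩
  rw [← evalAt_potential]
  exact (hC a ha z hz).trans (le_max_left _ _)

theorem hasDerivAt_tsum_evalAt {m : ℕ} (a : Fin m → ℂ)
    (p q : ℕ → Polynomial (MvPolynomial (Fin m) ℂ)) (hp0 : Polynomial.derivative (p 0) = 0)
    (hp : ∀ k, Polynomial.derivative (p (k + 1)) = q k) {u v : ℕ → ℝ}
    {ρ : ℝ} (hρ : 0 < ρ) (hu : Summable u) (hv : Summable v)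
    (hpu : ∀ k, ∀ z : ℂ, ‖z‖ ≤ ρ → ‖evalAt a z (p k)‖ ≤ u k)
    (hqv : ∀ k, ∀ z : ℂ, ‖z‖ ≤ ρ → ‖evalAt a z (q k)‖ ≤ v k) {z : ℂ} (hz : ‖z‖ < ρ) :
    HasDerivAt (fun w => ∑' k, evalAt a w (p k)) (∑' k, evalAt a z (q k)) z := by
  -- Differentiation shifts the series by one index; the term of index 0 contributes nothing.
  let v' : ℕ → ℝ := fun n => Nat.rec 0 (fun k _ => v k) n
  have hv' : Summable v' := (summable_nat_add_iff 1).mp hv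
  have hb : ∀ k, ∀ w : ℂ, ‖w‖ ≤ ρ → ‖evalAt a w (Polynomial.derivative (p k))‖ ≤ v' k := by
    intro k w hw
    cases k with
    | zero => simp [hp0, v']
    | succ k => rw [hp]; exact hqv k w hw
  have h := hasDerivAt_tsum_of_isPreconnected (u := v') hv' (Metric.isOpen_ball (x := (0 : ℂ)))
    (convex_ball (0 : ℂ) ρ).isPreconnected
    (g := fun k w => evalAt a w (p k)) (g' := fun k w => evalAt a w (Polynomial.derivative (p k)))
    (fun k w _ => hasDerivAt_evalAt a w (p k))
    (fun k w hw => hb k w (by simpa using (Metric.mem_ball.mp hw).le))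
    (Metric.mem_ball_self hρ)
    (Summable.of_norm_bounded hu fun k => hpu k 0 (by simpa using hρ.le))
    (y := z) (by simpa using hz)
  have hs : Summable fun k => evalAt a z (Polynomial.derivative (p k)) :=
    Summable.of_norm_bounded hv' fun k => hb k z hz.le
  rw [hs.tsum_eq_zero_add, hp0, map_zero, zero_add] at h
  simpa only [hp] using h

/-- `picard m i k` is the k-th increment, so the solution is the sum over k. Every increment is a
polynomial in z and a, and the factorial bound is locally uniform in both; this gives joint
holomorphy. -/
theorem exists_fundamental_system (m : ℕ) : ∃ Φ : Fin 3 → ℂ → (Fin m → ℂ) → Fin 3 → ℂ,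
    (∀ i a, IsSolution a fun z => Φ i z a) ∧
    (∀ i c, Differentiable ℂ fun x : ℂ × (Fin m → ℂ) => Φ i x.1 x.2 c) ∧
    ∀ i a c, Φ i 0 a c = if i = c then 1 else 0 := by
  refine ⟨fun i z a c => ∑' k, evalAt a z (picard m i k c), fun i a z => ?_, fun i c => ?_,
    fun i a c => ?_⟩
  · obtain ⟨L, hL, hφ⟩ := exists_monicPoly_bound (isCompact_singleton (x := a)) (‖z‖ + 1)
    have hφ := hφ a rfl
    have hρ : 0 < ‖z‖ + 1 := by positivity
    have hs := Real.summable_pow_div_factorial (L * (‖z‖ + 1))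
    have hb : ∀ c k, ∀ w : ℂ, ‖w‖ ≤ ‖z‖ + 1 → ‖evalAt a w (picard m i k c)‖
        ≤ (L * (‖z‖ + 1)) ^ k / k.factorial := fun c k w hw =>
      (norm_evalAt_picard_le a i hL hφ k c w hw).trans (by gcongr)
    have hd : ∀ c, Polynomial.derivative (picard m i 0 c) = 0 := by
      intro c; simp only [picard]; split_ifs <;> simp
    refine ⟨?_, ?_, ?_⟩
    · exact hasDerivAt_tsum_evalAt a (fun k => picard m i k 0) (fun k => picard m i k 1) (hd 0)
        (fun k => by simp [picard, derivative_polyIntegral]) hρ hs hs (hb 0) (hb 1) (by linarith)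
    · exact hasDerivAt_tsum_evalAt a (fun k => picard m i k 1) (fun k => picard m i k 2) (hd 1)
        (fun k => by simp [picard, derivative_polyIntegral]) hρ hs hs (hb 1) (hb 2) (by linarith)
    · have := hasDerivAt_tsum_evalAt a (fun k => picard m i k 2)
        (fun k => potential m * picard m i k 0) (hd 2)
        (fun k => by simp [picard, derivative_polyIntegral]) hρ hs (hs.mul_left L) (hb 2)
        (fun k w hw => by
          rw [map_mul, evalAt_potential, norm_mul]
          exact mul_le_mul (hφ w hw) (hb 0 k w hw) (norm_nonneg _) (by linarith))
        (z := z) (by linarith)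
      simpa only [map_mul, evalAt_potential, tsum_mul_left] using this
  · refine differentiable_of_locally_tendstoUniformlyOn
      (F := fun n (x : ℂ × (Fin m → ℂ)) => ∑ k ∈ Finset.range n, evalAt x.2 x.1 (picard m i k c))
      (fun n => ?_) (fun x => ⟨1, one_pos, ?_⟩)
    · exact Differentiable.fun_sum fun k _ => differentiable_evalAt _
    · obtain ⟨L, hL, hφ⟩ := exists_monicPoly_bound (isCompact_closedBall x.2 1) (‖x.1‖ + 1)
      refine tendstoUniformlyOn_tsum_nat
        (Real.summable_pow_div_factorial (L * (‖x.1‖ + 1))) fun k y hy => ?_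
      rw [← ball_prod_same] at hy
      have h1 : ‖y.1‖ ≤ ‖x.1‖ + 1 := by
        have := Metric.mem_ball.mp hy.1
        rw [dist_eq_norm] at this
        have h2 := norm_add_le (y.1 - x.1) x.1
        rw [sub_add_cancel] at h2
        linarith
      refine (norm_evalAt_picard_le y.2 i hL
        (hφ y.2 (Metric.ball_subset_closedBall hy.2)) k c y.1 h1).trans ?_
      gcongr
  · show ∑' k, evalAt a 0 (picard m i k c) = _
    rw [tsum_eq_single 0]
    · simp only [picard]; split_ifs <;> simp
    · intro k hk
      obtain ⟨k, rfl⟩ := Nat.exists_eq_succ_of_ne_zero hk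
      rw [evalAt_zero]
      fin_cases c <;> simp [picard, coeff_zero_polyIntegral]

/-! ### The formal data, their truncations and residuals -/

section FormalData

open PowerSeries

/-- The formal series of `z^{-m/3} y'/y` in `h = z^{-1/3}`. -/
noncomputable def slopeSeries (m : ℕ) : (MvPolynomial (Fin m) ℂ)⟦X⟧ :=
  (exists_formal_riccati m).choose

/-- The formal series of `z^{-2m/3} y''/y` in `h = z^{-1/3}`. -/
noncomputable def bendSeries (m : ℕ) : (MvPolynomial (Fin m) ℂ)⟦X⟧ :=
  (exists_formal_riccati m).choose_spec.choose

theorem constantCoeff_slopeSeries (m : ℕ) : constantCoeff (slopeSeries m) = 1 :=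
  (exists_formal_riccati m).choose_spec.choose_spec.1

theorem slopeSeries_eq (m : ℕ) : bendSeries m - slopeSeries m ^ 2 -
    X ^ (m + 3) * (C (MvPolynomial.C ((m : ℂ) / 3)) * slopeSeries m + eulerOp (slopeSeries m)) = 0 :=
  (exists_formal_riccati m).choose_spec.choose_spec.2.1

theorem bendSeries_eq (m : ℕ) :
    ((normalizedPotential m : Polynomial (MvPolynomial (Fin m) ℂ)) : (MvPolynomial (Fin m) ℂ)⟦X⟧)
      - slopeSeries m * bendSeries m -
      X ^ (m + 3) * (C (MvPolynomial.C (2 * (m : ℂ) / 3)) * bendSeries m + eulerOp (bendSeries m)) = 0 :=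
  (exists_formal_riccati m).choose_spec.choose_spec.2.2

theorem constantCoeff_bendSeries (m : ℕ) : constantCoeff (bendSeries m) = 1 := by
  have h := congrArg constantCoeff (slopeSeries_eq m)
  simp [constantCoeff_slopeSeries] at h
  exact sub_eq_zero.mp h

/-- The part of the formal exponent in negative powers of `z`. -/
noncomputable def tailSeries (m : ℕ) : (MvPolynomial (Fin m) ℂ)⟦X⟧ :=
  -- At k = 0 the factor -3/0 is 0, so the tail has no constant term; the coefficient of index m+3
  -- is reserved for the logarithm.
  mk fun k => MvPolynomial.C (-3 / (k : ℂ)) * coeff (k + (m + 3)) (slopeSeries m)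

/-- The formal exponential of `tailSeries m`. -/
noncomputable def amplitudeSeries (m : ℕ) : (MvPolynomial (Fin m) ℂ)⟦X⟧ :=
  (exists_formal_exp (d⁄dX _ (tailSeries m))).choose

theorem constantCoeff_amplitudeSeries (m : ℕ) : constantCoeff (amplitudeSeries m) = 1 :=
  (exists_formal_exp (d⁄dX _ (tailSeries m))).choose_spec.1

theorem derivative_amplitudeSeries (m : ℕ) :
    d⁄dX _ (amplitudeSeries m) = d⁄dX _ (tailSeries m) * amplitudeSeries m :=
  (exists_formal_exp (d⁄dX _ (tailSeries m))).choose_spec.2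

theorem X_pow_dvd_coe_iff {R : Type*} [CommRing R] {n : ℕ} {p : Polynomial R} :
    (X : R⟦X⟧) ^ n ∣ (p : R⟦X⟧) ↔ Polynomial.X ^ n ∣ p := by
  rw [X_pow_dvd_iff, Polynomial.X_pow_dvd_iff]
  simp only [Polynomial.coeff_coe]

theorem X_pow_dvd_sub_trunc {R : Type*} [CommRing R] (n : ℕ) (f : R⟦X⟧) :
    X ^ n ∣ f - ((trunc n f : Polynomial R) : R⟦X⟧) := by
  rw [X_pow_dvd_iff]
  intro i hi
  rw [map_sub, coeff_coe_trunc_of_lt hi, sub_self]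

/-- The operator `z d/dz` on polynomials in `h = z^{-1/3}`. -/
noncomputable def eulerPoly {m : ℕ} (p : Polynomial (MvPolynomial (Fin m) ℂ)) :
    Polynomial (MvPolynomial (Fin m) ℂ) :=
  Polynomial.C (MvPolynomial.C (-1 / 3)) * (Polynomial.X * Polynomial.derivative p)

theorem coe_eulerPoly {m : ℕ} (p : Polynomial (MvPolynomial (Fin m) ℂ)) :
    ((eulerPoly p : Polynomial (MvPolynomial (Fin m) ℂ)) : (MvPolynomial (Fin m) ℂ)⟦X⟧)
      = eulerOp (p : (MvPolynomial (Fin m) ℂ)⟦X⟧) := by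
  simp only [eulerPoly, eulerOp, Polynomial.coe_mul, Polynomial.coe_C, Polynomial.coe_X,
    derivative_coe]

/-- Residual of the first formal equation for truncated series. -/
noncomputable def residualOne (m n : ℕ) : Polynomial (MvPolynomial (Fin m) ℂ) :=
  trunc n (bendSeries m) - trunc n (slopeSeries m) ^ 2 - Polynomial.X ^ (m + 3) *
    (Polynomial.C (MvPolynomial.C ((m : ℂ) / 3)) * trunc n (slopeSeries m)
      + eulerPoly (trunc n (slopeSeries m)))

/-- Residual of the second formal equation for truncated series. -/
noncomputable def residualTwo (m n : ℕ) : Polynomial (MvPolynomial (Fin m) ℂ) :=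
  normalizedPotential m - trunc n (slopeSeries m) * trunc n (bendSeries m) - Polynomial.X ^ (m + 3) *
    (Polynomial.C (MvPolynomial.C (2 * (m : ℂ) / 3)) * trunc n (bendSeries m)
      + eulerPoly (trunc n (bendSeries m)))

/-- The full series has residual zero, so the residual of the truncation is a combination of
truncation errors, all of order n; the Euler operator does not lower the order. -/
theorem X_pow_dvd_residualOne (m n : ℕ) : Polynomial.X ^ n ∣ residualOne m n := by
  rw [← X_pow_dvd_coe_iff, residualOne]
  have h1 := X_pow_dvd_sub_trunc n (slopeSeries m)
  have h2 := X_pow_dvd_sub_trunc n (bendSeries m)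
  have h3 := X_pow_dvd_eulerOp h1
  rw [eulerOp_sub] at h3
  have h := slopeSeries_eq m
  simp only [Polynomial.coe_sub, Polynomial.coe_mul, Polynomial.coe_pow, Polynomial.coe_add,
    Polynomial.coe_C, Polynomial.coe_X, coe_eulerPoly]
  set S : (MvPolynomial (Fin m) ℂ)⟦X⟧ :=
    ((trunc n (slopeSeries m) : Polynomial (MvPolynomial (Fin m) ℂ)) : (MvPolynomial (Fin m) ℂ)⟦X⟧)
  set T : (MvPolynomial (Fin m) ℂ)⟦X⟧ :=
    ((trunc n (bendSeries m) : Polynomial (MvPolynomial (Fin m) ℂ)) : (MvPolynomial (Fin m) ℂ)⟦X⟧)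
  have key : T - S ^ 2 - X ^ (m + 3) * (C (MvPolynomial.C ((m : ℂ) / 3)) * S + eulerOp S)
      = (slopeSeries m - S) * (slopeSeries m + S) - (bendSeries m - T)
        + (slopeSeries m - S) * (X ^ (m + 3) * C (MvPolynomial.C ((m : ℂ) / 3)))
        + (eulerOp (slopeSeries m) - eulerOp S) * X ^ (m + 3) := by
    linear_combination h
  rw [key]
  exact dvd_add (dvd_add (dvd_sub (h1.mul_right _) h2) (h1.mul_right _)) (h3.mul_right _)

theorem X_pow_dvd_residualTwo (m n : ℕ) : Polynomial.X ^ n ∣ residualTwo m n := by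
  rw [← X_pow_dvd_coe_iff, residualTwo]
  have h1 := X_pow_dvd_sub_trunc n (slopeSeries m)
  have h2 := X_pow_dvd_sub_trunc n (bendSeries m)
  have h3 := X_pow_dvd_eulerOp h2
  rw [eulerOp_sub] at h3
  have h := bendSeries_eq m
  simp only [Polynomial.coe_sub, Polynomial.coe_mul, Polynomial.coe_pow, Polynomial.coe_add,
    Polynomial.coe_C, Polynomial.coe_X, coe_eulerPoly]
  set S : (MvPolynomial (Fin m) ℂ)⟦X⟧ :=
    ((trunc n (slopeSeries m) : Polynomial (MvPolynomial (Fin m) ℂ)) : (MvPolynomial (Fin m) ℂ)⟦X⟧)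
  set T : (MvPolynomial (Fin m) ℂ)⟦X⟧ :=
    ((trunc n (bendSeries m) : Polynomial (MvPolynomial (Fin m) ℂ)) : (MvPolynomial (Fin m) ℂ)⟦X⟧)
  set Ψ : (MvPolynomial (Fin m) ℂ)⟦X⟧ := ((normalizedPotential m :
    Polynomial (MvPolynomial (Fin m) ℂ)) : (MvPolynomial (Fin m) ℂ)⟦X⟧)
  have key : Ψ - S * T - X ^ (m + 3) * (C (MvPolynomial.C (2 * (m : ℂ) / 3)) * T + eulerOp T)
      = (slopeSeries m - S) * bendSeries m + (bendSeries m - T) * S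
        + (bendSeries m - T) * (X ^ (m + 3) * C (MvPolynomial.C (2 * (m : ℂ) / 3)))
        + (eulerOp (bendSeries m) - eulerOp T) * X ^ (m + 3) := by
    linear_combination h
  rw [key]
  exact dvd_add (dvd_add (dvd_add (h1.mul_right _) (h2.mul_right _)) (h2.mul_right _))
    (h3.mul_right _)

theorem X_dvd_trunc_sub_one {m n : ℕ} (hn : 1 ≤ n) {f : (MvPolynomial (Fin m) ℂ)⟦X⟧}
    (hf : constantCoeff f = 1) : Polynomial.X ^ 1 ∣ trunc n f - 1 := by
  rw [Polynomial.X_pow_dvd_iff]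
  intro d hd
  obtain rfl : d = 0 := by omega
  rw [Polynomial.coeff_sub, coeff_trunc, if_pos (by omega), coeff_zero_eq_constantCoeff_apply, hf]
  simp

theorem evalAt_trunc {m : ℕ} (a : Fin m → ℂ) (h : ℂ) (n : ℕ)
    (f : (MvPolynomial (Fin m) ℂ)⟦X⟧) :
    evalAt a h (trunc n f)
      = ∑ i ∈ Finset.range n, MvPolynomial.eval a (coeff i f) * h ^ i :=
  eval₂_trunc_eq_sum_range h _ n f

end FormalData

/-! ### Logarithmic coordinate and phase -/

/-- `X = z^{(m+3)/3}` as a function of `ζ = log z`. -/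
noncomputable def big (m : ℕ) (ζ : ℂ) : ℂ := Complex.exp (((m : ℂ) + 3) / 3 * ζ)

/-- `h = z^{-1/3}` as a function of `ζ = log z`. -/
noncomputable def small (ζ : ℂ) : ℂ := Complex.exp (-ζ / 3)

theorem small_ne_zero (ζ : ℂ) : small ζ ≠ 0 := Complex.exp_ne_zero _

theorem big_ne_zero (m : ℕ) (ζ : ℂ) : big m ζ ≠ 0 := Complex.exp_ne_zero _

theorem small_pow_mul_big (m : ℕ) (ζ : ℂ) : small ζ ^ (m + 3) * big m ζ = 1 := by
  rw [small, big, ← Complex.exp_nat_mul, ← Complex.exp_add, ← Complex.exp_zero]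
  congr 1; push_cast; ring

theorem small_pow_mul_big' (m : ℕ) (ζ : ℂ) : small ζ ^ m * big m ζ = Complex.exp ζ := by
  rw [small, big, ← Complex.exp_nat_mul, ← Complex.exp_add]
  congr 1; ring

theorem exp_mul_small_pow (ζ : ℂ) : Complex.exp ζ * small ζ ^ 3 = 1 := by
  rw [small, ← Complex.exp_nat_mul, ← Complex.exp_add, ← Complex.exp_zero]
  congr 1; push_cast; ring

theorem hasDerivAt_small (ζ : ℂ) : HasDerivAt small (-1 / 3 * small ζ) ζ := by
  have h : HasDerivAt (fun ζ : ℂ => -ζ / 3) (-1 / 3) ζ := ((hasDerivAt_id ζ).neg).div_const 3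
  have := h.cexp
  rw [mul_comm] at this
  exact this

theorem hasDerivAt_big (m : ℕ) (ζ : ℂ) :
    HasDerivAt (big m) (((m : ℂ) + 3) / 3 * big m ζ) ζ := by
  have h : HasDerivAt (fun ζ : ℂ => ((m : ℂ) + 3) / 3 * ζ) (((m : ℂ) + 3) / 3) ζ := by
    simpa using (hasDerivAt_id ζ).const_mul (((m : ℂ) + 3) / 3)
  have := h.cexp
  rw [mul_comm] at this
  exact this

theorem hasDerivAt_evalAt_small {m : ℕ} (a : Fin m → ℂ) (ζ : ℂ)
    (p : Polynomial (MvPolynomial (Fin m) ℂ)) :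
    HasDerivAt (fun ζ => evalAt a (small ζ) p) (evalAt a (small ζ) (eulerPoly p)) ζ := by
  have := (hasDerivAt_evalAt a (small ζ) p).comp ζ (hasDerivAt_small ζ)
  convert! this using 1
  simp only [eulerPoly, map_mul, evalAt_C, evalAt_X, MvPolynomial.eval_C]
  ring

theorem evalAt_normalizedPotential {m : ℕ} (a : Fin m → ℂ) (ζ : ℂ) :
    evalAt a (small ζ) (normalizedPotential m)
      = small ζ ^ (3 * m) * monicPoly a (Complex.exp ζ) := by
  have hz := exp_mul_small_pow ζ
  simp only [normalizedPotential, monicPoly, map_add, map_one, map_sum, map_mul, map_pow, evalAt_X,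
    evalAt_C, MvPolynomial.eval_X]
  rw [mul_add, Finset.mul_sum]
  congr 1
  · rw [pow_mul, ← mul_pow, mul_comm, hz, one_pow]
  · refine Finset.sum_congr rfl fun j _ => ?_
    have hj := j.2
    rw [show 3 * m = 3 * ((j : ℕ) + 1) + 3 * (m - 1 - j) by omega, pow_add _ (3 * ((j : ℕ) + 1)),
      pow_mul _ _ (m - 1 - (j : ℕ))]
    have : (small ζ ^ 3) ^ (m - 1 - (j : ℕ)) * Complex.exp ζ ^ (m - 1 - (j : ℕ)) = 1 := by
      rw [← mul_pow, mul_comm, hz, one_pow]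
    linear_combination (-(a j) * small ζ ^ (3 * ((j : ℕ) + 1))) * this

/-- The coefficients `A_{m,N}` of the exponent. -/
noncomputable def expoCoeff (m N : ℕ) : MvPolynomial (Fin m) ℂ :=
  MvPolynomial.C (3 / ((m : ℂ) + 3 - N)) * PowerSeries.coeff N (slopeSeries m)

/-- The exponent `r_m`. -/
noncomputable def expoLog (m : ℕ) : MvPolynomial (Fin m) ℂ := PowerSeries.coeff (m + 3) (slopeSeries m)

/-- The exponent `E_m(z,a)` as a function of `ζ = log z`. -/
noncomputable def expo {m : ℕ} (a : Fin m → ℂ) (ζ : ℂ) : ℂ :=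
  3 / ((m : ℂ) + 3) * Complex.exp (((m : ℂ) + 3) / 3 * ζ)
    + ∑ N ∈ Finset.Icc 1 (m + 2),
        MvPolynomial.eval a (expoCoeff m N) * Complex.exp (((m : ℂ) + 3 - (N : ℂ)) / 3 * ζ)

/-- The formal exponent, truncated after `k` negative powers. -/
noncomputable def phase {m : ℕ} (k : ℕ) (a : Fin m → ℂ) (ζ : ℂ) : ℂ :=
  expo a ζ + MvPolynomial.eval a (expoLog m) * ζ
    + evalAt a (small ζ) (PowerSeries.trunc (k + 1) (tailSeries m))

/-- The weight -3/k in the tail is chosen to cancel the factor -k/3 that z d/dz puts on h^k. -/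
theorem evalAt_eulerPoly_tail {m : ℕ} (k : ℕ) (a : Fin m → ℂ) (h : ℂ) :
    evalAt a h (eulerPoly (PowerSeries.trunc (k + 1) (tailSeries m)))
      = ∑ i ∈ Finset.range k,
        MvPolynomial.eval a (PowerSeries.coeff (m + 4 + i) (slopeSeries m)) * h ^ (i + 1) := by
  have h1 : Polynomial.derivative (PowerSeries.trunc (k + 1) (tailSeries m))
      = PowerSeries.trunc k (PowerSeries.derivative _ (tailSeries m)) := by
    rw [PowerSeries.trunc_derivative]
  simp only [eulerPoly, map_mul, evalAt_C, evalAt_X, MvPolynomial.eval_C, h1, evalAt_trunc,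
    Finset.mul_sum]
  refine Finset.sum_congr rfl fun i _ => ?_
  rw [PowerSeries.coeff_derivative, tailSeries, PowerSeries.coeff_mk]
  simp only [map_mul, map_add, MvPolynomial.eval_C, map_natCast, map_one]
  have : ((i : ℂ) + 1) ≠ 0 := by exact_mod_cast Nat.succ_ne_zero i
  rw [show i + 1 + (m + 3) = m + 4 + i by ring]
  push_cast
  field_simp
  ring

/-- The phase is a primitive of X σ in ζ, with σ truncated. The sum splits at index m+3, where X
h^{m+3} = 1 makes the term constant and its primitive linear in ζ = log z. -/
theorem hasDerivAt_phase {m : ℕ} (k : ℕ) (a : Fin m → ℂ) (ζ : ℂ) :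
    HasDerivAt (phase k a)
      (big m ζ * evalAt a (small ζ) (PowerSeries.trunc (m + 4 + k) (slopeSeries m))) ζ := by
  have hexp : ∀ c : ℂ, HasDerivAt (fun ζ : ℂ => Complex.exp (c * ζ)) (c * Complex.exp (c * ζ)) ζ :=
    by
    intro c
    have := ((hasDerivAt_id ζ).const_mul c).cexp
    simpa [mul_comm] using this
  have h1 := (((hexp (((m : ℂ) + 3) / 3)).const_mul (3 / ((m : ℂ) + 3))).add
    (HasDerivAt.fun_sum (u := Finset.Icc 1 (m + 2)) fun N _ =>
      (hexp (((m : ℂ) + 3 - (N : ℂ)) / 3)).const_mul (MvPolynomial.eval a (expoCoeff m N))))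
  have h2 := (h1.add ((hasDerivAt_id ζ).const_mul (MvPolynomial.eval a (expoLog m)))).add
    (hasDerivAt_evalAt_small a ζ (PowerSeries.trunc (k + 1) (tailSeries m)))
  convert! h2 using 1
  have hm3 : ((m : ℂ) + 3) ≠ 0 := by exact_mod_cast (by omega : m + 3 ≠ 0)
  have hX := small_pow_mul_big m ζ
  have hpow : ∀ N : ℕ, Complex.exp (((m : ℂ) + 3 - (N : ℂ)) / 3 * ζ) = big m ζ * small ζ ^ N := by
    intro N
    rw [small, big, ← Complex.exp_nat_mul, ← Complex.exp_add]
    congr 1; ring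
  rw [evalAt_trunc, evalAt_eulerPoly_tail, show m + 4 + k = (m + 2 + 1) + (1 + k) by ring,
    Finset.sum_range_add _ (m + 2 + 1) (1 + k), Finset.sum_range_succ' _ (m + 2),
    Finset.sum_range_add _ 1 k, Finset.sum_range_one]
  have hIcc : ∀ f : ℕ → ℂ, ∑ N ∈ Finset.Icc 1 (m + 2), f N = ∑ i ∈ Finset.range (m + 2), f (i + 1) :=
    by
    intro f
    rw [Finset.range_eq_Ico, Finset.sum_Ico_add' f 0 (m + 2) 1]
    rfl
  rw [hIcc]
  have e1 : ∀ i ∈ Finset.range (m + 2), MvPolynomial.eval a (expoCoeff m (i + 1)) *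
      (((m : ℂ) + 3 - ((i + 1 : ℕ) : ℂ)) / 3 *
        Complex.exp (((m : ℂ) + 3 - ((i + 1 : ℕ) : ℂ)) / 3 * ζ))
      = big m ζ * (MvPolynomial.eval a (PowerSeries.coeff (i + 1) (slopeSeries m)) * small ζ ^ (i + 1)) := by
    intro i hi
    have hi := Finset.mem_range.mp hi
    have hne : ((m : ℂ) + 3 - ((i + 1 : ℕ) : ℂ)) ≠ 0 := by
      rw [sub_ne_zero]
      exact_mod_cast (by omega : m + 3 ≠ i + 1)
    rw [hpow, expoCoeff, map_mul, MvPolynomial.eval_C]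
    field_simp
  rw [Finset.sum_congr rfl e1]
  have h0 : PowerSeries.coeff 0 (slopeSeries m) = 1 := by
    rw [PowerSeries.coeff_zero_eq_constantCoeff_apply, constantCoeff_slopeSeries]
  rw [h0, ← Finset.mul_sum, show Complex.exp (((m : ℂ) + 3) / 3 * ζ) = big m ζ from rfl]
  have e2 : ∀ i ∈ Finset.range k, MvPolynomial.eval a (PowerSeries.coeff (m + 2 + 1 + (1 + i)) (slopeSeries m))
      * small ζ ^ (m + 2 + 1 + (1 + i)) = small ζ ^ (m + 3) *
      (MvPolynomial.eval a (PowerSeries.coeff (m + 4 + i) (slopeSeries m)) * small ζ ^ (i + 1)) := by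
    intro i _
    rw [show m + 2 + 1 + (1 + i) = m + 4 + i by ring, show m + 4 + i = m + 3 + (i + 1) by ring,
      pow_add]
    ring
  rw [Finset.sum_congr rfl e2, ← Finset.mul_sum]
  have e3 : 3 / ((m : ℂ) + 3) * (((m : ℂ) + 3) / 3 * big m ζ) = big m ζ := by field_simp
  rw [e3, expoLog, map_one, show m + 2 + 1 + 0 = m + 3 by rfl]
  linear_combination (MvPolynomial.eval a (PowerSeries.coeff (m + 3) (slopeSeries m)) +
    ∑ i ∈ Finset.range k, MvPolynomial.eval a (PowerSeries.coeff (m + 4 + i) (slopeSeries m))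
      * small ζ ^ (i + 1)) * hX

/-! ### Rescaled defects and their differential system -/

/-- The function `y` divided by its approximation `exp (phase k a ζ)`. -/
noncomputable def coordU {m : ℕ} (k : ℕ) (a : Fin m → ℂ) (V : ℂ → Fin 3 → ℂ) (ζ : ℂ) : ℂ :=
  V (Complex.exp ζ) 0 * Complex.exp (-phase k a ζ)

/-- The rescaled defect of `y'` with respect to the approximate logarithmic derivative. -/
noncomputable def coordP {m : ℕ} (k : ℕ) (a : Fin m → ℂ) (V : ℂ → Fin 3 → ℂ) (ζ : ℂ) : ℂ :=
  big m ζ ^ 2 * (small ζ ^ m * V (Complex.exp ζ) 1 * Complex.exp (-phase k a ζ)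
    - evalAt a (small ζ) (PowerSeries.trunc (m + 4 + k) (slopeSeries m)) * coordU k a V ζ)

/-- The rescaled defect of `y''` with respect to its approximation. -/
noncomputable def coordS {m : ℕ} (k : ℕ) (a : Fin m → ℂ) (V : ℂ → Fin 3 → ℂ) (ζ : ℂ) : ℂ :=
  big m ζ ^ 2 * (small ζ ^ (2 * m) * V (Complex.exp ζ) 2 * Complex.exp (-phase k a ζ)
    - evalAt a (small ζ) (PowerSeries.trunc (m + 4 + k) (bendSeries m)) * coordU k a V ζ)

/-- A combination of `coordP` and `coordS` that decouples to leading order. -/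
noncomputable def coordG {m : ℕ} (k : ℕ) (a : Fin m → ℂ) (w : ℂ) (V : ℂ → Fin 3 → ℂ) (ζ : ℂ) : ℂ :=
  coordP k a V ζ + w * coordS k a V ζ

theorem hasDerivAt_comp_exp {f : ℂ → ℂ} {f' ζ : ℂ} (h : HasDerivAt f f' (Complex.exp ζ)) :
    HasDerivAt (fun ζ => f (Complex.exp ζ)) (f' * Complex.exp ζ) ζ :=
  h.comp ζ (Complex.hasDerivAt_exp ζ)

theorem hasDerivAt_exp_neg_phase {m : ℕ} (k : ℕ) (a : Fin m → ℂ) (ζ : ℂ) :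
    HasDerivAt (fun ζ => Complex.exp (-phase k a ζ))
      (-(big m ζ * evalAt a (small ζ) (PowerSeries.trunc (m + 4 + k) (slopeSeries m)))
        * Complex.exp (-phase k a ζ)) ζ := by
  have := (hasDerivAt_phase k a ζ).neg.cexp
  rw [mul_comm] at this
  exact this

theorem hasDerivAt_coordU {m : ℕ} (k : ℕ) {a : Fin m → ℂ} {V : ℂ → Fin 3 → ℂ}
    (hV : IsSolution a V) (ζ : ℂ) :
    HasDerivAt (coordU k a V) ((big m ζ)⁻¹ * coordP k a V ζ) ζ := by
  have h := (hasDerivAt_comp_exp (hV (Complex.exp ζ)).1).mul (hasDerivAt_exp_neg_phase k a ζ)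
  convert! h using 1
  have hX := big_ne_zero m ζ
  rw [coordP, coordU, ← small_pow_mul_big' m ζ]
  field_simp
  ring

theorem hasDerivAt_small_pow (n : ℕ) (ζ : ℂ) :
    HasDerivAt (fun ζ => small ζ ^ n) (-(n : ℂ) / 3 * small ζ ^ n) ζ := by
  have h := (hasDerivAt_small ζ).pow n
  convert! h using 1
  rcases n with _ | n
  · simp
  · rw [Nat.add_sub_cancel, pow_succ]; ring

/-- The Riccati terms are collected in the residual. The constant (m+6)/3 is 2(m+3)/3, from the
weight X², minus m/3, from h^m. -/
theorem hasDerivAt_coordP {m : ℕ} (k : ℕ) {a : Fin m → ℂ} {V : ℂ → Fin 3 → ℂ}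
    (hV : IsSolution a V) (ζ : ℂ) :
    HasDerivAt (coordP k a V) ((((m : ℂ) + 6) / 3) * coordP k a V ζ
      - 2 * big m ζ * evalAt a (small ζ) (PowerSeries.trunc (m + 4 + k) (slopeSeries m))
        * coordP k a V ζ + big m ζ * coordS k a V ζ
      + big m ζ ^ 3 * evalAt a (small ζ) (residualOne m (m + 4 + k)) * coordU k a V ζ) ζ := by
  have hU := hasDerivAt_coordU k hV ζ
  have hσ := hasDerivAt_evalAt_small a ζ (PowerSeries.trunc (m + 4 + k) (slopeSeries m))
  have hW := ((hasDerivAt_small_pow m ζ).mul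
    (hasDerivAt_comp_exp (hV (Complex.exp ζ)).2.1)).mul (hasDerivAt_exp_neg_phase k a ζ)
  have h := ((hasDerivAt_big m ζ).pow 2).mul (hW.sub (hσ.mul hU))
  convert! h using 1
  have hX := big_ne_zero m ζ
  have hhX := small_pow_mul_big m ζ
  have hz := small_pow_mul_big' m ζ
  have h2m : small ζ ^ (2 * m) = small ζ ^ m * small ζ ^ m := by rw [two_mul, pow_add]
  simp only [Pi.mul_apply, Pi.sub_apply, Pi.pow_apply, coordS, coordP, residualOne, map_sub,
    map_mul, map_pow, map_add, evalAt_C, evalAt_X, MvPolynomial.eval_C, h2m]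
  rw [← hz]
  generalize evalAt a (small ζ) (PowerSeries.trunc (m + 4 + k) (slopeSeries m)) = S at *
  generalize evalAt a (small ζ) (PowerSeries.trunc (m + 4 + k) (bendSeries m)) = T at *
  generalize evalAt a (small ζ) (eulerPoly (PowerSeries.trunc (m + 4 + k) (slopeSeries m))) = S' at *
  generalize coordU k a V ζ = U at *
  generalize Complex.exp (-phase k a ζ) = e at *
  generalize V (Complex.exp ζ) 1 = V1 at *
  generalize V (Complex.exp ζ) 2 = V2 at *
  generalize big m ζ = X at *
  generalize small ζ ^ m = H at *
  generalize small ζ ^ (m + 3) = H3 at *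
  field_simp
  linear_combination (-(X * U * (↑m * S + 3 * S'))) * hhX

/-- Here the weights X² and h^{2m} leave the constant 2(m+3)/3 - 2m/3 = 2. -/
theorem hasDerivAt_coordS {m : ℕ} (k : ℕ) {a : Fin m → ℂ} {V : ℂ → Fin 3 → ℂ}
    (hV : IsSolution a V) (ζ : ℂ) :
    HasDerivAt (coordS k a V) (2 * coordS k a V ζ
      - big m ζ * evalAt a (small ζ) (PowerSeries.trunc (m + 4 + k) (bendSeries m))
        * coordP k a V ζ
      - big m ζ * evalAt a (small ζ) (PowerSeries.trunc (m + 4 + k) (slopeSeries m))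
        * coordS k a V ζ
      + big m ζ ^ 3 * evalAt a (small ζ) (residualTwo m (m + 4 + k)) * coordU k a V ζ) ζ := by
  have hU := hasDerivAt_coordU k hV ζ
  have hσ := hasDerivAt_evalAt_small a ζ (PowerSeries.trunc (m + 4 + k) (bendSeries m))
  have hW := ((hasDerivAt_small_pow (2 * m) ζ).mul
    (hasDerivAt_comp_exp (hV (Complex.exp ζ)).2.2)).mul (hasDerivAt_exp_neg_phase k a ζ)
  have h := ((hasDerivAt_big m ζ).pow 2).mul (hW.sub (hσ.mul hU))
  convert! h using 1
  have hX := big_ne_zero m ζ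
  have hhX := small_pow_mul_big m ζ
  have hz := small_pow_mul_big' m ζ
  have h2m : small ζ ^ (2 * m) = small ζ ^ m * small ζ ^ m := by rw [two_mul, pow_add]
  have h3m : small ζ ^ (3 * m) = small ζ ^ m * small ζ ^ m * small ζ ^ m := by
    rw [← pow_add, ← pow_add]; congr 1; ring
  have hUd : coordU k a V ζ = V (Complex.exp ζ) 0 * Complex.exp (-phase k a ζ) := rfl
  simp only [Pi.mul_apply, Pi.sub_apply, Pi.pow_apply, coordS, coordP, residualTwo, map_sub,
    map_mul, map_pow, map_add, evalAt_C, evalAt_X, MvPolynomial.eval_C, h2m,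
    evalAt_normalizedPotential, h3m]
  generalize evalAt a (small ζ) (PowerSeries.trunc (m + 4 + k) (slopeSeries m)) = S at *
  generalize evalAt a (small ζ) (eulerPoly (PowerSeries.trunc (m + 4 + k) (bendSeries m))) = T' at *
  generalize evalAt a (small ζ) (PowerSeries.trunc (m + 4 + k) (bendSeries m)) = T at *
  generalize monicPoly a (Complex.exp ζ) = φ at *
  generalize hU' : coordU k a V ζ = U at *
  generalize Complex.exp (-phase k a ζ) = e at *
  generalize V (Complex.exp ζ) 0 = V0 at *
  generalize V (Complex.exp ζ) 1 = V1 at *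
  generalize V (Complex.exp ζ) 2 = V2 at *
  rw [← hz]
  generalize big m ζ = X at *
  generalize small ζ ^ m = H at *
  generalize small ζ ^ (m + 3) = H3 at *
  push_cast
  field_simp
  rw [hUd]
  linear_combination (-(V0 * e * (2 * ↑m * T + 3 * T'))) * hhX

/-- This allows terms with bounded coefficients to be absorbed into the perturbation of size X h. -/
theorem one_le_norm_big_mul_norm_small (m : ℕ) {ζ : ℂ} (h : ‖small ζ‖ ≤ 1) :
    1 ≤ ‖big m ζ‖ * ‖small ζ‖ := by
  have h1 := congrArg norm (small_pow_mul_big m ζ)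
  rw [norm_mul, norm_pow, norm_one] at h1
  have h2 : ‖small ζ‖ ^ (m + 3) ≤ ‖small ζ‖ ^ 1 :=
    pow_le_pow_of_le_one (norm_nonneg _) h (by omega)
  rw [pow_one] at h2
  nlinarith [norm_nonneg (big m ζ)]

/-- The defects satisfy a system that is diagonal to leading order. -/
theorem exists_hasDerivAt_coordG_bound {m : ℕ} (k : ℕ) {K : Set (Fin m → ℂ)} (hK : IsCompact K) :
    ∃ C, 0 ≤ C ∧ ∀ a ∈ K, ∀ V, IsSolution a V → ∀ ζ, ‖small ζ‖ ≤ 1 →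
      ∀ ω : ℂ, ω ^ 2 + ω + 1 = 0 → ‖ω‖ = 1 →
      ∃ d, HasDerivAt (coordG k a (ω ^ 2) V) d ζ ∧
        ‖d - big m ζ * (ω - 1) * coordG k a (ω ^ 2) V ζ‖ ≤
          C * (‖big m ζ‖ * ‖small ζ‖ * (‖coordP k a V ζ‖ + ‖coordS k a V ζ‖)
            + ‖big m ζ‖ ^ 3 * ‖small ζ‖ ^ (m + 4 + k) * ‖coordU k a V ζ‖) := by
  obtain ⟨C1, hC1, hS⟩ := exists_norm_evalAt_le_pow hK
    (X_dvd_trunc_sub_one (n := m + 4 + k) (by omega) (constantCoeff_slopeSeries m))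
  obtain ⟨C2, hC2, hT⟩ := exists_norm_evalAt_le_pow hK
    (X_dvd_trunc_sub_one (n := m + 4 + k) (by omega) (constantCoeff_bendSeries m))
  obtain ⟨C3, hC3, hR1⟩ := exists_norm_evalAt_le_pow hK (X_pow_dvd_residualOne m (m + 4 + k))
  obtain ⟨C4, hC4, hR2⟩ := exists_norm_evalAt_le_pow hK (X_pow_dvd_residualTwo m (m + 4 + k))
  refine ⟨((m : ℝ) + 6) / 3 + 2 + 3 * C1 + C2 + C3 + C4, by positivity,
    fun a ha V hV ζ hh ω hω hω1 => ?_⟩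
  refine ⟨_, (hasDerivAt_coordP k hV ζ).add ((hasDerivAt_coordS k hV ζ).const_mul (ω ^ 2)), ?_⟩
  have hS := hS a ha _ hh
  have hT := hT a ha _ hh
  have hR1 := hR1 a ha _ hh
  have hR2 := hR2 a ha _ hh
  have h1 := one_le_norm_big_mul_norm_small m hh
  rw [map_sub, map_one, pow_one] at hS hT
  rw [coordG]
  have hm : ‖((m : ℂ) + 6) / 3‖ = ((m : ℝ) + 6) / 3 := by
    rw [show ((m : ℂ) + 6) / 3 = (((m : ℝ) + 6) / 3 : ℝ) by push_cast; rfl, Complex.norm_real,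
      Real.norm_of_nonneg (by positivity)]
  generalize hSe : evalAt a (small ζ) (PowerSeries.trunc (m + 4 + k) (slopeSeries m)) = S at *
  generalize evalAt a (small ζ) (PowerSeries.trunc (m + 4 + k) (bendSeries m)) = T at *
  generalize evalAt a (small ζ) (residualOne m (m + 4 + k)) = R1 at *
  generalize evalAt a (small ζ) (residualTwo m (m + 4 + k)) = R2 at *
  generalize coordU k a V ζ = U at *
  generalize coordP k a V ζ = P at *
  generalize coordS k a V ζ = Q at *
  generalize big m ζ = X at *
  generalize small ζ = h at *
  have hω3 : ω ^ 3 = 1 := by linear_combination (ω - 1) * hω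
  -- With σ = τ = 1 the leading matrix for (P, S) is X times the one with rows (-2, 1) and (-1, -1);
  -- (1, ω²) is a left eigenvector for ω - 1. The remaining terms are perturbations.
  have key : ((m : ℂ) + 6) / 3 * P - 2 * X * S * P + X * Q + X ^ 3 * R1 * U +
      ω ^ 2 * (2 * Q - X * T * P - X * S * Q + X ^ 3 * R2 * U) - X * (ω - 1) * (P + ω ^ 2 * Q)
      = ((m : ℂ) + 6) / 3 * P + ω ^ 2 * (2 * Q) - 2 * X * (S - 1) * P
        - ω ^ 2 * (X * (T - 1) * P) - ω ^ 2 * (X * (S - 1) * Q) + X ^ 3 * R1 * U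
        + ω ^ 2 * (X ^ 3 * R2 * U) := by
    linear_combination (-(X * P)) * hω - (X * Q) * hω3
  rw [key]
  have hn2 : ‖ω ^ 2‖ = 1 := by rw [norm_pow, hω1, one_pow]
  have b1 : ‖((m : ℂ) + 6) / 3 * P‖ ≤ (((m : ℝ) + 6) / 3) * (‖X‖ * ‖h‖ * (‖P‖ + ‖Q‖)) := by
    rw [norm_mul, hm]
    refine mul_le_mul_of_nonneg_left ?_ (by positivity)
    nlinarith [norm_nonneg P, norm_nonneg Q]
  have b2 : ‖ω ^ 2 * (2 * Q)‖ ≤ 2 * (‖X‖ * ‖h‖ * (‖P‖ + ‖Q‖)) := by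
    rw [norm_mul, hn2, norm_mul, one_mul, Complex.norm_ofNat]
    refine mul_le_mul_of_nonneg_left ?_ (by positivity)
    nlinarith [norm_nonneg P, norm_nonneg Q]
  have b3 : ‖2 * X * (S - 1) * P‖ ≤ 2 * C1 * (‖X‖ * ‖h‖ * ‖P‖) := by
    rw [norm_mul, norm_mul, norm_mul, Complex.norm_ofNat]
    calc 2 * ‖X‖ * ‖S - 1‖ * ‖P‖ ≤ 2 * ‖X‖ * (C1 * ‖h‖) * ‖P‖ := by gcongr
      _ = _ := by ring
  have b4 : ‖ω ^ 2 * (X * (T - 1) * P)‖ ≤ C2 * (‖X‖ * ‖h‖ * ‖P‖) := by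
    rw [norm_mul, hn2, one_mul, norm_mul, norm_mul]
    calc ‖X‖ * ‖T - 1‖ * ‖P‖ ≤ ‖X‖ * (C2 * ‖h‖) * ‖P‖ := by gcongr
      _ = _ := by ring
  have b5 : ‖ω ^ 2 * (X * (S - 1) * Q)‖ ≤ C1 * (‖X‖ * ‖h‖ * ‖Q‖) := by
    rw [norm_mul, hn2, one_mul, norm_mul, norm_mul]
    calc ‖X‖ * ‖S - 1‖ * ‖Q‖ ≤ ‖X‖ * (C1 * ‖h‖) * ‖Q‖ := by gcongr
      _ = _ := by ring
  have b6 : ‖X ^ 3 * R1 * U‖ ≤ C3 * (‖X‖ ^ 3 * ‖h‖ ^ (m + 4 + k) * ‖U‖) := by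
    rw [norm_mul, norm_mul, norm_pow]
    calc ‖X‖ ^ 3 * ‖R1‖ * ‖U‖ ≤ ‖X‖ ^ 3 * (C3 * ‖h‖ ^ (m + 4 + k)) * ‖U‖ := by gcongr
      _ = _ := by ring
  have b7 : ‖ω ^ 2 * (X ^ 3 * R2 * U)‖ ≤ C4 * (‖X‖ ^ 3 * ‖h‖ ^ (m + 4 + k) * ‖U‖) := by
    rw [norm_mul, hn2, one_mul, norm_mul, norm_mul, norm_pow]
    calc ‖X‖ ^ 3 * ‖R2‖ * ‖U‖ ≤ ‖X‖ ^ 3 * (C4 * ‖h‖ ^ (m + 4 + k)) * ‖U‖ := by gcongr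
      _ = _ := by ring
  have tri : ∀ x1 x2 x3 x4 x5 x6 x7 : ℂ, ‖x1 + x2 - x3 - x4 - x5 + x6 + x7‖
      ≤ ‖x1‖ + ‖x2‖ + ‖x3‖ + ‖x4‖ + ‖x5‖ + ‖x6‖ + ‖x7‖ := by
    intro x1 x2 x3 x4 x5 x6 x7
    refine (norm_add_le _ _).trans (add_le_add ((norm_add_le _ _).trans (add_le_add
      ((norm_sub_le _ _).trans (add_le_add ((norm_sub_le _ _).trans (add_le_add
      ((norm_sub_le _ _).trans (add_le_add (norm_add_le _ _) le_rfl)) le_rfl)) le_rfl))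
      le_rfl)) le_rfl)
  refine (tri _ _ _ _ _ _ _).trans ?_
  have p1 : 0 ≤ ‖X‖ * ‖h‖ * ‖P‖ := by positivity
  have p2 : 0 ≤ ‖X‖ * ‖h‖ * ‖Q‖ := by positivity
  have p3 : 0 ≤ ‖X‖ ^ 3 * ‖h‖ ^ (m + 4 + k) * ‖U‖ := by positivity
  generalize ‖X‖ ^ 3 * ‖h‖ ^ (m + 4 + k) * ‖U‖ = y3 at *
  rw [mul_add (‖X‖ * ‖h‖)] at *
  generalize ‖X‖ * ‖h‖ * ‖P‖ = y1 at *
  generalize ‖X‖ * ‖h‖ * ‖Q‖ = y2 at *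
  have q1 := mul_nonneg hC1 p1
  have q2 := mul_nonneg hC1 p2
  have q3 := mul_nonneg hC2 p1
  have q4 := mul_nonneg hC2 p2
  have q5 := mul_nonneg hC3 p1
  have q6 := mul_nonneg hC3 p2
  have q7 := mul_nonneg hC4 p1
  have q8 := mul_nonneg hC4 p2
  have q9 := mul_nonneg hC1 p3
  have q10 := mul_nonneg hC2 p3
  have q11 : 0 ≤ ((m : ℝ) + 6) / 3 * y3 := by positivity
  linarith

/-- The change of coordinates inverts with determinant ±(ω - ω²), whose modulus √3 is at least 1. -/
theorem norm_coordP_add_norm_coordS_le {m : ℕ} (k : ℕ) (a : Fin m → ℂ) (V : ℂ → Fin 3 → ℂ) (ζ : ℂ)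
    {ω : ℂ} (hω : ω ^ 2 + ω + 1 = 0) (hω1 : ‖ω‖ = 1) :
    ‖coordP k a V ζ‖ + ‖coordS k a V ζ‖ ≤
      2 * (‖coordG k a (ω ^ 2) V ζ‖ + ‖coordG k a ω V ζ‖) := by
  have hω3 : ω ^ 3 = 1 := by linear_combination (ω - 1) * hω
  have h3 : 1 ≤ ‖ω - ω ^ 2‖ := by
    have h : (ω - ω ^ 2) ^ 2 = -3 := by linear_combination (ω ^ 2 - 3 * ω + 3) * hω
    have h' := congrArg norm h
    rw [norm_pow, norm_neg, Complex.norm_ofNat] at h'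
    nlinarith [norm_nonneg (ω - ω ^ 2)]
  simp only [coordG]
  generalize coordP k a V ζ = P
  generalize coordS k a V ζ = Q
  have e1 : (ω - ω ^ 2) * P = ω * (P + ω ^ 2 * Q) - ω ^ 2 * (P + ω * Q) := by
    linear_combination (0 : ℂ) * hω3
  have e2 : (ω - ω ^ 2) * Q = (P + ω * Q) - (P + ω ^ 2 * Q) := by ring
  have f1 : ‖P‖ ≤ ‖P + ω ^ 2 * Q‖ + ‖P + ω * Q‖ := by
    calc ‖P‖ ≤ ‖ω - ω ^ 2‖ * ‖P‖ := le_mul_of_one_le_left (norm_nonneg _) h3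
      _ = ‖ω * (P + ω ^ 2 * Q) - ω ^ 2 * (P + ω * Q)‖ := by rw [← norm_mul, e1]
      _ ≤ _ := (norm_sub_le _ _).trans (by simp [norm_pow, hω1])
  have f2 : ‖Q‖ ≤ ‖P + ω ^ 2 * Q‖ + ‖P + ω * Q‖ := by
    calc ‖Q‖ ≤ ‖ω - ω ^ 2‖ * ‖Q‖ := le_mul_of_one_le_left (norm_nonneg _) h3
      _ = ‖(P + ω * Q) - (P + ω ^ 2 * Q)‖ := by rw [← norm_mul, e2]
      _ ≤ _ := (norm_sub_le _ _).trans (by rw [add_comm])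
  linarith

/-! ### The energy inequality -/

theorem hasDerivAt_norm_sq_comp {f : ℝ → ℂ} {f' : ℂ} {s : ℝ} (h : HasDerivAt f f' s) :
    HasDerivAt (fun s => ‖f s‖ ^ 2) (2 * (f' * (starRingEnd ℂ) (f s)).re) s := by
  have := h.norm_sq
  simpa [Complex.inner, mul_comm] using this

theorem re_mul_conj_ge (x y : ℂ) : -(‖x‖ * ‖y‖) ≤ (x * (starRingEnd ℂ) y).re := by
  have h := (abs_le.mp (Complex.abs_re_le_norm (x * (starRingEnd ℂ) y))).1
  rwa [norm_mul, RCLike.norm_conj] at h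

theorem re_mul_conj_ge_of_near {d μ g : ℂ} {B c : ℝ} (hμ : c ≤ μ.re) (hd : ‖d - μ * g‖ ≤ B) :
    c * ‖g‖ ^ 2 - B * ‖g‖ ≤ (d * (starRingEnd ℂ) g).re := by
  have h1 : (d * (starRingEnd ℂ) g).re
      = μ.re * ‖g‖ ^ 2 + ((d - μ * g) * (starRingEnd ℂ) g).re := by
    have : d * (starRingEnd ℂ) g = μ * ((‖g‖ ^ 2 : ℝ) : ℂ) + (d - μ * g) * (starRingEnd ℂ) g := by
      rw [← Complex.normSq_eq_norm_sq, Complex.normSq_eq_conj_mul_self]; ring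
    rw [this, Complex.add_re, Complex.re_mul_ofReal]
  have h2 := re_mul_conj_ge (d - μ * g) g
  have h3 : ‖d - μ * g‖ * ‖g‖ ≤ B * ‖g‖ := mul_le_mul_of_nonneg_right hd (norm_nonneg _)
  have h4 : c * ‖g‖ ^ 2 ≤ μ.re * ‖g‖ ^ 2 := mul_le_mul_of_nonneg_right hμ (by positivity)
  linarith

/-- The energy inequality for a system whose second and third equation are repulsive. -/
theorem energy_deriv_ge {D g₁ g₂ D' g₁' g₂' μ₁ μ₂ : ℂ} {κ η δ e : ℝ} (hκ : 0 ≤ κ)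
    (hδ : 0 ≤ δ)
    (hD : ‖D'‖ ≤ κ * (‖g₁‖ + ‖g₂‖))
    (h₁ : ‖g₁' - μ₁ * g₁‖ ≤ η * (‖g₁‖ + ‖g₂‖) + δ * (‖D‖ + e))
    (h₂ : ‖g₂' - μ₂ * g₂‖ ≤ η * (‖g₁‖ + ‖g₂‖) + δ * (‖D‖ + e))
    (hη : 0 ≤ η) (hμ₁ : 2 * η ≤ μ₁.re) (hμ₂ : 2 * η ≤ μ₂.re) :
    -(3 * (κ + δ)) * (‖D‖ ^ 2 + ‖g₁‖ ^ 2 + ‖g₂‖ ^ 2) - 2 * δ * e ^ 2 ≤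
      2 * (D' * (starRingEnd ℂ) D).re + 2 * (g₁' * (starRingEnd ℂ) g₁).re
        + 2 * (g₂' * (starRingEnd ℂ) g₂).re := by
  have a0 := re_mul_conj_ge D' D
  have a1 := re_mul_conj_ge_of_near hμ₁ h₁
  have a2 := re_mul_conj_ge_of_near hμ₂ h₂
  have a3 : ‖D'‖ * ‖D‖ ≤ κ * (‖g₁‖ + ‖g₂‖) * ‖D‖ := mul_le_mul_of_nonneg_right hD (norm_nonneg _)
  have n0 := norm_nonneg D
  have n1 := norm_nonneg g₁
  have n2 := norm_nonneg g₂
  generalize ‖D‖ = x at *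
  generalize ‖g₁‖ = y at *
  generalize ‖g₂‖ = z at *
  -- The factor 2 in 2η ≤ Re μ is what makes the mutual coupling a complete square: 2y² + 2z² -
  -- (y+z)² = (y-z)².
  have b1 : 0 ≤ η * (y - z) ^ 2 := by positivity
  have b2 : 0 ≤ κ * ((x - y) ^ 2 + (x - z) ^ 2 + x ^ 2 + 2 * y ^ 2 + 2 * z ^ 2) := by positivity
  have b3 : 0 ≤ δ * ((x - y) ^ 2 + (x - z) ^ 2 + (e - y) ^ 2 + (e - z) ^ 2 + x ^ 2 + y ^ 2
    + z ^ 2) := by positivity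
  nlinarith

theorem energy_gronwall {D G₁ G₂ D' G₁' G₂' μ₁ μ₂ : ℝ → ℂ} {κ η δ : ℝ → ℝ} {A e r L : ℝ} {l : ℕ}
    (hl : 1 ≤ l) (hA : 0 ≤ A) (hr : 1 ≤ r) (hL : 0 ≤ L)
    (dD : ∀ s ∈ Set.Icc 0 L, HasDerivAt D (D' s) s)
    (d₁ : ∀ s ∈ Set.Icc 0 L, HasDerivAt G₁ (G₁' s) s)
    (d₂ : ∀ s ∈ Set.Icc 0 L, HasDerivAt G₂ (G₂' s) s)
    (hκ : ∀ s ∈ Set.Icc 0 L, 0 ≤ κ s) (hδ : ∀ s ∈ Set.Icc 0 L, 0 ≤ δ s)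
    (hη : ∀ s ∈ Set.Icc 0 L, 0 ≤ η s)
    (hD : ∀ s ∈ Set.Icc 0 L, ‖D' s‖ ≤ κ s * (‖G₁ s‖ + ‖G₂ s‖))
    (h₁ : ∀ s ∈ Set.Icc 0 L, ‖G₁' s - μ₁ s * G₁ s‖ ≤
      η s * (‖G₁ s‖ + ‖G₂ s‖) + δ s * (‖D s‖ + e))
    (h₂ : ∀ s ∈ Set.Icc 0 L, ‖G₂' s - μ₂ s * G₂ s‖ ≤
      η s * (‖G₁ s‖ + ‖G₂ s‖) + δ s * (‖D s‖ + e))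
    (hμ₁ : ∀ s ∈ Set.Icc 0 L, 2 * η s ≤ (μ₁ s).re)
    (hμ₂ : ∀ s ∈ Set.Icc 0 L, 2 * η s ≤ (μ₂ s).re)
    (hκδ : ∀ s ∈ Set.Icc 0 L, κ s + δ s ≤ A / (r + s) ^ 2)
    (hδl : ∀ s ∈ Set.Icc 0 L, δ s ≤ A / (r + s) ^ (l + 1)) :
    ‖D 0‖ ^ 2 + ‖G₁ 0‖ ^ 2 + ‖G₂ 0‖ ^ 2 ≤ Real.exp (3 * A) *
      (‖D L‖ ^ 2 + ‖G₁ L‖ ^ 2 + ‖G₂ L‖ ^ 2 + 2 * A * e ^ 2 / r ^ l) := by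
  set N : ℝ → ℝ := fun s => ‖D s‖ ^ 2 + ‖G₁ s‖ ^ 2 + ‖G₂ s‖ ^ 2 with hN
  have hl0 : (0 : ℝ) < l := by exact_mod_cast hl
  -- E is an integrating factor for the loss 3A/(r+s)², and J is a primitive of the source
  -- 2Ae²/(r+s)^{l+1}; thus N E + J is nondecreasing.
  let E : ℝ → ℝ := fun s => Real.exp (-(3 * A) * (r + s)⁻¹)
  let J : ℝ → ℝ := fun s => -(2 * A * e ^ 2 / l) * ((r + s) ^ l)⁻¹
  have dN : ∀ s ∈ Set.Icc 0 L, HasDerivAt N (2 * (D' s * (starRingEnd ℂ) (D s)).re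
      + 2 * (G₁' s * (starRingEnd ℂ) (G₁ s)).re + 2 * (G₂' s * (starRingEnd ℂ) (G₂ s)).re) s :=
    fun s hs => ((hasDerivAt_norm_sq_comp (dD s hs)).add (hasDerivAt_norm_sq_comp (d₁ s hs))).add
      (hasDerivAt_norm_sq_comp (d₂ s hs))
  have dE : ∀ s ∈ Set.Icc 0 L, HasDerivAt E (E s * (3 * A / (r + s) ^ 2)) s := by
    intro s hs
    have h0 : r + s ≠ 0 := by linarith [hs.1]
    have := (((hasDerivAt_id s).const_add r).inv h0).const_mul (-(3 * A))
    convert! this.exp using 1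
    simp only [E, id]
    congr 1
    field_simp
  have dJ : ∀ s ∈ Set.Icc 0 L, HasDerivAt J (2 * A * e ^ 2 / (r + s) ^ (l + 1)) s := by
    intro s hs
    have h0 : r + s ≠ 0 := by linarith [hs.1]
    have := ((((hasDerivAt_id s).const_add r).pow l).inv (pow_ne_zero l h0)).const_mul
      (-(2 * A * e ^ 2 / l))
    convert! this using 1
    obtain ⟨j, rfl⟩ : ∃ j, l = j + 1 := ⟨l - 1, by omega⟩
    simp only [id, Nat.add_sub_cancel, Pi.pow_apply]
    field_simp
    ring
  have dF : ∀ s ∈ Set.Icc 0 L, HasDerivAt (fun s => N s * E s + J s) _ s := fun s hs =>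
    ((dN s hs).mul (dE s hs)).add (dJ s hs)
  have hmono : MonotoneOn (fun s => N s * E s + J s) (Set.Icc 0 L) := by
    refine monotoneOn_of_deriv_nonneg (convex_Icc 0 L)
      (fun s hs => (dF s hs).continuousAt.continuousWithinAt)
      (fun s hs => (dF s (interior_subset hs)).differentiableAt.differentiableWithinAt) ?_
    intro s hs
    have hs := interior_subset hs
    rw [(dF s hs).deriv]
    have h0 : 0 < r + s := by linarith [hs.1]
    have key := energy_deriv_ge (hκ s hs) (hδ s hs) (hD s hs) (h₁ s hs) (h₂ s hs) (hη s hs)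
      (hμ₁ s hs) (hμ₂ s hs)
    have hN0 : 0 ≤ N s := by positivity
    have hE0 : 0 < E s := Real.exp_pos _
    have hE1 : E s ≤ 1 := by
      apply Real.exp_le_one_iff.mpr
      have : 0 ≤ 3 * A * (r + s)⁻¹ := by positivity
      linarith
    have k1 := mul_le_mul_of_nonneg_right (hκδ s hs) hN0
    have k2 := mul_le_mul_of_nonneg_right (hδl s hs) (by positivity : 0 ≤ 2 * e ^ 2)
    have k3 : 0 ≤ 2 * A * e ^ 2 / (r + s) ^ (l + 1) := by positivity
    have k4 : -(3 * A / (r + s) ^ 2) * N s - 2 * A * e ^ 2 / (r + s) ^ (l + 1) ≤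
        2 * (D' s * (starRingEnd ℂ) (D s)).re
      + 2 * (G₁' s * (starRingEnd ℂ) (G₁ s)).re + 2 * (G₂' s * (starRingEnd ℂ) (G₂ s)).re := by
      refine le_trans ?_ key
      have e1 : 3 * A / (r + s) ^ 2 = 3 * (A / (r + s) ^ 2) := by ring
      have e2 : 2 * A * e ^ 2 / (r + s) ^ (l + 1) = A / (r + s) ^ (l + 1) * (2 * e ^ 2) := by ring
      rw [e1, e2]
      change _ ≤ -(3 * (κ s + δ s)) * N s - 2 * δ s * e ^ 2
      linarith
    have k5 := mul_le_mul_of_nonneg_right k4 hE0.le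
    have k6 := mul_le_of_le_one_right k3 hE1
    nlinarith
  have h := hmono (Set.left_mem_Icc.mpr hL) (Set.right_mem_Icc.mpr hL) hL
  simp only [] at h
  have hE0 : Real.exp (-(3 * A)) ≤ E 0 := by
    apply Real.exp_le_exp.mpr
    have : 3 * A * (r + 0)⁻¹ ≤ 3 * A :=
      mul_le_of_le_one_right (by positivity) (inv_le_one_of_one_le₀ (by linarith))
    linarith
  have hEL : E L ≤ 1 := by
    apply Real.exp_le_one_iff.mpr
    have : 0 ≤ 3 * A * (r + L)⁻¹ := by positivity
    linarith
  have hJL : J L ≤ 0 := by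
    have : 0 ≤ (2 * A * e ^ 2 / l) * ((r + L) ^ l)⁻¹ := by positivity
    simp only [J]; linarith
  have hJ0 : -(2 * A * e ^ 2 / r ^ l) ≤ J 0 := by
    simp only [J, add_zero]
    have : 2 * A * e ^ 2 / l ≤ 2 * A * e ^ 2 :=
      div_le_self (by positivity) (by exact_mod_cast hl)
    have h2 := mul_le_mul_of_nonneg_right this (by positivity : 0 ≤ (r ^ l)⁻¹)
    rw [div_eq_mul_inv _ (r ^ l)]
    linarith
  have hN0 : 0 ≤ N 0 := by positivity
  have hNL : 0 ≤ N L := by positivity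
  have f1 := mul_le_mul_of_nonneg_left hE0 hN0
  have f2 := mul_le_of_le_one_right hNL hEL
  have f3 : N 0 * Real.exp (-(3 * A)) ≤ N L + 2 * A * e ^ 2 / r ^ l := by linarith
  rw [Real.exp_neg, ← div_eq_mul_inv, div_le_iff₀ (Real.exp_pos _), mul_comm] at f3
  exact f3

/-! ### The variable q, cones and the repulsive directions -/

/-- A primitive cube root of unity. -/
noncomputable def omega : ℂ := ⟨-1 / 2, Real.sqrt 3 / 2⟩

theorem omega_eq : omega ^ 2 + omega + 1 = 0 := by
  have h : Real.sqrt 3 * Real.sqrt 3 = 3 := Real.mul_self_sqrt (by norm_num)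
  apply Complex.ext
  · simp [omega, pow_two]; nlinarith
  · simp [omega, pow_two]; ring

theorem norm_omega : ‖omega‖ = 1 := by
  have h3 : omega ^ 3 = 1 := by linear_combination (omega - 1) * omega_eq
  have := congrArg norm h3
  rw [norm_pow, norm_one] at this
  exact (pow_eq_one_iff_of_nonneg (norm_nonneg _) (by norm_num)).mp this

theorem omega_pow_four : (omega ^ 2) ^ 2 = omega := by
  linear_combination (omega ^ 2 - omega) * omega_eq

theorem omega_sq_eq : (omega ^ 2) ^ 2 + omega ^ 2 + 1 = 0 := by
  rw [omega_pow_four]; linear_combination omega_eq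

theorem norm_omega_sq : ‖omega ^ 2‖ = 1 := by rw [norm_pow, norm_omega, one_pow]

/-- The logarithm of `z`, as a function of `q = (z^{(m+3)/4}) e^{3πi/4}` in the slit plane. -/
noncomputable def logZ (m : ℕ) (q : ℂ) : ℂ :=
  (4 * Complex.log q - 3 * Real.pi * Complex.I) / ((m : ℂ) + 3)

/-- The principal cube root. -/
noncomputable def cubeRoot (q : ℂ) : ℂ := Complex.exp (Complex.log q / 3)

theorem cubeRoot_pow_three {q : ℂ} (hq : q ≠ 0) : cubeRoot q ^ 3 = q := by
  rw [cubeRoot, ← Complex.exp_nat_mul]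
  push_cast
  rw [mul_div_cancel₀ _ (by norm_num), Complex.exp_log hq]

theorem norm_cubeRoot_pow_three {q : ℂ} (hq : q ≠ 0) : ‖cubeRoot q‖ ^ 3 = ‖q‖ := by
  rw [← norm_pow, cubeRoot_pow_three hq]

theorem natCast_add_three_ne_zero (m : ℕ) : ((m : ℂ) + 3) ≠ 0 := by
  exact_mod_cast (by omega : m + 3 ≠ 0)

theorem big_logZ (m : ℕ) (q : ℂ) : big m (logZ m q) = -cubeRoot q ^ 4 := by
  have hm := natCast_add_three_ne_zero m
  have : ((m : ℂ) + 3) / 3 * logZ m q = 4 * (Complex.log q / 3) - Real.pi * Complex.I := by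
    rw [logZ]; field_simp
  rw [big, this, Complex.exp_sub, Complex.exp_pi_mul_I, cubeRoot, ← Complex.exp_nat_mul]
  push_cast
  ring

theorem norm_big_logZ (m : ℕ) (q : ℂ) : ‖big m (logZ m q)‖ = ‖cubeRoot q‖ ^ 4 := by
  rw [big_logZ, norm_neg, norm_pow]

theorem one_le_norm_cubeRoot {q : ℂ} (hq : 1 ≤ ‖q‖) : 1 ≤ ‖cubeRoot q‖ := by
  have h0 : q ≠ 0 := norm_pos_iff.mp (by linarith)
  rw [← norm_cubeRoot_pow_three h0] at hq
  exact (one_le_pow_iff_of_nonneg (norm_nonneg _) (by norm_num)).mp hq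

theorem norm_le_norm_big_logZ (m : ℕ) {q : ℂ} (hq : 1 ≤ ‖q‖) : ‖q‖ ≤ ‖big m (logZ m q)‖ := by
  have h0 : q ≠ 0 := norm_pos_iff.mp (by linarith)
  rw [norm_big_logZ, ← norm_cubeRoot_pow_three h0]
  exact pow_le_pow_right₀ (one_le_norm_cubeRoot hq) (by norm_num)

theorem norm_small_pow_mul_norm_big (m : ℕ) (ζ : ℂ) : ‖small ζ‖ ^ (m + 3) * ‖big m ζ‖ = 1 := by
  rw [← norm_pow, ← norm_mul, small_pow_mul_big, norm_one]

theorem norm_small_logZ_le (m : ℕ) {q : ℂ} {ε : ℝ} (hε : 0 < ε) (hq : 1 ≤ ‖q‖)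
    (hqε : (ε⁻¹) ^ (m + 3) ≤ ‖q‖) : ‖small (logZ m q)‖ ≤ ε := by
  have h1 := norm_small_pow_mul_norm_big m (logZ m q)
  have h2 := norm_le_norm_big_logZ m hq
  have h3 : ‖small (logZ m q)‖ ^ (m + 3) ≤ ε ^ (m + 3) := by
    have h4 : 1 ≤ ε ^ (m + 3) * ‖big m (logZ m q)‖ := by
      calc (1 : ℝ) = ε ^ (m + 3) * ε⁻¹ ^ (m + 3) := by
            rw [← mul_pow, mul_inv_cancel₀ hε.ne', one_pow]
        _ ≤ _ := mul_le_mul_of_nonneg_left (hqε.trans h2) (by positivity)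
    have h5 : 0 < ‖big m (logZ m q)‖ := by linarith
    exact le_of_mul_le_mul_right (by linarith) h5
  exact (pow_le_pow_iff_left₀ (norm_nonneg _) hε.le (by omega)).mp h3

theorem norm_small_logZ_le_one (m : ℕ) {q : ℂ} (hq : 1 ≤ ‖q‖) : ‖small (logZ m q)‖ ≤ 1 :=
  norm_small_logZ_le m one_pos hq (by simpa using hq)

theorem hasDerivAt_logZ (m : ℕ) {q : ℂ} (hq : q ∈ Complex.slitPlane) :
    HasDerivAt (logZ m) (4 / ((m : ℂ) + 3) * q⁻¹) q := by
  have := (((Complex.hasDerivAt_log hq).const_mul 4).sub_const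
    (3 * Real.pi * Complex.I)).div_const ((m : ℂ) + 3)
  convert! this using 1
  ring

/-- The sector `Re q ≥ -κ |q|` around the positive real axis. -/
def InCone (κ : ℝ) (q : ℂ) : Prop := -(κ * ‖q‖) ≤ q.re

theorem InCone.mem_slitPlane {κ : ℝ} (hκ : κ < 1) {q : ℂ} (h : InCone κ q) (hq : q ≠ 0) :
    q ∈ Complex.slitPlane := by
  rw [Complex.mem_slitPlane_iff]
  by_contra! hc
  obtain ⟨h1, h2⟩ := hc
  have h3 : ‖q‖ = -q.re := by
    rw [← Complex.abs_re_eq_norm.mpr h2, abs_of_nonpos h1]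
  have h4 : 0 < ‖q‖ := norm_pos_iff.mpr hq
  rw [InCone] at h
  nlinarith

theorem InCone.add_ofReal {κ : ℝ} (hκ0 : 0 ≤ κ) (hκ : κ < 1) {q : ℂ} (h : InCone κ q) {r : ℝ}
    (hr : 0 ≤ r) : InCone κ (q + r) := by
  rw [InCone] at h ⊢
  have h1 : ‖q‖ ≤ ‖q + r‖ + r := by
    have := norm_sub_le (q + r) (r : ℂ)
    rwa [add_sub_cancel_right, Complex.norm_real, Real.norm_of_nonneg hr] at this
  rw [Complex.add_re, Complex.ofReal_re]
  nlinarith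

theorem InCone.smul {κ : ℝ} {q : ℂ} (h : InCone κ q) {t : ℝ} (ht : 0 ≤ t) : InCone κ (t * q) := by
  rw [InCone] at h ⊢
  rw [norm_mul, Complex.norm_real, Real.norm_of_nonneg ht, Complex.re_ofReal_mul]
  nlinarith

/-- Expanding, |q+r|² ≥ |q|² + r² - 2κr|q|, and the right side equals (1-κ)/2 (|q|+r)² + (1+κ)/2
(|q|-r)². -/
theorem InCone.norm_add_ofReal_ge {κ : ℝ} (hκ0 : 0 ≤ κ) (hκ : κ < 1) {q : ℂ} (h : InCone κ q)
    {r : ℝ} (hr : 0 ≤ r) : (1 - κ) / 2 * (‖q‖ + r) ≤ ‖q + r‖ := by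
  rw [InCone] at h
  have h1 : ‖q + r‖ ^ 2 = ‖q‖ ^ 2 + 2 * r * q.re + r ^ 2 := by
    rw [← Complex.normSq_eq_norm_sq, ← Complex.normSq_eq_norm_sq, Complex.normSq_apply,
      Complex.normSq_apply]
    simp; ring
  have h2 : (1 - κ) / 2 * (‖q‖ + r) ^ 2 ≤ ‖q + r‖ ^ 2 := by
    rw [h1]
    have h3 : 0 ≤ (1 + κ) / 2 * (‖q‖ - r) ^ 2 := by positivity
    nlinarith
  have h4 : ((1 - κ) / 2 * (‖q‖ + r)) ^ 2 ≤ ‖q + r‖ ^ 2 := by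
    refine le_trans ?_ h2
    rw [mul_pow]
    have : ((1 - κ) / 2) ^ 2 ≤ (1 - κ) / 2 := by nlinarith
    exact mul_le_mul_of_nonneg_right this (by positivity)
  exact (pow_le_pow_iff_left₀ (by have := norm_nonneg q; have : 0 ≤ 1 - κ := by linarith
                                  positivity) (norm_nonneg _) (by norm_num)).mp h4

/-- Strict repulsion: in a closed subsector of the slit plane the principal cube root makes an
angle of less than `π/2` with the directions of `1 - ω` and `1 - ω²`. -/
theorem exists_re_cubeRoot_ge {κ : ℝ} (hκ0 : 0 ≤ κ) (hκ : κ < 1) :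
    ∃ c, 0 < c ∧ ∀ q : ℂ, q ≠ 0 → InCone κ q →
      c * ‖cubeRoot q‖ ≤ (cubeRoot q * (1 - omega)).re ∧
      c * ‖cubeRoot q‖ ≤ (cubeRoot q * (1 - omega ^ 2)).re := by
  set ε := Real.arccos κ with hε
  have hε0 : 0 < ε := Real.arccos_pos.mpr hκ
  have hεπ : ε ≤ Real.pi / 2 := Real.arccos_le_pi_div_two.mpr hκ0
  have hcos : Real.cos ε = κ := Real.cos_arccos (by linarith) hκ.le
  have hπ := Real.pi_pos
  have hs3 : 0 < Real.sqrt 3 := Real.sqrt_pos.mpr (by norm_num)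
  have hs33 : Real.sqrt 3 * Real.sqrt 3 = 3 := Real.mul_self_sqrt (by norm_num)
  -- The cone is |arg q| ≤ π - ε with cos ε = κ, so arg q / 3 ± π/6 stays within π/2 - ε/3; and √3
  -- is the modulus of 1-ω and of 1-ω².
  refine ⟨Real.sqrt 3 * Real.cos (Real.pi / 2 - ε / 3),
    mul_pos hs3 (Real.cos_pos_of_mem_Ioo ⟨by linarith, by linarith⟩), fun q hq hc => ?_⟩
  have harg : |q.arg| ≤ Real.pi - ε := by
    by_contra! hlt
    have h1 : Real.cos |q.arg| < Real.cos (Real.pi - ε) :=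
      Real.cos_lt_cos_of_nonneg_of_le_pi (by linarith) (Complex.abs_arg_le_pi q) hlt
    rw [Real.cos_pi_sub, hcos, Real.cos_abs, Complex.cos_arg hq, div_lt_iff₀ (norm_pos_iff.mpr hq)]
      at h1
    rw [InCone] at hc
    linarith
  have hφ := abs_le.mp harg
  set φ := q.arg / 3 with hφdef
  have hroot : cubeRoot q = ((‖cubeRoot q‖ : ℝ) : ℂ) * (Real.cos φ + Real.sin φ * Complex.I) := by
    have h1 : Complex.log q / 3 = ((Real.log ‖q‖ / 3 : ℝ) : ℂ) + (φ : ℝ) * Complex.I := by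
      rw [Complex.log, hφdef]; push_cast; ring
    have h2 : ‖cubeRoot q‖ = Real.exp (Real.log ‖q‖ / 3) := by
      rw [cubeRoot, h1, Complex.norm_exp]; simp
    rw [h2, cubeRoot, h1, Complex.exp_add, Complex.exp_mul_I, Complex.ofReal_exp,
      Complex.ofReal_cos, Complex.ofReal_sin]
  have e1 : (cubeRoot q * (1 - omega)).re
      = ‖cubeRoot q‖ * (Real.sqrt 3 * Real.cos (φ - Real.pi / 6)) := by
    conv_lhs => rw [hroot]
    rw [mul_assoc, Complex.re_ofReal_mul, Real.cos_sub, Real.cos_pi_div_six, Real.sin_pi_div_six]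
    congr 1
    generalize Real.cos φ = x
    generalize Real.sin φ = y
    simp [omega]
    linear_combination (-(x / 2)) * hs33
  have e2 : (cubeRoot q * (1 - omega ^ 2)).re
      = ‖cubeRoot q‖ * (Real.sqrt 3 * Real.cos (φ + Real.pi / 6)) := by
    have : (1 : ℂ) - omega ^ 2 = 2 + omega := by linear_combination (-1 : ℂ) * omega_eq
    rw [this]
    conv_lhs => rw [hroot]
    rw [mul_assoc, Complex.re_ofReal_mul, Real.cos_add, Real.cos_pi_div_six, Real.sin_pi_div_six]
    congr 1
    generalize Real.cos φ = x
    generalize Real.sin φ = y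
    simp [omega]
    linear_combination (-(x / 2)) * hs33
  have c1 : Real.cos (Real.pi / 2 - ε / 3) ≤ Real.cos (φ - Real.pi / 6) := by
    rw [← Real.cos_abs (φ - Real.pi / 6)]
    refine Real.cos_le_cos_of_nonneg_of_le_pi (abs_nonneg _) (by linarith) ?_
    rw [abs_le]; constructor <;> linarith
  have c2 : Real.cos (Real.pi / 2 - ε / 3) ≤ Real.cos (φ + Real.pi / 6) := by
    rw [← Real.cos_abs (φ + Real.pi / 6)]
    refine Real.cos_le_cos_of_nonneg_of_le_pi (abs_nonneg _) (by linarith) ?_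
    rw [abs_le]; constructor <;> linarith
  rw [e1, e2, mul_comm]
  exact ⟨by gcongr, by gcongr⟩

/-! ### Transfer of estimates along paths in the q-plane -/

/-- The squared size of the coordinates of `V`, with `coordU` measured from `e`. -/
noncomputable def energy {m : ℕ} (k : ℕ) (a : Fin m → ℂ) (V : ℂ → Fin 3 → ℂ) (e : ℂ) (q : ℂ) : ℝ :=
  ‖coordU k a V (logZ m q) - e‖ ^ 2 + ‖coordG k a (omega ^ 2) V (logZ m q)‖ ^ 2
    + ‖coordG k a omega V (logZ m q)‖ ^ 2

/-- Estimates along a path `q₀ + s d` are transferred from its end to its beginning. -/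
theorem exists_energy_transfer {m : ℕ} (k l : ℕ) (hl : 1 ≤ l) (hkl : (m + 3) * (3 + l) ≤ m + 4 + k)
    {κ c₁ : ℝ} (hκ0 : 0 ≤ κ) (hκ : κ < 1) (hc₁ : 0 < c₁)
    {K : Set (Fin m → ℂ)} (hK : IsCompact K) :
    ∃ ε R C : ℝ, 0 < ε ∧ 1 ≤ R ∧ 0 ≤ C ∧ ∀ a ∈ K, ∀ V, IsSolution a V → ∀ e q₀ d : ℂ, ∀ L : ℝ,
      R ≤ ‖q₀‖ → 0 ≤ L → ‖d - 1‖ ≤ ε →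
      (∀ s ∈ Set.Icc 0 L, InCone κ (q₀ + s * d) ∧ c₁ * (‖q₀‖ + s) ≤ ‖q₀ + s * d‖) →
      energy k a V e q₀ ≤ C * (energy k a V e (q₀ + L * d) + ‖e‖ ^ 2 / ‖q₀‖ ^ l) := by
  obtain ⟨C, hC, hbd⟩ := exists_hasDerivAt_coordG_bound k hK
  obtain ⟨c, hc, hre⟩ := exists_re_cubeRoot_ge hκ0 hκ
  -- The two summands come from the influence of the defects on U and from the residuals.
  set A : ℝ := 6 / c₁ ^ 2 + 3 * C / c₁ ^ (l + 1) with hA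
  have hA0 : 0 ≤ A := by positivity
  -- Half of the repulsion constant c pays for the O(h) coupling, for which |h| ≤ ε₀ suffices; the
  -- other half pays for the deviation of d from 1, hence the bound c/4 below.
  set ε₀ : ℝ := c / (16 * (C + 1)) with hε₀
  have hε₀0 : 0 < ε₀ := by positivity
  set R : ℝ := max 1 (max 1 (ε₀⁻¹ ^ (m + 3)) / c₁) with hR
  refine ⟨min 1 (c / 4), R, Real.exp (3 * A) * (1 + 2 * A), by positivity, le_max_left _ _,
    by positivity, fun a ha V hV e q₀ d L hq₀ hL hd hpath => ?_⟩
  have hr1 : 1 ≤ ‖q₀‖ := (le_max_left _ _).trans hq₀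
  have hd2 : ‖d‖ ≤ 2 := by
    have := norm_add_le (d - 1) 1
    rw [sub_add_cancel, norm_one] at this
    linarith [hd.trans (min_le_left _ _)]
  have hdc : ‖d - 1‖ ≤ c / 4 := hd.trans (min_le_right _ _)
  have hm3 : (0 : ℝ) < (m : ℝ) + 3 := by positivity
  have hm3c : ‖4 / ((m : ℂ) + 3)‖ = 4 / ((m : ℝ) + 3) := by
    rw [norm_div, Complex.norm_ofNat, show ((m : ℂ) + 3) = (((m : ℝ) + 3 : ℝ) : ℂ) by push_cast; rfl,
      Complex.norm_real, Real.norm_of_nonneg hm3.le]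
  set q : ℝ → ℂ := fun s => q₀ + s * d with hq
  have hqR : ∀ s ∈ Set.Icc 0 L, max 1 (ε₀⁻¹ ^ (m + 3)) ≤ ‖q s‖ := by
    intro s hs
    refine le_trans ?_ (hpath s hs).2
    have h1 : max 1 (ε₀⁻¹ ^ (m + 3)) / c₁ ≤ ‖q₀‖ + s :=
      ((le_max_right _ _).trans hq₀).trans (by linarith [hs.1])
    rwa [div_le_iff₀ hc₁, mul_comm] at h1
  have hq1 : ∀ s ∈ Set.Icc 0 L, 1 ≤ ‖q s‖ := fun s hs => (le_max_left _ _).trans (hqR s hs)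
  have hqne : ∀ s ∈ Set.Icc 0 L, q s ≠ 0 := fun s hs => norm_pos_iff.mp (by linarith [hq1 s hs])
  have hsmall : ∀ s ∈ Set.Icc 0 L, ‖small (logZ m (q s))‖ ≤ ε₀ := fun s hs =>
    norm_small_logZ_le m hε₀0 (hq1 s hs) ((le_max_right _ _).trans (hqR s hs))
  have hsmall1 : ∀ s ∈ Set.Icc 0 L, ‖small (logZ m (q s))‖ ≤ 1 := fun s hs =>
    norm_small_logZ_le_one m (hq1 s hs)
  set v : ℝ → ℂ := fun s => 4 / ((m : ℂ) + 3) * (q s)⁻¹ * d with hv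
  have hζ : ∀ s ∈ Set.Icc 0 L, HasDerivAt (fun s : ℝ => logZ m (q s)) (v s) s := by
    intro s hs
    have h1 : HasDerivAt q d s := by
      rw [hq]
      simpa using ((Complex.ofRealCLM.hasDerivAt (x := s)).mul_const d).const_add q₀
    exact (hasDerivAt_logZ m ((hpath s hs).1.mem_slitPlane hκ (hqne s hs))).comp s h1
  have hvn : ∀ s ∈ Set.Icc 0 L, ‖v s‖ ≤ 3 / ‖q s‖ := by
    intro s hs
    have h0 : 0 < ‖q s‖ := by linarith [hq1 s hs]
    simp only [hv]
    rw [norm_mul, norm_mul, hm3c, norm_inv, div_eq_mul_inv 3]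
    have h1 : 4 / ((m : ℝ) + 3) ≤ 4 / 3 := by gcongr; linarith [(Nat.cast_nonneg m : (0:ℝ) ≤ m)]
    calc 4 / ((m : ℝ) + 3) * ‖q s‖⁻¹ * ‖d‖ ≤ 4 / 3 * ‖q s‖⁻¹ * 2 := by gcongr
      _ ≤ 3 * ‖q s‖⁻¹ := by
        have : 0 ≤ ‖q s‖⁻¹ := by positivity
        linarith
  have hBv : ∀ s ∈ Set.Icc 0 L, big m (logZ m (q s)) * v s
      = -(4 / ((m : ℂ) + 3) * cubeRoot (q s) * d) := by
    intro s hs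
    have h0 := hqne s hs
    have h3 := cubeRoot_pow_three h0
    have h4 : cubeRoot (q s) ^ 4 * (q s)⁻¹ = cubeRoot (q s) := by
      rw [pow_succ, h3]; field_simp
    rw [big_logZ]
    simp only [hv]
    linear_combination (-(4 / ((m : ℂ) + 3) * d)) * h4
  have hBvn : ∀ s ∈ Set.Icc 0 L, ‖v s‖ * ‖big m (logZ m (q s))‖
      ≤ 4 / ((m : ℝ) + 3) * (2 * ‖cubeRoot (q s)‖) := by
    intro s hs
    rw [← norm_mul, mul_comm, hBv s hs, norm_neg, norm_mul, norm_mul, hm3c, mul_assoc]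
    refine mul_le_mul_of_nonneg_left ?_ (by positivity)
    rw [mul_comm]
    exact mul_le_mul_of_nonneg_right hd2 (norm_nonneg _)
  set κ' : ℝ → ℝ := fun s => 2 * ‖big m (logZ m (q s))‖⁻¹ * ‖v s‖ with hκ'
  set η : ℝ → ℝ := fun s => 2 * C * ‖v s‖ * ‖big m (logZ m (q s))‖ * ‖small (logZ m (q s))‖ with hη
  set δ : ℝ → ℝ := fun s => C * ‖v s‖ * ‖big m (logZ m (q s))‖ ^ 3
    * ‖small (logZ m (q s))‖ ^ (m + 4 + k) with hδ
  have hηb : ∀ s ∈ Set.Icc 0 L, 2 * η s ≤ 4 / ((m : ℝ) + 3) * (c / 2 * ‖cubeRoot (q s)‖) := by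
    intro s hs
    have h1 : 2 * η s = 4 * C * (‖v s‖ * ‖big m (logZ m (q s))‖) * ‖small (logZ m (q s))‖ := by
      simp only [hη]; ring
    rw [h1]
    calc 4 * C * (‖v s‖ * ‖big m (logZ m (q s))‖) * ‖small (logZ m (q s))‖
        ≤ 4 * C * (4 / ((m : ℝ) + 3) * (2 * ‖cubeRoot (q s)‖)) * ε₀ := by
          exact mul_le_mul (mul_le_mul_of_nonneg_left (hBvn s hs) (by positivity)) (hsmall s hs)
            (norm_nonneg _) (by positivity)
      _ = 4 / ((m : ℝ) + 3) * ‖cubeRoot (q s)‖ * (8 * C * ε₀) := by ring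
      _ ≤ 4 / ((m : ℝ) + 3) * ‖cubeRoot (q s)‖ * (c / 2) := by
          refine mul_le_mul_of_nonneg_left ?_ (by positivity)
          have : ε₀ * (16 * (C + 1)) = c := by rw [hε₀]; field_simp
          nlinarith
      _ = _ := by ring
  have hμ : ∀ w : ℂ, ‖1 - w‖ ≤ 2 → (∀ q : ℂ, q ≠ 0 → InCone κ q →
      c * ‖cubeRoot q‖ ≤ (cubeRoot q * (1 - w)).re) → ∀ s ∈ Set.Icc 0 L,
      2 * η s ≤ (big m (logZ m (q s)) * (w - 1) * v s).re := by
    intro w hw2 hw s hs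
    refine (hηb s hs).trans ?_
    have h1 : big m (logZ m (q s)) * (w - 1) * v s = ((4 / ((m : ℝ) + 3) : ℝ) : ℂ) *
        (cubeRoot (q s) * (1 - w) + cubeRoot (q s) * (1 - w) * (d - 1)) := by
      push_cast
      linear_combination (w - 1) * hBv s hs
    rw [h1, Complex.re_ofReal_mul, Complex.add_re]
    refine mul_le_mul_of_nonneg_left ?_ (by positivity)
    have h2 := hw _ (hqne s hs) (hpath s hs).1
    have h3 : ‖cubeRoot (q s) * (1 - w) * (d - 1)‖ ≤ ‖cubeRoot (q s)‖ * 2 * (c / 4) := by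
      rw [norm_mul, norm_mul]; gcongr
    have h4 := (abs_le.mp (Complex.abs_re_le_norm (cubeRoot (q s) * (1 - w) * (d - 1)))).1
    linarith
  have hw1 : ‖1 - omega‖ ≤ 2 := by
    refine (norm_sub_le _ _).trans ?_; rw [norm_omega, norm_one]; norm_num
  have hw2 : ‖1 - omega ^ 2‖ ≤ 2 := by
    refine (norm_sub_le _ _).trans ?_; rw [norm_omega_sq, norm_one]; norm_num
  have hcomp : ∀ s ∈ Set.Icc 0 L, ∀ (f : ℂ → ℂ) (f' : ℂ), HasDerivAt f f' (logZ m (q s)) →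
      HasDerivAt (fun s : ℝ => f (logZ m (q s))) (f' * v s) s := fun s hs f f' hf =>
    HasDerivAt.comp (h := fun s : ℝ => logZ m (q s)) s hf (hζ s hs)
  have hD1 : ∀ s ∈ Set.Icc 0 L, HasDerivAt (fun s : ℝ => coordU k a V (logZ m (q s)) - e)
      ((big m (logZ m (q s)))⁻¹ * coordP k a V (logZ m (q s)) * v s) s := fun s hs =>
    (hcomp s hs _ _ (hasDerivAt_coordU k hV (logZ m (q s)))).sub_const e
  choose! g₁ hg₁ using fun (s : ℝ) (hs : s ∈ Set.Icc 0 L) =>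
    hbd a ha V hV (logZ m (q s)) (hsmall1 s hs) omega omega_eq norm_omega
  choose! g₂ hg₂ using fun (s : ℝ) (hs : s ∈ Set.Icc 0 L) =>
    hbd a ha V hV (logZ m (q s)) (hsmall1 s hs) (omega ^ 2) omega_sq_eq norm_omega_sq
  rw [omega_pow_four] at hg₂
  have hPS : ∀ s, ‖coordP k a V (logZ m (q s))‖ + ‖coordS k a V (logZ m (q s))‖ ≤
      2 * (‖coordG k a (omega ^ 2) V (logZ m (q s))‖ + ‖coordG k a omega V (logZ m (q s))‖) :=
    fun s => norm_coordP_add_norm_coordS_le k a V _ omega_eq norm_omega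
  have hU : ∀ s, ‖coordU k a V (logZ m (q s))‖ ≤ ‖coordU k a V (logZ m (q s)) - e‖ + ‖e‖ := by
    intro s
    have := norm_add_le (coordU k a V (logZ m (q s)) - e) e
    rwa [sub_add_cancel] at this
  have hG : ∀ s, ∀ g G μ : ℂ, ‖g - μ * G‖ ≤
      C * (‖big m (logZ m (q s))‖ * ‖small (logZ m (q s))‖ * (‖coordP k a V (logZ m (q s))‖ +
        ‖coordS k a V (logZ m (q s))‖) + ‖big m (logZ m (q s))‖ ^ 3 *
        ‖small (logZ m (q s))‖ ^ (m + 4 + k) * ‖coordU k a V (logZ m (q s))‖) →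
      ‖g * v s - μ * v s * G‖ ≤ η s * (‖coordG k a (omega ^ 2) V (logZ m (q s))‖ +
        ‖coordG k a omega V (logZ m (q s))‖)
        + δ s * (‖coordU k a V (logZ m (q s)) - e‖ + ‖e‖) := by
    intro s g G μ hg
    have h1 : g * v s - μ * v s * G = v s * (g - μ * G) := by ring
    rw [h1, norm_mul]
    refine (mul_le_mul_of_nonneg_left hg (norm_nonneg (v s))).trans ?_
    have h2 := mul_le_mul_of_nonneg_left (hPS s)
      (by positivity : 0 ≤ C * ‖v s‖ * ‖big m (logZ m (q s))‖ * ‖small (logZ m (q s))‖)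
    have h3 := mul_le_mul_of_nonneg_left (hU s) (by simp only [hδ]; positivity : 0 ≤ δ s)
    simp only [hη]
    simp only [hδ] at h3 ⊢
    linarith
  have hrs : ∀ s ∈ Set.Icc 0 L, 1 ≤ ‖q₀‖ + s := fun s hs => by linarith [hs.1]
  have hδl : ∀ s ∈ Set.Icc 0 L, δ s ≤ 3 * C / c₁ ^ (l + 1) / (‖q₀‖ + s) ^ (l + 1) := by
    intro s hs
    have h0 : 0 < ‖q s‖ := by linarith [hq1 s hs]
    have hrs := hrs s hs
    set b := ‖big m (logZ m (q s))‖ with hb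
    set h := ‖small (logZ m (q s))‖ with hh
    have hbq : ‖q s‖ ≤ b := norm_le_norm_big_logZ m (hq1 s hs)
    have hb0 : 0 < b := h0.trans_le hbq
    -- With |h|^{m+3}|X| = 1, the exponent (m+3)(3+l) cancels the three powers of X and leaves
    -- |X|^{-l}.
    have h1 : b ^ 3 * h ^ (m + 4 + k) ≤ (‖q s‖ ^ l)⁻¹ := by
      calc b ^ 3 * h ^ (m + 4 + k) ≤ b ^ 3 * h ^ ((m + 3) * (3 + l)) := by
            refine mul_le_mul_of_nonneg_left ?_ (by positivity)
            exact pow_le_pow_of_le_one (norm_nonneg _) (hsmall1 s hs) hkl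
        _ = (b ^ l)⁻¹ := by
            have h2 : (h ^ (m + 3) * b) ^ (3 + l) = 1 := by
              rw [norm_small_pow_mul_norm_big, one_pow]
            rw [pow_mul]
            refine eq_inv_of_mul_eq_one_left ?_
            rw [← h2]
            ring
        _ ≤ _ := by gcongr
    calc δ s = C * ‖v s‖ * (b ^ 3 * h ^ (m + 4 + k)) := by simp only [hδ]; ring
      _ ≤ C * (3 / ‖q s‖) * (‖q s‖ ^ l)⁻¹ := by
          gcongr
          exact hvn s hs
      _ = 3 * C / ‖q s‖ ^ (l + 1) := by rw [pow_succ]; field_simp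
      _ ≤ 3 * C / (c₁ * (‖q₀‖ + s)) ^ (l + 1) := by
          gcongr
          exact (hpath s hs).2
      _ = _ := by rw [mul_pow, div_div]
  have hκb : ∀ s ∈ Set.Icc 0 L, κ' s ≤ 6 / c₁ ^ 2 / (‖q₀‖ + s) ^ 2 := by
    intro s hs
    have h0 : 0 < ‖q s‖ := by linarith [hq1 s hs]
    have hrs := hrs s hs
    calc κ' s ≤ 2 * ‖q s‖⁻¹ * (3 / ‖q s‖) := by
          simp only [hκ']
          gcongr
          · exact norm_le_norm_big_logZ m (hq1 s hs)
          · exact hvn s hs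
      _ = 6 / ‖q s‖ ^ 2 := by field_simp; norm_num
      _ ≤ 6 / (c₁ * (‖q₀‖ + s)) ^ 2 := by
          gcongr
          exact (hpath s hs).2
      _ = _ := by rw [mul_pow, div_div]
  have main := energy_gronwall (l := l) (A := A) (e := ‖e‖) (r := ‖q₀‖) (L := L)
    (D := fun s => coordU k a V (logZ m (q s)) - e)
    (G₁ := fun s => coordG k a (omega ^ 2) V (logZ m (q s)))
    (G₂ := fun s => coordG k a omega V (logZ m (q s)))
    (D' := fun s => (big m (logZ m (q s)))⁻¹ * coordP k a V (logZ m (q s)) * v s)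
    (G₁' := fun s => g₁ s * v s) (G₂' := fun s => g₂ s * v s)
    (μ₁ := fun s => big m (logZ m (q s)) * (omega - 1) * v s)
    (μ₂ := fun s => big m (logZ m (q s)) * (omega ^ 2 - 1) * v s)
    (κ := κ') (η := η) (δ := δ) hl hA0 hr1 hL hD1
    (fun s hs => hcomp s hs _ _ (hg₁ s hs).1)
    (fun s hs => hcomp s hs _ _ (hg₂ s hs).1)
    (fun s _ => by simp only [hκ']; positivity)
    (fun s _ => by simp only [hδ]; positivity)
    (fun s _ => by simp only [hη]; positivity)
    (fun s _ => by
      rw [norm_mul, norm_mul, norm_inv]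
      have h1 := mul_le_mul_of_nonneg_left (hPS s)
        (by positivity : 0 ≤ ‖big m (logZ m (q s))‖⁻¹ * ‖v s‖)
      have h2 : 0 ≤ ‖big m (logZ m (q s))‖⁻¹ * ‖v s‖ * ‖coordS k a V (logZ m (q s))‖ := by
        positivity
      simp only [hκ']
      linarith)
    (fun s hs => hG s _ _ _ (hg₁ s hs).2)
    (fun s hs => hG s _ _ _ (hg₂ s hs).2)
    (hμ omega hw1 fun q h1 h2 => (hre q h1 h2).1)
    (hμ (omega ^ 2) hw2 fun q h1 h2 => (hre q h1 h2).2)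
    (fun s hs => by
      have hrs := hrs s hs
      have h1 : 3 * C / c₁ ^ (l + 1) / (‖q₀‖ + s) ^ (l + 1) ≤
          3 * C / c₁ ^ (l + 1) / (‖q₀‖ + s) ^ 2 := by
        refine div_le_div_of_nonneg_left (by positivity) (by positivity) ?_
        exact pow_le_pow_right₀ hrs (by omega)
      have h2 : A / (‖q₀‖ + s) ^ 2 = 6 / c₁ ^ 2 / (‖q₀‖ + s) ^ 2 +
          3 * C / c₁ ^ (l + 1) / (‖q₀‖ + s) ^ 2 := by rw [hA, add_div]
      rw [h2]
      exact add_le_add (hκb s hs) ((hδl s hs).trans h1))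
    (fun s hs => by
      have hrs := hrs s hs
      refine (hδl s hs).trans ?_
      gcongr
      rw [hA]
      have : 0 ≤ 6 / c₁ ^ 2 := by positivity
      linarith)
  have hq0 : q 0 = q₀ := by simp [hq]
  simp only [hq0] at main
  rw [mul_assoc]
  refine main.trans (mul_le_mul_of_nonneg_left ?_ (Real.exp_pos _).le)
  have hE : 0 ≤ energy k a V e (q L) := by simp only [energy]; positivity
  have hx : 0 ≤ ‖e‖ ^ 2 / ‖q₀‖ ^ l := by positivity
  have h1 : 2 * A * ‖e‖ ^ 2 / ‖q₀‖ ^ l = 2 * A * (‖e‖ ^ 2 / ‖q₀‖ ^ l) := by ring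
  rw [h1]
  change energy k a V e (q L) + _ ≤ _
  change _ ≤ (1 + 2 * A) * (energy k a V e (q L) + _)
  nlinarith [mul_nonneg hA0 hE]

theorem exists_energy_transfer_real {m : ℕ} (k l : ℕ) (hl : 1 ≤ l)
    (hkl : (m + 3) * (3 + l) ≤ m + 4 + k) {K : Set (Fin m → ℂ)} (hK : IsCompact K) :
    ∃ R C : ℝ, 1 ≤ R ∧ 0 ≤ C ∧ ∀ a ∈ K, ∀ V, IsSolution a V → ∀ e : ℂ, ∀ r₀ r₁ : ℝ,
      R ≤ r₀ → r₀ ≤ r₁ →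
      energy k a V e r₀ ≤ C * (energy k a V e r₁ + ‖e‖ ^ 2 / r₀ ^ l) := by
  obtain ⟨ε, R, C, hε, hR, hC, h⟩ := exists_energy_transfer k l hl hkl (le_refl (0 : ℝ)) one_pos
    one_pos hK
  refine ⟨R, C, hR, hC, fun a ha V hV e r₀ r₁ h0 h1 => ?_⟩
  have hr0 : ‖(r₀ : ℂ)‖ = r₀ := by rw [Complex.norm_real, Real.norm_of_nonneg (by linarith)]
  have := h a ha V hV e r₀ 1 (r₁ - r₀) (by rwa [hr0]) (by linarith) (by simpa using hε.le) (by
    intro s hs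
    have hrs : (r₀ : ℂ) + s * 1 = ((r₀ + s : ℝ) : ℂ) := by push_cast; ring
    have h2 : 0 ≤ r₀ + s := by linarith [hs.1]
    rw [hrs, hr0, Complex.norm_real, Real.norm_of_nonneg h2, one_mul, InCone]
    refine ⟨?_, le_rfl⟩
    simpa using h2)
  rw [hr0] at this
  convert this using 4
  push_cast; ring

theorem exists_energy_transfer_cone {m : ℕ} (k l : ℕ) (hl : 1 ≤ l)
    (hkl : (m + 3) * (3 + l) ≤ m + 4 + k) {κ : ℝ} (hκ0 : 0 ≤ κ) (hκ : κ < 1)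
    {K : Set (Fin m → ℂ)} (hK : IsCompact K) :
    ∃ R C : ℝ, 1 ≤ R ∧ 0 ≤ C ∧ ∀ q₀ : ℂ, InCone κ q₀ → R ≤ ‖q₀‖ → ∃ R₁, ∀ r : ℝ, R₁ ≤ r →
      ∀ a ∈ K, ∀ V, IsSolution a V → ∀ e : ℂ,
      energy k a V e q₀ ≤ C * (energy k a V e r + ‖e‖ ^ 2 / ‖q₀‖ ^ l) := by
  have hc₁ : 0 < (1 - κ) / 4 := by linarith
  obtain ⟨ε, R, C, hε, hR, hC, h⟩ := exists_energy_transfer k l hl hkl hκ0 hκ hc₁ hK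
  -- The path is the segment from q₀ to r. The summand 3‖q₀‖ secures the lower bound on |q| with c₁
  -- = (1-κ)/4; the other brings the direction within ε of 1. The constants R and C do not depend on
  -- r, so r may tend to infinity.
  refine ⟨R, C, hR, hC, fun q₀ hq₀ hRq => ⟨3 * ‖q₀‖ + 2 * ‖q₀‖ / ε, fun r hr a ha V hV e => ?_⟩⟩
  have hQ : 1 ≤ ‖q₀‖ := hR.trans hRq
  have hQε : 0 ≤ 2 * ‖q₀‖ / ε := by positivity
  have hr0 : 0 ≤ r := by linarith
  have hrn : ‖(r : ℂ)‖ = r := by rw [Complex.norm_real, Real.norm_of_nonneg hr0]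
  set L : ℝ := ‖(r : ℂ) - q₀‖ with hLdef
  have hL1 : r - ‖q₀‖ ≤ L := by
    have := norm_sub_norm_le (r : ℂ) q₀
    rwa [hrn] at this
  have hL2 : L ≤ r + ‖q₀‖ := by
    have := norm_sub_le (r : ℂ) q₀
    rwa [hrn] at this
  have hL0 : 0 < L := by linarith
  have hLc : (L : ℂ) ≠ 0 := by exact_mod_cast hL0.ne'
  have hd : ‖((r : ℂ) - q₀) / L - 1‖ ≤ ε := by
    have h1 : ((r : ℂ) - q₀) / L - 1 = (((r - L : ℝ) : ℂ) - q₀) / L := by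
      push_cast; field_simp; ring
    have h2 : ‖((r - L : ℝ) : ℂ) - q₀‖ ≤ 2 * ‖q₀‖ := by
      refine (norm_sub_le _ _).trans ?_
      rw [Complex.norm_real, Real.norm_eq_abs]
      have : |r - L| ≤ ‖q₀‖ := abs_le.mpr ⟨by linarith, by linarith⟩
      linarith
    rw [h1, norm_div, Complex.norm_real, Real.norm_of_nonneg hL0.le, div_le_iff₀ hL0]
    refine h2.trans ?_
    have h3 : 2 * ‖q₀‖ / ε ≤ L := by linarith
    rwa [div_le_iff₀ hε, mul_comm L] at h3
  have := h a ha V hV e q₀ (((r : ℂ) - q₀) / L) L hRq hL0.le hd (by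
    intro s hs
    set t : ℝ := s / L with ht
    have ht0 : 0 ≤ t := div_nonneg hs.1 hL0.le
    have ht1 : t ≤ 1 := (div_le_one hL0).mpr hs.2
    have hst : s = t * L := by rw [ht]; field_simp
    have h1 : q₀ + s * (((r : ℂ) - q₀) / L) = ((1 - t : ℝ) : ℂ) * q₀ + ((t * r : ℝ) : ℂ) := by
      rw [hst]; push_cast; field_simp; ring
    have h2 : InCone κ (((1 - t : ℝ) : ℂ) * q₀) := hq₀.smul (by linarith)
    have h3 : 0 ≤ t * r := by positivity
    rw [h1]
    refine ⟨h2.add_ofReal hκ0 hκ h3, ?_⟩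
    refine le_trans ?_ (h2.norm_add_ofReal_ge hκ0 hκ h3)
    rw [norm_mul, Complex.norm_real, Real.norm_of_nonneg (by linarith : 0 ≤ 1 - t)]
    have h4 : ‖q₀‖ + s ≤ 2 * ((1 - t) * ‖q₀‖ + t * r) := by
      have h5 : t * L ≤ t * (r + ‖q₀‖) := mul_le_mul_of_nonneg_left hL2 ht0
      have h6 : t * (3 * ‖q₀‖) ≤ t * r := mul_le_mul_of_nonneg_left (by linarith) ht0
      rw [hst]
      nlinarith
    nlinarith)
  have hend : q₀ + L * (((r : ℂ) - q₀) / L) = r := by field_simp; ring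
  rwa [hend] at this

/-! ### Solutions and their coordinates -/

theorem IsSolution.sub {m : ℕ} {a : Fin m → ℂ} {V W : ℂ → Fin 3 → ℂ} (hV : IsSolution a V)
    (hW : IsSolution a W) : IsSolution a fun z c => V z c - W z c := by
  intro z
  refine ⟨(hV z).1.sub (hW z).1, (hV z).2.1.sub (hW z).2.1, ?_⟩
  have := (hV z).2.2.sub (hW z).2.2
  rwa [← mul_sub] at this

theorem IsSolution.sum {m : ℕ} {a : Fin m → ℂ} {V : Fin 3 → ℂ → Fin 3 → ℂ}
    (hV : ∀ i, IsSolution a (V i)) (I : Fin 3 → ℂ) :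
    IsSolution a fun z c => ∑ i, I i * V i z c := by
  intro z
  refine ⟨HasDerivAt.fun_sum fun i _ => (hV i z).1.const_mul (I i),
    HasDerivAt.fun_sum fun i _ => (hV i z).2.1.const_mul (I i), ?_⟩
  have := HasDerivAt.fun_sum (u := Finset.univ) fun i _ => (hV i z).2.2.const_mul (I i)
  rw [Finset.mul_sum]
  exact this.congr_deriv (Finset.sum_congr rfl fun i _ => by ring)

theorem coordU_sub {m : ℕ} (k : ℕ) (a : Fin m → ℂ) (V W : ℂ → Fin 3 → ℂ) (ζ : ℂ) :
    coordU k a (fun z c => V z c - W z c) ζ = coordU k a V ζ - coordU k a W ζ := by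
  simp only [coordU]; ring

theorem coordP_sub {m : ℕ} (k : ℕ) (a : Fin m → ℂ) (V W : ℂ → Fin 3 → ℂ) (ζ : ℂ) :
    coordP k a (fun z c => V z c - W z c) ζ = coordP k a V ζ - coordP k a W ζ := by
  simp only [coordP, coordU_sub]; ring

theorem coordS_sub {m : ℕ} (k : ℕ) (a : Fin m → ℂ) (V W : ℂ → Fin 3 → ℂ) (ζ : ℂ) :
    coordS k a (fun z c => V z c - W z c) ζ = coordS k a V ζ - coordS k a W ζ := by
  simp only [coordS, coordU_sub]; ring

/-- Subtracting a solution that is exactly normalized at q moves the reference value of U from 1 to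
0; transferring the difference then has no source term. -/
theorem energy_sub {m : ℕ} (k : ℕ) (a : Fin m → ℂ) (V W : ℂ → Fin 3 → ℂ) (q : ℂ)
    (hU : coordU k a W (logZ m q) = 1) (hP : coordP k a W (logZ m q) = 0)
    (hS : coordS k a W (logZ m q) = 0) :
    energy k a (fun z c => V z c - W z c) 0 q = energy k a V 1 q := by
  simp only [energy, coordG, coordU_sub, coordP_sub, coordS_sub, hU, hP, hS, sub_zero]

theorem norm_coord_le_sqrt_energy {m : ℕ} (k : ℕ) (a : Fin m → ℂ) (V : ℂ → Fin 3 → ℂ) (e q : ℂ) :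
    ‖coordU k a V (logZ m q) - e‖ ≤ Real.sqrt (energy k a V e q) ∧
    ‖coordP k a V (logZ m q)‖ ≤ 4 * Real.sqrt (energy k a V e q) ∧
    ‖coordS k a V (logZ m q)‖ ≤ 4 * Real.sqrt (energy k a V e q) := by
  have h := norm_coordP_add_norm_coordS_le k a V (logZ m q) omega_eq norm_omega
  have h0 : ‖coordU k a V (logZ m q) - e‖ ≤ Real.sqrt (energy k a V e q) :=
    Real.le_sqrt_of_sq_le (by
      simp only [energy]
      have := sq_nonneg ‖coordG k a (omega ^ 2) V (logZ m q)‖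
      have := sq_nonneg ‖coordG k a omega V (logZ m q)‖
      linarith)
  have h1 : ‖coordG k a (omega ^ 2) V (logZ m q)‖ ≤ Real.sqrt (energy k a V e q) :=
    Real.le_sqrt_of_sq_le (by
      simp only [energy]
      have := sq_nonneg ‖coordU k a V (logZ m q) - e‖
      have := sq_nonneg ‖coordG k a omega V (logZ m q)‖
      linarith)
  have h2 : ‖coordG k a omega V (logZ m q)‖ ≤ Real.sqrt (energy k a V e q) :=
    Real.le_sqrt_of_sq_le (by
      simp only [energy]
      have := sq_nonneg ‖coordU k a V (logZ m q) - e‖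
      have := sq_nonneg ‖coordG k a (omega ^ 2) V (logZ m q)‖
      linarith)
  have := norm_nonneg (coordP k a V (logZ m q))
  have := norm_nonneg (coordS k a V (logZ m q))
  exact ⟨h0, by linarith, by linarith⟩

/-- The vector `(y, y', y'')` with coordinates `U`, `P`, `S`. -/
noncomputable def fromCoord {m : ℕ} (k : ℕ) (a : Fin m → ℂ) (ζ U P S : ℂ) : Fin 3 → ℂ :=
  ![Complex.exp (phase k a ζ) * U,
    (small ζ ^ m)⁻¹ * (Complex.exp (phase k a ζ) * ((big m ζ ^ 2)⁻¹ * P +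
      evalAt a (small ζ) (PowerSeries.trunc (m + 4 + k) (slopeSeries m)) * U)),
    (small ζ ^ (2 * m))⁻¹ * (Complex.exp (phase k a ζ) * ((big m ζ ^ 2)⁻¹ * S +
      evalAt a (small ζ) (PowerSeries.trunc (m + 4 + k) (bendSeries m)) * U))]

theorem fromCoord_coord {m : ℕ} (k : ℕ) (a : Fin m → ℂ) (V : ℂ → Fin 3 → ℂ) (ζ : ℂ) :
    fromCoord k a ζ (coordU k a V ζ) (coordP k a V ζ) (coordS k a V ζ) = V (Complex.exp ζ) := by
  have h1 := small_ne_zero ζ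
  have h2 := big_ne_zero m ζ
  have h3 := Complex.exp_ne_zero (phase k a ζ)
  ext c
  fin_cases c <;> simp only [fromCoord, coordP, coordS, coordU, Complex.exp_neg, Fin.zero_eta,
    Fin.mk_one, Fin.reduceFinMk, Matrix.cons_val_zero, Matrix.cons_val_one, Matrix.cons_val] <;>
  field_simp <;> ring

theorem coordU_eq_of_fromCoord {m : ℕ} {k : ℕ} {a : Fin m → ℂ} {V : ℂ → Fin 3 → ℂ} {ζ U P S : ℂ}
    (h : V (Complex.exp ζ) = fromCoord k a ζ U P S) :
    coordU k a V ζ = U ∧ coordP k a V ζ = P ∧ coordS k a V ζ = S := by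
  have h1 := small_ne_zero ζ
  have h2 := big_ne_zero m ζ
  have h3 := Complex.exp_ne_zero (phase k a ζ)
  have hU : coordU k a V ζ = U := by
    simp only [coordU, h, fromCoord, Complex.exp_neg, Matrix.cons_val_zero]
    field_simp
  refine ⟨hU, ?_, ?_⟩
  · simp only [coordP, hU, h, fromCoord, Complex.exp_neg, Matrix.cons_val_one,
      Matrix.cons_val_zero]
    field_simp
    ring
  · simp only [coordS, hU, h, fromCoord, Complex.exp_neg, Matrix.cons_val]
    field_simp
    ring

theorem differentiable_expo {m : ℕ} (ζ : ℂ) : Differentiable ℂ fun a : Fin m → ℂ => expo a ζ := by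
  refine (differentiable_const _).add (Differentiable.fun_sum fun N _ => ?_)
  exact (differentiable_mvPolynomial_eval _).mul (differentiable_const _)

theorem differentiable_evalAt_left {m : ℕ} (p : Polynomial (MvPolynomial (Fin m) ℂ)) (h : ℂ) :
    Differentiable ℂ fun a : Fin m → ℂ => evalAt a h p := by
  have h1 : ∀ a : Fin m → ℂ, evalAt a h p = ∑ n ∈ p.support,
      MvPolynomial.eval a (p.coeff n) * h ^ n := fun a => by
    simp only [evalAt, Polynomial.coe_eval₂RingHom, Polynomial.eval₂_eq_sum, Polynomial.sum_def]
  simp only [h1]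
  exact Differentiable.fun_sum fun n _ => (differentiable_mvPolynomial_eval _).mul_const _

theorem differentiable_phase {m : ℕ} (k : ℕ) (ζ : ℂ) :
    Differentiable ℂ fun a : Fin m → ℂ => phase k a ζ :=
  ((differentiable_expo ζ).add ((differentiable_mvPolynomial_eval _).mul
    (differentiable_const _))).add (differentiable_evalAt_left _ _)

theorem differentiable_fromCoord {m : ℕ} (k : ℕ) (ζ U P S : ℂ) (c : Fin 3) :
    Differentiable ℂ fun a : Fin m → ℂ => fromCoord k a ζ U P S c := by
  have h1 := (differentiable_phase (m := m) k ζ).cexp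
  have h2 := differentiable_evalAt_left (PowerSeries.trunc (m + 4 + k) (slopeSeries m)) (small ζ)
  have h3 := differentiable_evalAt_left (PowerSeries.trunc (m + 4 + k) (bendSeries m)) (small ζ)
  fin_cases c <;> simp only [fromCoord, Fin.zero_eta,
    Fin.mk_one, Fin.reduceFinMk, Matrix.cons_val_zero, Matrix.cons_val_one, Matrix.cons_val]
  · exact h1.mul_const _
  · exact (h1.mul ((h2.mul_const _).const_add _)).const_mul _
  · exact (h1.mul ((h3.mul_const _).const_add _)).const_mul _

theorem exists_norm_le_of_isCompact {m : ℕ} {K : Set (Fin m → ℂ)} (hK : IsCompact K)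
    {f : (Fin m → ℂ) → ℂ} (hf : Differentiable ℂ f) : ∃ C, 0 ≤ C ∧ ∀ a ∈ K, ‖f a‖ ≤ C := by
  obtain ⟨C, hC⟩ := hK.exists_bound_of_continuousOn hf.continuous.continuousOn
  exact ⟨max C 0, le_max_right _ _, fun a ha => (hC a ha).trans (le_max_left _ _)⟩

/-- For fixed a and ζ the map is linear in (U, P, S), with coefficients entire in a. -/
theorem exists_norm_fromCoord_le {m : ℕ} (k : ℕ) (ζ : ℂ) {K : Set (Fin m → ℂ)}
    (hK : IsCompact K) : ∃ C, 0 ≤ C ∧ ∀ a ∈ K, ∀ U P S c,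
      ‖fromCoord k a ζ U P S c‖ ≤ C * (‖U‖ + ‖P‖ + ‖S‖) := by
  have hlin : ∀ a : Fin m → ℂ, ∀ U P S c, fromCoord k a ζ U P S c =
      U * fromCoord k a ζ 1 0 0 c + P * fromCoord k a ζ 0 1 0 c + S * fromCoord k a ζ 0 0 1 c := by
    intro a U P S c
    fin_cases c <;> simp only [fromCoord, Fin.zero_eta, Fin.mk_one, Fin.reduceFinMk,
      Matrix.cons_val_zero, Matrix.cons_val_one, Matrix.cons_val] <;> ring
  choose C1 hC1 h1 using fun c =>
    exists_norm_le_of_isCompact hK (differentiable_fromCoord (m := m) k ζ 1 0 0 c)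
  choose C2 hC2 h2 using fun c =>
    exists_norm_le_of_isCompact hK (differentiable_fromCoord (m := m) k ζ 0 1 0 c)
  choose C3 hC3 h3 using fun c =>
    exists_norm_le_of_isCompact hK (differentiable_fromCoord (m := m) k ζ 0 0 1 c)
  refine ⟨∑ c, (C1 c + C2 c + C3 c),
    Finset.sum_nonneg fun c _ => by have := hC1 c; have := hC2 c; have := hC3 c; positivity,
    fun a ha U P S c => ?_⟩
  have hc : C1 c + C2 c + C3 c ≤ ∑ c, (C1 c + C2 c + C3 c) :=
    Finset.single_le_sum (f := fun c => C1 c + C2 c + C3 c)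
      (fun c _ => by have := hC1 c; have := hC2 c; have := hC3 c; positivity) (Finset.mem_univ c)
  rw [hlin]
  calc _ ≤ ‖U‖ * C1 c + ‖P‖ * C2 c + ‖S‖ * C3 c := by
        refine (norm_add_le _ _).trans (add_le_add ((norm_add_le _ _).trans (add_le_add ?_ ?_)) ?_)
        · rw [norm_mul]; exact mul_le_mul_of_nonneg_left (h1 c a ha) (norm_nonneg _)
        · rw [norm_mul]; exact mul_le_mul_of_nonneg_left (h2 c a ha) (norm_nonneg _)
        · rw [norm_mul]; exact mul_le_mul_of_nonneg_left (h3 c a ha) (norm_nonneg _)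
    _ ≤ (C1 c + C2 c + C3 c) * (‖U‖ + ‖P‖ + ‖S‖) := by
        have := hC1 c; have := hC2 c; have := hC3 c
        have := norm_nonneg U; have := norm_nonneg P; have := norm_nonneg S
        nlinarith [mul_nonneg (hC1 c) (norm_nonneg P), mul_nonneg (hC1 c) (norm_nonneg S),
          mul_nonneg (hC2 c) (norm_nonneg U), mul_nonneg (hC2 c) (norm_nonneg S),
          mul_nonneg (hC3 c) (norm_nonneg U), mul_nonneg (hC3 c) (norm_nonneg P)]
    _ ≤ _ := mul_le_mul_of_nonneg_right hc (by positivity)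

/-! ### The entire limit solution -/

/-- The equation has no y'' term, so by Liouville's formula the Wronskian is constant. Its value 1
makes the adjugate the inverse, which keeps the coefficients of a solution entire in a. -/
theorem det_wronskian_eq_one {m : ℕ} {a : Fin m → ℂ} {V : Fin 3 → ℂ → Fin 3 → ℂ}
    (hV : ∀ i, IsSolution a (V i)) (h0 : ∀ i c, V i 0 c = if i = c then 1 else 0) (z : ℂ) :
    (Matrix.of fun c i => V i z c).det = 1 := by
  have hd : ∀ z, HasDerivAt (fun z => (Matrix.of fun c i => V i z c).det) 0 z := by
    intro z
    have hy := fun i => (hV i z).1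
    have hy' := fun i => (hV i z).2.1
    have hy'' := fun i => (hV i z).2.2
    simp only [Matrix.det_fin_three, Matrix.of_apply]
    have h := ((((((hy 0).mul (hy' 1)).mul (hy'' 2)).sub (((hy 0).mul (hy' 2)).mul (hy'' 1))).sub
      (((hy 1).mul (hy' 0)).mul (hy'' 2))).add (((hy 1).mul (hy' 2)).mul (hy'' 0))).add
      (((hy 2).mul (hy' 0)).mul (hy'' 1)) |>.sub (((hy 2).mul (hy' 1)).mul (hy'' 0))
    refine h.congr_deriv ?_
    simp only [Pi.mul_apply]
    ring
  have hc := is_const_of_deriv_eq_zero (fun z => (hd z).differentiableAt)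
    (fun z => (hd z).deriv) z 0
  rw [hc]
  simp only [Matrix.det_fin_three, Matrix.of_apply, h0]
  simp

theorem differentiable_adjugate_apply {E : Type*} [NormedAddCommGroup E] [NormedSpace ℂ E]
    {W : E → Matrix (Fin 3) (Fin 3) ℂ} (hW : ∀ i j, Differentiable ℂ fun x => W x i j)
    (i j : Fin 3) : Differentiable ℂ fun x => (W x).adjugate i j := by
  have h : ∀ p q r s t u v w : Fin 3, Differentiable ℂ fun x =>
      W x p q * W x r s - W x t u * W x v w := fun p q r s t u v w =>
    ((hW p q).mul (hW r s)).sub ((hW t u).mul (hW v w))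
  have h' : ∀ p q r s t u v w : Fin 3, Differentiable ℂ fun x =>
      -(W x p q * W x r s) + W x t u * W x v w := fun p q r s t u v w =>
    ((hW p q).mul (hW r s)).neg.add ((hW t u).mul (hW v w))
  simp only [Matrix.adjugate_fin_three]
  fin_cases i <;> fin_cases j <;> simp only [Fin.zero_eta, Fin.mk_one, Fin.reduceFinMk,
    Matrix.of_apply, Matrix.cons_val_zero, Matrix.cons_val_one, Matrix.cons_val] <;>
    first | exact h _ _ _ _ _ _ _ _ | exact h' _ _ _ _ _ _ _ _

/-- There is a solution, entire in `(z, a)`, that is the limit of the solutions which agree with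
the approximate one at the points `q = j` of the central ray. -/
theorem exists_limit_solution (m k : ℕ) (hk : (m + 3) * 4 ≤ m + 4 + k) :
    ∃ (V : ℂ → (Fin m → ℂ) → Fin 3 → ℂ) (Vj : ℕ → (Fin m → ℂ) → ℂ → Fin 3 → ℂ),
      (∀ a, IsSolution a fun z => V z a) ∧
      (∀ c, Differentiable ℂ fun x : ℂ × (Fin m → ℂ) => V x.1 x.2 c) ∧
      (∀ j a, IsSolution a (Vj j a)) ∧
      (∀ j a, Vj j a (Complex.exp (logZ m (j : ℝ))) = fromCoord k a (logZ m (j : ℝ)) 1 0 0) ∧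
      ∀ a z c, Filter.Tendsto (fun j => Vj j a z c) Filter.atTop (nhds (V z a c)) := by
  obtain ⟨Φ, hΦ, hΦd, hΦ0⟩ := exists_fundamental_system m
  let W : ℂ → (Fin m → ℂ) → Matrix (Fin 3) (Fin 3) ℂ := fun z a => Matrix.of fun c i => Φ i z a c
  have hdet : ∀ z a, (W z a).det = 1 := fun z a =>
    det_wronskian_eq_one (fun i => hΦ i a) (fun i c => hΦ0 i a c) z
  have hWd : ∀ z c i, Differentiable ℂ fun a => W z a c i := by
    intro z c i
    have h1 : Differentiable ℂ fun a : Fin m → ℂ => (z, a) :=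
      (differentiable_const z).prodMk differentiable_fun_id
    exact (hΦd i c).comp h1
  have hadj : ∀ z c i, Differentiable ℂ fun a => (W z a).adjugate c i := fun z c i =>
    differentiable_adjugate_apply (hWd z) c i
  let I : ℕ → (Fin m → ℂ) → Fin 3 → ℂ := fun j a =>
    (W (Complex.exp (logZ m (j : ℝ))) a).adjugate.mulVec (fromCoord k a (logZ m (j : ℝ)) 1 0 0)
  let Vj : ℕ → (Fin m → ℂ) → ℂ → Fin 3 → ℂ := fun j a z c => ∑ i, I j a i * Φ i z a c
  have hVjW : ∀ j a z, Vj j a z = (W z a).mulVec (I j a) := by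
    intro j a z
    ext c
    simp only [Vj, W, Matrix.mulVec, dotProduct, Matrix.of_apply]
    exact Finset.sum_congr rfl fun i _ => mul_comm _ _
  have hVjsol : ∀ j a, IsSolution a (Vj j a) := fun j a =>
    IsSolution.sum (fun i => hΦ i a) (I j a)
  have hVjinit : ∀ j a, Vj j a (Complex.exp (logZ m (j : ℝ)))
      = fromCoord k a (logZ m (j : ℝ)) 1 0 0 := by
    intro j a
    rw [hVjW]
    simp only [I]
    rw [Matrix.mulVec_mulVec, Matrix.mul_adjugate, hdet, one_smul, Matrix.one_mulVec]
  have hId : ∀ j i, Differentiable ℂ fun a => I j a i := by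
    intro j i
    simp only [I, Matrix.mulVec, dotProduct]
    exact Differentiable.fun_sum fun c _ => (hadj _ i c).mul (differentiable_fromCoord k _ 1 0 0 c)
  have hinv : ∀ z a (J : Fin 3 → ℂ), (W z a).adjugate.mulVec ((W z a).mulVec J) = J := by
    intro z a J
    rw [Matrix.mulVec_mulVec, Matrix.adjugate_mul, hdet, one_smul, Matrix.one_mulVec]
  have hcauchy : ∀ K : Set (Fin m → ℂ), IsCompact K → ∃ (N : ℕ) (M : ℝ), ∀ a ∈ K, ∀ i j : ℕ,
      N ≤ i → i ≤ j → ∀ c, ‖I j a c - I i a c‖ ≤ M * Real.sqrt ((i : ℝ)⁻¹) := by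
    intro K hK
    -- The weakest transfer, l = 1, already makes the energies at q = R decay like 1/i.
    obtain ⟨R, C, hR, hC, htr⟩ := exists_energy_transfer_real k 1 le_rfl hk hK
    obtain ⟨M₁, hM₁, hfrom⟩ := exists_norm_fromCoord_le k (logZ m (R : ℝ)) hK
    choose M₂ hM₂ hadjb using fun p : Fin 3 × Fin 3 =>
      exists_norm_le_of_isCompact hK (hadj (Complex.exp (logZ m (R : ℝ))) p.1 p.2)
    refine ⟨⌈R⌉₊, ∑ p, M₂ p * (M₁ * (9 * C)), fun a ha i j hi hij c => ?_⟩
    have hRi : R ≤ (i : ℝ) := (Nat.le_ceil R).trans (by exact_mod_cast hi)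
    have hi0 : (0 : ℝ) < i := by linarith
    obtain ⟨cU, cP, cS⟩ := coordU_eq_of_fromCoord (hVjinit j a)
    have hj0 : energy k a (Vj j a) 1 ((j : ℝ) : ℂ) = 0 := by
      simp only [energy, coordG, cU, cP, cS]
      simp
    have e1 := htr a ha (Vj j a) (hVjsol j a) 1 i j hRi (by exact_mod_cast hij)
    rw [hj0, norm_one, one_pow, pow_one, zero_add, one_div] at e1
    obtain ⟨dU, dP, dS⟩ := coordU_eq_of_fromCoord (hVjinit i a)
    -- V_j is compared with V_i at q = i, where V_i is normalized; the difference is then carried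
    -- back to the fixed point q = R.
    have e2 := energy_sub k a (Vj j a) (Vj i a) ((i : ℝ) : ℂ) dU dP dS
    have e3 := htr a ha _ ((hVjsol j a).sub (hVjsol i a)) 0 R i le_rfl hRi
    rw [e2, norm_zero, zero_pow two_ne_zero, zero_div, add_zero] at e3
    have e4 : energy k a (fun z c => Vj j a z c - Vj i a z c) 0 ((R : ℝ) : ℂ)
        ≤ C ^ 2 * (i : ℝ)⁻¹ := by
      refine e3.trans ?_
      have := mul_le_mul_of_nonneg_left e1 hC
      linarith
    have e5 : Real.sqrt (energy k a (fun z c => Vj j a z c - Vj i a z c) 0 ((R : ℝ) : ℂ))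
        ≤ C * Real.sqrt ((i : ℝ)⁻¹) := by
      refine (Real.sqrt_le_sqrt e4).trans ?_
      rw [Real.sqrt_mul (by positivity), Real.sqrt_sq hC]
    obtain ⟨f1, f2, f3⟩ := norm_coord_le_sqrt_energy k a
      (fun z c => Vj j a z c - Vj i a z c) 0 ((R : ℝ) : ℂ)
    rw [sub_zero] at f1
    -- The 9 is 1 + 4 + 4, the sum of the constants in `norm_coord_le_sqrt_energy`.
    have e6 : ∀ c', ‖Vj j a (Complex.exp (logZ m (R : ℝ))) c' -
        Vj i a (Complex.exp (logZ m (R : ℝ))) c'‖ ≤ M₁ * (9 * C) * Real.sqrt ((i : ℝ)⁻¹) := by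
      intro c'
      have h1 := congrFun (fromCoord_coord k a (fun z c => Vj j a z c - Vj i a z c)
        (logZ m (R : ℝ))) c'
      rw [← h1]
      refine (hfrom a ha _ _ _ c').trans ?_
      rw [mul_assoc]
      refine mul_le_mul_of_nonneg_left ?_ hM₁
      linarith
    have e7 : I j a c - I i a c = ∑ c', (W (Complex.exp (logZ m (R : ℝ))) a).adjugate c c' *
        (Vj j a (Complex.exp (logZ m (R : ℝ))) c' - Vj i a (Complex.exp (logZ m (R : ℝ))) c') := by
      conv_lhs => rw [← hinv (Complex.exp (logZ m (R : ℝ))) a (I j a),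
        ← hinv (Complex.exp (logZ m (R : ℝ))) a (I i a), ← hVjW, ← hVjW]
      simp only [Matrix.mulVec, dotProduct, mul_sub, Finset.sum_sub_distrib]
    rw [e7, Finset.sum_mul, Fintype.sum_prod_type]
    have e8 : ∀ c₁ : Fin 3, 0 ≤ ∑ c₂, M₂ (c₁, c₂) * (M₁ * (9 * C)) * Real.sqrt ((i : ℝ)⁻¹) :=
      fun c₁ => Finset.sum_nonneg fun c₂ _ => by
        have := hM₂ (c₁, c₂)
        positivity
    refine le_trans ?_ (Finset.single_le_sum (fun c₁ _ => e8 c₁) (Finset.mem_univ c))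
    refine (norm_sum_le _ _).trans (Finset.sum_le_sum fun c' _ => ?_)
    rw [norm_mul, mul_assoc]
    exact mul_le_mul (hadjb (c, c') a ha) (e6 c') (norm_nonneg _) (hM₂ _)
  have hucs : ∀ K : Set (Fin m → ℂ), IsCompact K → ∀ c,
      UniformCauchySeqOn (fun j a => I j a c) Filter.atTop K := by
    intro K hK c
    obtain ⟨N, M, hNM⟩ := hcauchy K hK
    have hlim : Filter.Tendsto (fun i : ℕ => M * Real.sqrt ((i : ℝ)⁻¹)) Filter.atTop (nhds 0) := by
      have := ((tendsto_inv_atTop_nhds_zero_nat (𝕜 := ℝ)).sqrt).const_mul M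
      simpa using this
    rw [Metric.uniformCauchySeqOn_iff]
    intro ε hε
    obtain ⟨N', hN'⟩ := Filter.eventually_atTop.mp (hlim.eventually_lt_const hε)
    refine ⟨max N N', fun i hi j hj a ha => ?_⟩
    rw [dist_eq_norm]
    rcases le_total i j with h | h
    · rw [norm_sub_rev]
      exact (hNM a ha i j ((le_max_left _ _).trans hi) h c).trans_lt
        (hN' i ((le_max_right _ _).trans hi))
    · exact (hNM a ha j i ((le_max_left _ _).trans hj) h c).trans_lt
        (hN' j ((le_max_right _ _).trans hj))
  have hpt : ∀ a c, ∃ L, Filter.Tendsto (fun j => I j a c) Filter.atTop (nhds L) := fun a c =>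
    cauchySeq_tendsto_of_complete ((hucs {a} isCompact_singleton c).cauchySeq rfl)
  choose J hJ using hpt
  have hJd : ∀ c, Differentiable ℂ fun a => J a c := by
    intro c
    refine differentiable_of_locally_tendstoUniformlyOn (F := fun j a => I j a c)
      (fun j => hId j c) fun x => ⟨1, one_pos, ?_⟩
    exact ((hucs _ (isCompact_closedBall x 1) c).mono
      Metric.ball_subset_closedBall).tendstoUniformlyOn_of_tendsto fun a _ => hJ a c
  refine ⟨fun z a c => ∑ i, J a i * Φ i z a c, Vj, fun a => IsSolution.sum (fun i => hΦ i a) (J a),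
    fun c => ?_, hVjsol, hVjinit, fun a z c => ?_⟩
  · refine Differentiable.fun_sum fun i _ => Differentiable.mul ?_ (hΦd i c)
    exact (hJd i).comp differentiable_snd
  · exact tendsto_finsetSum _ fun i _ => (hJ a i).mul_const _

/-! ### Approximation to every order -/

theorem X_pow_dvd_trunc_sub_trunc {R : Type*} [CommRing R] {n n' : ℕ} (h : n ≤ n')
    (f : PowerSeries R) :
    Polynomial.X ^ n ∣ PowerSeries.trunc n f - PowerSeries.trunc n' f := by
  rw [Polynomial.X_pow_dvd_iff]
  intro d hd
  rw [Polynomial.coeff_sub, PowerSeries.coeff_trunc, PowerSeries.coeff_trunc, if_pos hd,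
    if_pos (by omega), sub_self]

theorem X_dvd_trunc_tailSeries (m n : ℕ) :
    Polynomial.X ^ 1 ∣ PowerSeries.trunc n (tailSeries m) := by
  rw [Polynomial.X_pow_dvd_iff]
  intro d hd
  obtain rfl : d = 0 := by omega
  rw [PowerSeries.coeff_trunc]
  simp [tailSeries]

theorem evalAt_zero_trunc_tailSeries {m : ℕ} (n : ℕ) (a : Fin m → ℂ) :
    evalAt a 0 (PowerSeries.trunc n (tailSeries m)) = 0 := by
  obtain ⟨q, hq⟩ := X_dvd_trunc_tailSeries m n
  rw [hq, map_mul, map_pow, evalAt_X]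
  simp

theorem continuous_evalAt_right {m : ℕ} (a : Fin m → ℂ)
    (p : Polynomial (MvPolynomial (Fin m) ℂ)) : Continuous fun h => evalAt a h p :=
  continuous_iff_continuousAt.mpr fun h => (hasDerivAt_evalAt a h p).continuousAt

theorem tendsto_small_logZ (m : ℕ) :
    Filter.Tendsto (fun j : ℕ => small (logZ m ((j : ℝ) : ℂ))) Filter.atTop (nhds 0) := by
  rw [Metric.tendsto_atTop]
  intro ε hε
  refine ⟨⌈max 1 ((ε / 2)⁻¹ ^ (m + 3))⌉₊, fun j hj => ?_⟩
  have hj' : max 1 ((ε / 2)⁻¹ ^ (m + 3)) ≤ (j : ℝ) :=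
    (Nat.le_ceil _).trans (by exact_mod_cast hj)
  have hn : ‖((j : ℝ) : ℂ)‖ = j := by rw [Complex.norm_real, Real.norm_of_nonneg (by positivity)]
  rw [dist_zero_right]
  have := norm_small_logZ_le m (q := ((j : ℝ) : ℂ)) (half_pos hε)
    (by rw [hn]; exact (le_max_left _ _).trans hj') (by rw [hn]; exact (le_max_right _ _).trans hj')
  linarith

/-- Refining the truncation does not change the solution to leading order. -/
theorem tendsto_energy_of_fromCoord {m k₀ k : ℕ} (hk₀ : m + 3 ≤ k₀) (hk : k₀ ≤ k) (a : Fin m → ℂ)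
    {V : ℕ → ℂ → Fin 3 → ℂ} (hV : ∀ j : ℕ, V j (Complex.exp (logZ m ((j : ℝ) : ℂ)))
      = fromCoord k₀ a (logZ m ((j : ℝ) : ℂ)) 1 0 0) :
    Filter.Tendsto (fun j : ℕ => energy k a (V j) 1 ((j : ℝ) : ℂ)) Filter.atTop (nhds 0) := by
  set ζ : ℕ → ℂ := fun j => logZ m ((j : ℝ) : ℂ) with hζ
  replace hV : ∀ j, V j (Complex.exp (ζ j)) = fromCoord k₀ a (ζ j) 1 0 0 := hV
  have hs : Filter.Tendsto (fun j => small (ζ j)) Filter.atTop (nhds 0) := tendsto_small_logZ m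
  have hU : ∀ j, coordU k a (V j) (ζ j) = Complex.exp
      (evalAt a (small (ζ j)) (PowerSeries.trunc (k₀ + 1) (tailSeries m)
        - PowerSeries.trunc (k + 1) (tailSeries m))) := by
    intro j
    rw [coordU, hV j]
    simp only [fromCoord, Matrix.cons_val_zero]
    rw [mul_one, ← Complex.exp_add, map_sub]
    congr 1
    simp only [phase]
    ring
  have hUt : Filter.Tendsto (fun j => coordU k a (V j) (ζ j)) Filter.atTop (nhds 1) := by
    simp only [hU]
    have h1 := ((continuous_evalAt_right a (PowerSeries.trunc (k₀ + 1) (tailSeries m)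
        - PowerSeries.trunc (k + 1) (tailSeries m))).tendsto 0).comp hs
    rw [map_sub, evalAt_zero_trunc_tailSeries, evalAt_zero_trunc_tailSeries, sub_zero] at h1
    simpa using h1.cexp
  have hdefect : ∀ f : PowerSeries (MvPolynomial (Fin m) ℂ), Filter.Tendsto (fun j =>
      big m (ζ j) ^ 2 * (evalAt a (small (ζ j)) (PowerSeries.trunc (m + 4 + k₀) f
        - PowerSeries.trunc (m + 4 + k) f) * coordU k a (V j) (ζ j)))
      Filter.atTop (nhds 0) := by
    intro f
    obtain ⟨C, hC, hb⟩ := exists_norm_evalAt_le_pow (isCompact_singleton (x := a))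
      (X_pow_dvd_trunc_sub_trunc (by omega : m + 4 + k₀ ≤ m + 4 + k) f)
    have hlim : Filter.Tendsto (fun j => C * ‖small (ζ j)‖ * ‖coordU k a (V j) (ζ j)‖)
        Filter.atTop (nhds 0) := by
      simpa using (hs.norm.const_mul C).mul hUt.norm
    refine squeeze_zero_norm' ?_ hlim
    have hsmall : ∀ᶠ j in Filter.atTop, ‖small (ζ j)‖ < 1 :=
      hs.norm.eventually_lt_const (by simp)
    filter_upwards [hsmall] with j hj
    rw [norm_mul, norm_mul, norm_pow, ← mul_assoc]
    refine mul_le_mul_of_nonneg_right ?_ (norm_nonneg _)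
    have h1 := norm_small_pow_mul_norm_big m (ζ j)
    -- Here m + 3 ≤ k₀ enters: the truncations differ at order at least 2(m+3)+1, which beats the
    -- weight X² by one power of h.
    have h2 : ‖small (ζ j)‖ ^ (m + 4 + k₀) ≤ ‖small (ζ j)‖ ^ ((m + 3) * 2 + 1) :=
      pow_le_pow_of_le_one (norm_nonneg _) hj.le (by omega)
    calc ‖big m (ζ j)‖ ^ 2 * ‖evalAt a (small (ζ j)) (PowerSeries.trunc (m + 4 + k₀) f
        - PowerSeries.trunc (m + 4 + k) f)‖
        ≤ ‖big m (ζ j)‖ ^ 2 * (C * ‖small (ζ j)‖ ^ ((m + 3) * 2 + 1)) := by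
          refine mul_le_mul_of_nonneg_left ((hb a rfl _ hj.le).trans ?_) (by positivity)
          exact mul_le_mul_of_nonneg_left h2 hC
      _ = C * ‖small (ζ j)‖ * (‖small (ζ j)‖ ^ (m + 3) * ‖big m (ζ j)‖) ^ 2 := by ring
      _ = C * ‖small (ζ j)‖ := by rw [h1]; ring
  have hVU : ∀ j, Complex.exp (phase k₀ a (ζ j)) * Complex.exp (-phase k a (ζ j))
      = coordU k a (V j) (ζ j) := by
    intro j
    rw [coordU, hV j]
    simp only [fromCoord, Matrix.cons_val_zero, mul_one]
  have hP : Filter.Tendsto (fun j => coordP k a (V j) (ζ j)) Filter.atTop (nhds 0) := by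
    refine (hdefect (slopeSeries m)).congr fun j => ?_
    have h1 := small_ne_zero (ζ j)
    rw [coordP, hV j, ← hVU j, map_sub]
    simp only [fromCoord, Matrix.cons_val_one, Matrix.cons_val_zero]
    field_simp
    ring
  have hS : Filter.Tendsto (fun j => coordS k a (V j) (ζ j)) Filter.atTop (nhds 0) := by
    refine (hdefect (bendSeries m)).congr fun j => ?_
    have h1 := small_ne_zero (ζ j)
    rw [coordS, hV j, ← hVU j, map_sub]
    simp only [fromCoord, Matrix.cons_val]
    field_simp
    ring
  have := ((((hUt.sub_const 1).norm.pow 2).add ((hP.add (hS.const_mul (omega ^ 2))).norm.pow 2)).add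
    ((hP.add (hS.const_mul omega)).norm.pow 2))
  simpa [energy, coordG, hζ] using this

theorem tendsto_energy {m : ℕ} (k : ℕ) (a : Fin m → ℂ) {Vj : ℕ → ℂ → Fin 3 → ℂ}
    {V : ℂ → Fin 3 → ℂ} (e q : ℂ)
    (h : ∀ z c, Filter.Tendsto (fun j => Vj j z c) Filter.atTop (nhds (V z c))) :
    Filter.Tendsto (fun j => energy k a (Vj j) e q) Filter.atTop (nhds (energy k a V e q)) := by
  have hU : Filter.Tendsto (fun j => coordU k a (Vj j) (logZ m q)) Filter.atTop
      (nhds (coordU k a V (logZ m q))) := (h _ 0).mul_const _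
  have hP : Filter.Tendsto (fun j => coordP k a (Vj j) (logZ m q)) Filter.atTop
      (nhds (coordP k a V (logZ m q))) :=
    ((((h _ 1).const_mul _).mul_const _).sub (hU.const_mul _)).const_mul _
  have hS : Filter.Tendsto (fun j => coordS k a (Vj j) (logZ m q)) Filter.atTop
      (nhds (coordS k a V (logZ m q))) :=
    ((((h _ 2).const_mul _).mul_const _).sub (hU.const_mul _)).const_mul _
  exact (((hU.sub_const e).norm.pow 2).add ((hP.add (hS.const_mul (omega ^ 2))).norm.pow 2)).add
    ((hP.add (hS.const_mul omega)).norm.pow 2)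

/-- The recessive solution, entire in `(z, a)`, is approximated by the formal one to every order,
uniformly in closed subsectors of the slit `q`-plane. -/
theorem exists_recessive_solution (m : ℕ) : ∃ V : ℂ → (Fin m → ℂ) → Fin 3 → ℂ,
    (∀ a, IsSolution a fun z => V z a) ∧
    (∀ c, Differentiable ℂ fun x : ℂ × (Fin m → ℂ) => V x.1 x.2 c) ∧
    ∀ l n : ℕ, 1 ≤ l → ∃ k, n ≤ k ∧ ∀ κ : ℝ, 0 ≤ κ → κ < 1 → ∀ K : Set (Fin m → ℂ), IsCompact K →
      ∃ R C : ℝ, 1 ≤ R ∧ 0 ≤ C ∧ ∀ a ∈ K, ∀ q, InCone κ q → R ≤ ‖q‖ →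
        energy k a (fun z => V z a) 1 q ≤ C / ‖q‖ ^ l := by
  -- The solution is fixed once, at one coarse truncation; only the truncation used to measure its
  -- energy depends on l and n.
  obtain ⟨V, Vj, hV, hVd, hVj, hinit, hlim⟩ := exists_limit_solution m ((m + 3) * 4) (by omega)
  refine ⟨V, hV, hVd, fun l n hl => ⟨(m + 3) * (4 + l) + n, by omega,
    fun κ hκ0 hκ K hK => ?_⟩⟩
  set k := (m + 3) * (4 + l) + n with hk
  have hk4 : (m + 3) * (4 + l) = (m + 3) * (3 + l) + (m + 3) := by ring
  have hk5 : (m + 3) * (4 + l) = (m + 3) * 4 + (m + 3) * l := by ring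
  obtain ⟨R, C, hR, hC, htr⟩ := exists_energy_transfer_cone k l hl (by omega) hκ0 hκ hK
  refine ⟨R, C, hR, hC, fun a ha q hq hqR => ?_⟩
  obtain ⟨R₁, hR₁⟩ := htr q hq hqR
  have h1 := tendsto_energy k a (Vj := fun j => Vj j a) (V := fun z => V z a) 1 q (hlim a)
  have h2 := tendsto_energy_of_fromCoord (k₀ := (m + 3) * 4) (k := k) (by omega) (by omega) a
    (V := fun j => Vj j a) (fun j => hinit j a)
  have h3 := (h2.add_const (‖(1 : ℂ)‖ ^ 2 / ‖q‖ ^ l)).const_mul C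
  rw [zero_add, norm_one, one_pow, mul_one_div] at h3
  -- The energy at the far end q = j tends to 0, so only the source term survives in the limit.
  refine le_of_tendsto_of_tendsto h1 h3 ?_
  filter_upwards [Filter.eventually_ge_atTop ⌈R₁⌉₊] with j hj
  have := hR₁ j ((Nat.le_ceil R₁).trans (by exact_mod_cast hj)) a ha (Vj j a) (hVj j a) 1
  rwa [norm_one, one_pow] at this

/-! ### From coordinate bounds to truncated expansions -/

theorem X_pow_dvd_derivative_trunc_amplitudeSeries {m n k : ℕ} (hnk : n ≤ k) :
    Polynomial.X ^ n ∣ Polynomial.derivative (PowerSeries.trunc (n + 1) (amplitudeSeries m))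
      - Polynomial.derivative (PowerSeries.trunc (k + 1) (tailSeries m))
        * PowerSeries.trunc (n + 1) (amplitudeSeries m) := by
  have h := derivative_amplitudeSeries m
  have h1 : Polynomial.derivative (PowerSeries.trunc (n + 1) (amplitudeSeries m))
      = PowerSeries.trunc n (PowerSeries.derivative _ (amplitudeSeries m)) := by
    rw [PowerSeries.trunc_derivative]
  have h2 : Polynomial.derivative (PowerSeries.trunc (k + 1) (tailSeries m))
      = PowerSeries.trunc k (PowerSeries.derivative _ (tailSeries m)) := by
    rw [PowerSeries.trunc_derivative]
  rw [h1, h2, ← X_pow_dvd_coe_iff, Polynomial.coe_sub, Polynomial.coe_mul]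
  have d1 := X_pow_dvd_sub_trunc n (PowerSeries.derivative _ (amplitudeSeries m))
  have d2 := (pow_dvd_pow _ hnk).trans
    (X_pow_dvd_sub_trunc k (PowerSeries.derivative _ (tailSeries m)))
  have d3 := (pow_dvd_pow _ n.le_succ).trans (X_pow_dvd_sub_trunc (n + 1) (amplitudeSeries m))
  have := ((d2.mul_right (amplitudeSeries m)).add
    (d3.mul_left ((PowerSeries.trunc k (PowerSeries.derivative _ (tailSeries m)) :
      Polynomial (MvPolynomial (Fin m) ℂ)) : PowerSeries (MvPolynomial (Fin m) ℂ)))).sub d1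
  refine this.trans (dvd_of_eq ?_)
  rw [h]
  ring

/-- The exponential of the truncated tail agrees with the truncated formal exponential. -/
theorem exists_norm_exp_tail_sub_le {m n k : ℕ} (hnk : n ≤ k) {K : Set (Fin m → ℂ)}
    (hK : IsCompact K) : ∃ C, 0 ≤ C ∧ ∀ a ∈ K, ∀ h : ℂ, ‖h‖ ≤ 1 →
      ‖Complex.exp (evalAt a h (PowerSeries.trunc (k + 1) (tailSeries m)))
        - evalAt a h (PowerSeries.trunc (n + 1) (amplitudeSeries m))‖ ≤ C * ‖h‖ ^ (n + 1) := by
  obtain ⟨T, hT0, hT⟩ := exists_norm_evalAt_le hK 1 (PowerSeries.trunc (k + 1) (tailSeries m))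
  obtain ⟨C, hC0, hC⟩ := exists_norm_evalAt_le_pow hK
    (X_pow_dvd_derivative_trunc_amplitudeSeries (m := m) hnk)
  refine ⟨Real.exp T * (C * Real.exp T), by positivity, fun a ha h hh => ?_⟩
  set t := PowerSeries.trunc (k + 1) (tailSeries m) with ht
  set b := PowerSeries.trunc (n + 1) (amplitudeSeries m) with hb
  -- The derivative of b e^{-t} is (b' - t'b)e^{-t}, of order n in h; the mean value inequality from
  -- 0 to h gains the missing power.
  have hder : ∀ x ∈ Metric.closedBall (0 : ℂ) ‖h‖,
      HasDerivWithinAt (fun x => evalAt a x b * Complex.exp (-evalAt a x t))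
        (evalAt a x (Polynomial.derivative b - Polynomial.derivative t * b)
          * Complex.exp (-evalAt a x t)) (Metric.closedBall (0 : ℂ) ‖h‖) x := by
    intro x _
    have := (hasDerivAt_evalAt a x b).mul (hasDerivAt_evalAt a x t).neg.cexp
    convert! this.hasDerivWithinAt using 1
    simp only [map_sub, map_mul, Pi.neg_apply]
    ring
  have hexp : ∀ x : ℂ, ‖x‖ ≤ 1 → ‖Complex.exp (-evalAt a x t)‖ ≤ Real.exp T := by
    intro x hx
    refine (Complex.norm_exp_le_exp_norm _).trans (Real.exp_le_exp.mpr ?_)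
    rw [norm_neg]
    exact hT a ha x hx
  have hbound : ∀ x ∈ Metric.closedBall (0 : ℂ) ‖h‖,
      ‖evalAt a x (Polynomial.derivative b - Polynomial.derivative t * b)
          * Complex.exp (-evalAt a x t)‖ ≤ C * ‖h‖ ^ n * Real.exp T := by
    intro x hx
    rw [mem_closedBall_zero_iff] at hx
    rw [norm_mul]
    refine mul_le_mul ?_ (hexp x (hx.trans hh)) (norm_nonneg _) (by positivity)
    refine (hC a ha x (hx.trans hh)).trans ?_
    gcongr
  have hmv := (convex_closedBall (0 : ℂ) ‖h‖).norm_image_sub_le_of_norm_hasDerivWithin_le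
    hder hbound (Metric.mem_closedBall_self (norm_nonneg h))
    (mem_closedBall_zero_iff.mpr le_rfl : h ∈ _)
  have h0 : evalAt a 0 b = 1 := by
    rw [evalAt_zero, hb, PowerSeries.coeff_trunc, if_pos n.succ_pos,
      PowerSeries.coeff_zero_eq_constantCoeff_apply, constantCoeff_amplitudeSeries, map_one]
  have ht0 : evalAt a 0 t = 0 := evalAt_zero_trunc_tailSeries _ a
  rw [h0, ht0, neg_zero, Complex.exp_zero, mul_one, sub_zero] at hmv
  have hsplit : Complex.exp (evalAt a h t) - evalAt a h b
      = -(Complex.exp (evalAt a h t) * (evalAt a h b * Complex.exp (-evalAt a h t) - 1)) := by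
    rw [mul_sub, mul_left_comm, ← Complex.exp_add, add_neg_cancel, Complex.exp_zero]
    ring
  have he : ‖Complex.exp (evalAt a h t)‖ ≤ Real.exp T :=
    (Complex.norm_exp_le_exp_norm _).trans (Real.exp_le_exp.mpr (hT a ha h hh))
  rw [hsplit, norm_neg, norm_mul]
  refine (mul_le_mul he hmv (norm_nonneg _) (by positivity)).trans (le_of_eq ?_)
  ring

theorem X_pow_dvd_trunc_mul_trunc_sub {m n k : ℕ} (hnk : n ≤ k)
    (f g : PowerSeries (MvPolynomial (Fin m) ℂ)) :
    Polynomial.X ^ n ∣ PowerSeries.trunc k f * PowerSeries.trunc n g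
      - PowerSeries.trunc n (g * f) := by
  rw [← X_pow_dvd_coe_iff, Polynomial.coe_sub, Polynomial.coe_mul]
  have d1 := X_pow_dvd_sub_trunc n (g * f)
  have d2 := (pow_dvd_pow _ hnk).trans (X_pow_dvd_sub_trunc k f)
  have d3 := X_pow_dvd_sub_trunc n g
  refine (d1.sub ((d2.mul_right g).add
    (d3.mul_left ((PowerSeries.trunc k f : Polynomial (MvPolynomial (Fin m) ℂ)) :
      PowerSeries (MvPolynomial (Fin m) ℂ))))).trans (dvd_of_eq ?_)
  ring

/-- Four errors of order n+1 are added: the defect Q, the deviation of U from 1, the replacement of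
the tail exponential by the truncated amplitude, and the truncation of the product series. -/
theorem exists_norm_expansion_le {m n k : ℕ} (hnk : n ≤ k) {K : Set (Fin m → ℂ)}
    (hK : IsCompact K) (f : PowerSeries (MvPolynomial (Fin m) ℂ)) {M : ℝ} (hM : 0 ≤ M) :
    ∃ C, ∀ a ∈ K, ∀ h : ℂ, ‖h‖ ≤ 1 → ∀ U Q : ℂ, ‖U - 1‖ ≤ M * ‖h‖ ^ (n + 1) →
      ‖Q‖ ≤ M * ‖h‖ ^ (n + 1) →
      ‖(Q + evalAt a h (PowerSeries.trunc (m + 4 + k) f) * U)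
          * Complex.exp (evalAt a h (PowerSeries.trunc (k + 1) (tailSeries m)))
        - evalAt a h (PowerSeries.trunc (n + 1) (amplitudeSeries m * f))‖ ≤ C * ‖h‖ ^ (n + 1) := by
  obtain ⟨T, hT0, hT⟩ := exists_norm_evalAt_le hK 1 (PowerSeries.trunc (k + 1) (tailSeries m))
  obtain ⟨F, hF0, hF⟩ := exists_norm_evalAt_le hK 1 (PowerSeries.trunc (m + 4 + k) f)
  obtain ⟨C₁, hC₁0, hC₁⟩ := exists_norm_exp_tail_sub_le hnk hK
  obtain ⟨C₂, hC₂0, hC₂⟩ := exists_norm_evalAt_le_pow hK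
    (X_pow_dvd_trunc_mul_trunc_sub (by omega : n + 1 ≤ m + 4 + k) f (amplitudeSeries m))
  refine ⟨M * Real.exp T + F * M * Real.exp T + F * C₁ + C₂, fun a ha h hh U Q hU hQ => ?_⟩
  have hc₁ := hC₁ a ha h hh
  have hc₂ := hC₂ a ha h hh
  have hf := hF a ha h hh
  rw [map_sub, map_mul] at hc₂
  have he : ‖Complex.exp (evalAt a h (PowerSeries.trunc (k + 1) (tailSeries m)))‖ ≤ Real.exp T :=
    (Complex.norm_exp_le_exp_norm _).trans (Real.exp_le_exp.mpr (hT a ha h hh))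
  set e := Complex.exp (evalAt a h (PowerSeries.trunc (k + 1) (tailSeries m)))
  set φ := evalAt a h (PowerSeries.trunc (m + 4 + k) f)
  set b := evalAt a h (PowerSeries.trunc (n + 1) (amplitudeSeries m))
  set p := evalAt a h (PowerSeries.trunc (n + 1) (amplitudeSeries m * f))
  have hsplit : (Q + φ * U) * e - p = Q * e + φ * (U - 1) * e + φ * (e - b) + (φ * b - p) := by ring
  rw [hsplit]
  refine (norm_add₄_le).trans ?_
  have hp : 0 ≤ ‖h‖ ^ (n + 1) := by positivity
  have b1 : ‖Q * e‖ ≤ M * ‖h‖ ^ (n + 1) * Real.exp T := by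
    rw [norm_mul]; gcongr
  have b2 : ‖φ * (U - 1) * e‖ ≤ F * (M * ‖h‖ ^ (n + 1)) * Real.exp T := by
    rw [norm_mul, norm_mul]; gcongr
  have b3 : ‖φ * (e - b)‖ ≤ F * (C₁ * ‖h‖ ^ (n + 1)) := by
    rw [norm_mul]; gcongr
  linarith

/-! ### Polar coordinates and the sector -/

/-- The logarithm `log ρ + iθ` of `ρ e^{iθ}`. -/
noncomputable def polarLog (ρ θ : ℝ) : ℂ := (Real.log ρ : ℂ) + (θ : ℂ) * Complex.I

theorem exp_polarLog {ρ : ℝ} (hρ : 0 < ρ) (θ : ℝ) : Complex.exp (polarLog ρ θ) = polarPoint ρ θ := by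
  rw [polarLog, polarPoint, Complex.exp_add, ← Complex.ofReal_exp, Real.exp_log hρ]

theorem expPart_expoCoeff {m : ℕ} (ρ θ : ℝ) (a : Fin m → ℂ) :
    expPart (expoCoeff m) ρ θ a = expo a (polarLog ρ θ) := rfl

theorem polarPow_neg_div_three (ρ θ : ℝ) (N : ℕ) :
    polarPow ρ θ (-(N : ℂ) / 3) = small (polarLog ρ θ) ^ N := by
  rw [small, ← Complex.exp_nat_mul, polarPow, ← polarLog]
  congr 1; ring

theorem norm_small_polarLog {ρ : ℝ} (hρ : 0 < ρ) (θ : ℝ) :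
    ‖small (polarLog ρ θ)‖ = ρ ^ (-1 / 3 : ℝ) := by
  rw [small, Complex.norm_exp, Real.rpow_def_of_pos hρ]
  congr 1
  have : -polarLog ρ θ / 3 = ((-Real.log ρ / 3 : ℝ) : ℂ) + ((-θ / 3 : ℝ) : ℂ) * Complex.I := by
    rw [polarLog]; push_cast; ring
  rw [this]
  simp
  ring

theorem norm_small_polarLog_pow {ρ : ℝ} (hρ : 0 < ρ) (θ : ℝ) (n : ℕ) :
    ‖small (polarLog ρ θ)‖ ^ (n + 1) = ρ ^ (-((n : ℝ) + 1) / 3) := by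
  rw [norm_small_polarLog hρ, ← Real.rpow_natCast, ← Real.rpow_mul hρ.le]
  congr 1; push_cast; ring

theorem norm_small_polarLog_le_one {ρ : ℝ} (hρ : 1 ≤ ρ) (θ : ℝ) :
    ‖small (polarLog ρ θ)‖ ≤ 1 := by
  rw [norm_small_polarLog (by linarith)]
  exact Real.rpow_le_one_of_one_le_of_nonpos hρ (by norm_num)

/-- A closed subsector of the sector of the theorem lies in a cone around the positive axis of the
variable `q`. -/
theorem exists_cone_of_sector (m : ℕ) {α β : ℝ} (hα : -(7 * Real.pi) / ((m : ℝ) + 3) < α)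
    (hβ : β < Real.pi / ((m : ℝ) + 3)) :
    ∃ κ : ℝ, 0 ≤ κ ∧ κ < 1 ∧ ∀ ρ : ℝ, 1 ≤ ρ → ∀ θ ∈ Set.Icc α β, ∃ q : ℂ, InCone κ q ∧
      logZ m q = polarLog ρ θ ∧ ρ ^ (((m : ℝ) + 3) / 4) = ‖q‖ := by
  have hπ := Real.pi_pos
  have hm : (0 : ℝ) < (m : ℝ) + 3 := by positivity
  rw [div_lt_iff₀ hm] at hα
  rw [lt_div_iff₀ hm] at hβ
  obtain ⟨ε, hε0, hε⟩ : ∃ ε, 0 < ε ∧ ε ≤ (7 * Real.pi + ((m : ℝ) + 3) * α) / 4 ∧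
      ε ≤ (Real.pi - ((m : ℝ) + 3) * β) / 4 ∧ ε ≤ Real.pi / 2 := by
    refine ⟨min ((7 * Real.pi + ((m : ℝ) + 3) * α) / 4)
      (min ((Real.pi - ((m : ℝ) + 3) * β) / 4) (Real.pi / 2)), ?_, min_le_left _ _,
      (min_le_right _ _).trans (min_le_left _ _), (min_le_right _ _).trans (min_le_right _ _)⟩
    refine lt_min (by linarith) (lt_min (by linarith) (by linarith))
  obtain ⟨hεα, hεβ, hεπ⟩ := hε
  refine ⟨Real.cos ε, Real.cos_nonneg_of_mem_Icc ⟨by linarith, hεπ⟩, ?_, fun ρ hρ θ hθ => ?_⟩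
  · rw [← Real.cos_zero]
    exact Real.cos_lt_cos_of_nonneg_of_le_pi le_rfl (by linarith) hε0
  -- ψ is the argument of q. The bounds -7π/(m+3) and π/(m+3) for θ correspond to -π and π for ψ, so
  -- the closed subsector keeps a distance ε from the slit.
  set ψ : ℝ := (((m : ℝ) + 3) * θ + 3 * Real.pi) / 4 with hψ
  have h1 : ((m : ℝ) + 3) * α ≤ ((m : ℝ) + 3) * θ := by have := hθ.1; gcongr
  have h2 : ((m : ℝ) + 3) * θ ≤ ((m : ℝ) + 3) * β := by have := hθ.2; gcongr
  have hψ1 : |ψ| ≤ Real.pi - ε := by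
    rw [abs_le]; constructor <;> linarith
  have hψ2 := abs_le.mp hψ1
  set w : ℂ := ((((m : ℝ) + 3) / 4 * Real.log ρ : ℝ) : ℂ) + (ψ : ℂ) * Complex.I with hw
  have hre : w.re = ((m : ℝ) + 3) / 4 * Real.log ρ := by simp [hw]
  have him : w.im = ψ := by simp [hw]
  have hnorm : ‖Complex.exp w‖ = ρ ^ (((m : ℝ) + 3) / 4) := by
    rw [Complex.norm_exp, hre, Real.rpow_def_of_pos (by linarith), mul_comm]
  refine ⟨Complex.exp w, ?_, ?_, hnorm.symm⟩
  · rw [InCone, Complex.norm_exp, Complex.exp_re, him]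
    have : -Real.cos ε ≤ Real.cos ψ := by
      rw [← Real.cos_pi_sub, ← Real.cos_abs ψ]
      exact Real.cos_le_cos_of_nonneg_of_le_pi (abs_nonneg _) (by linarith) hψ1
    nlinarith [Real.exp_pos w.re]
  · have hm' := natCast_add_three_ne_zero m
    rw [logZ, Complex.log_exp (by rw [him]; linarith) (by rw [him]; linarith), hw, hψ, polarLog]
    push_cast
    field_simp
    ring

/-- Approximation of the coordinates of a solution in closed subsectors. -/
theorem exists_norm_coord_le {m k : ℕ} (n : ℕ) {V : ℂ → (Fin m → ℂ) → Fin 3 → ℂ}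
    {K : Set (Fin m → ℂ)}
    (hV : ∀ κ : ℝ, 0 ≤ κ → κ < 1 → ∃ R C : ℝ, 1 ≤ R ∧ 0 ≤ C ∧ ∀ a ∈ K, ∀ q, InCone κ q → R ≤ ‖q‖ →
        energy k a (fun z => V z a) 1 q ≤ C / ‖q‖ ^ (2 * (n + 1)))
    {α β : ℝ} (hα : -(7 * Real.pi) / ((m : ℝ) + 3) < α) (hβ : β < Real.pi / ((m : ℝ) + 3)) :
    ∃ R M : ℝ, 1 ≤ R ∧ 0 ≤ M ∧ ∀ a ∈ K, ∀ ρ : ℝ, R ≤ ρ → ∀ θ ∈ Set.Icc α β,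
      ‖coordU k a (fun z => V z a) (polarLog ρ θ) - 1‖
        ≤ M * ‖small (polarLog ρ θ)‖ ^ (n + 1) ∧
      ‖coordP k a (fun z => V z a) (polarLog ρ θ)‖ + ‖coordS k a (fun z => V z a) (polarLog ρ θ)‖
        ≤ M * ‖small (polarLog ρ θ)‖ ^ (n + 1) := by
  obtain ⟨κ, hκ0, hκ1, hκ⟩ := exists_cone_of_sector m hα hβ
  obtain ⟨R, C, hR, hC, hb⟩ := hV κ hκ0 hκ1
  -- As (m+3)/4 ≥ 1/2, ρ ≥ R² forces |q| ≥ ρ^{1/2} ≥ R, and also |q|^{-1} ≤ ρ^{-1/3} = |h|. The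
  -- energy exponent 2(n+1) is halved by the square root; the 8 is 4 + 4, for P and S together.
  refine ⟨R ^ 2, 8 * Real.sqrt C, one_le_pow₀ hR, by positivity, fun a ha ρ hρ θ hθ => ?_⟩
  have hρ1 : 1 ≤ ρ := (one_le_pow₀ hR).trans hρ
  obtain ⟨q, hq, hlog, hnorm⟩ := hκ ρ hρ1 θ hθ
  have hs0 : 0 < ‖small (polarLog ρ θ)‖ := norm_pos_iff.mpr (small_ne_zero _)
  have hroot : ρ ^ (1 / 2 : ℝ) ≤ ‖q‖ := by
    rw [← hnorm]
    refine Real.rpow_le_rpow_of_exponent_le hρ1 ?_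
    have : (0 : ℝ) ≤ m := by positivity
    linarith
  have hRq : R ≤ ‖q‖ := by
    refine le_trans ?_ hroot
    rw [← Real.sqrt_eq_rpow]
    exact Real.le_sqrt_of_sq_le hρ
  have hq1 : 1 ≤ ‖q‖ := hR.trans hRq
  have hsmall : ‖q‖⁻¹ ≤ ‖small (polarLog ρ θ)‖ := by
    have : ρ ^ (1 / 3 : ℝ) ≤ ρ ^ (1 / 2 : ℝ) :=
      Real.rpow_le_rpow_of_exponent_le hρ1 (by norm_num)
    rw [norm_small_polarLog (by linarith), neg_div, Real.rpow_neg (by linarith)]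
    exact inv_anti₀ (Real.rpow_pos_of_pos (by linarith) _) (this.trans hroot)
  have hE : Real.sqrt (energy k a (fun z => V z a) 1 q)
      ≤ Real.sqrt C * ‖small (polarLog ρ θ)‖ ^ (n + 1) := by
    refine Real.sqrt_le_iff.mpr ⟨by positivity, (hb a ha q hq hRq).trans ?_⟩
    rw [mul_pow, Real.sq_sqrt hC, div_eq_mul_inv, ← inv_pow, ← pow_mul, mul_comm (n + 1) 2]
    gcongr
  obtain ⟨h1, h2, h3⟩ := norm_coord_le_sqrt_energy k a (fun z => V z a) 1 q
  rw [hlog] at h1 h2 h3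
  have hpos : 0 ≤ Real.sqrt C * ‖small (polarLog ρ θ)‖ ^ (n + 1) := by positivity
  constructor <;> linarith

/-- Common endgame for y, y' and y'': g is 1, σ or τ, and the defect Q is 0, P or S. The weight
X^{-2} only helps, since |X| ≥ 1. -/
theorem hasSectorExpansion_of_factor {m : ℕ} {V : ℂ → (Fin m → ℂ) → Fin 3 → ℂ}
    (hV : ∀ l n : ℕ, 1 ≤ l → ∃ k, n ≤ k ∧ ∀ κ : ℝ, 0 ≤ κ → κ < 1 →
      ∀ K : Set (Fin m → ℂ), IsCompact K → ∃ R C : ℝ, 1 ≤ R ∧ 0 ≤ C ∧ ∀ a ∈ K, ∀ q, InCone κ q →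
        R ≤ ‖q‖ → energy k a (fun z => V z a) 1 q ≤ C / ‖q‖ ^ l)
    {f : ℂ → (Fin m → ℂ) → ℂ} {s : (Fin m → ℂ) → ℂ} {g : PowerSeries (MvPolynomial (Fin m) ℂ)}
    (hg : PowerSeries.constantCoeff g = 1) {Q : ℕ → (Fin m → ℂ) → ℂ → ℂ}
    (hf : ∀ k a ζ, Complex.exp (-s a * ζ) * Complex.exp (-expo a ζ) * f (Complex.exp ζ) a
      = ((big m ζ ^ 2)⁻¹ * Q k a ζ + evalAt a (small ζ) (PowerSeries.trunc (m + 4 + k) g)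
          * coordU k a (fun z => V z a) ζ)
        * Complex.exp (evalAt a (small ζ) (PowerSeries.trunc (k + 1) (tailSeries m))))
    (hQ : ∀ k a ζ, ‖Q k a ζ‖ ≤ ‖coordP k a (fun z => V z a) ζ‖ + ‖coordS k a (fun z => V z a) ζ‖) :
    HasSectorExpansion (-(7 * Real.pi) / ((m : ℝ) + 3)) (Real.pi / ((m : ℝ) + 3)) f s
      (fun N => PowerSeries.coeff N (amplitudeSeries m * g)) (expPart (expoCoeff m)) := by
  intro K hK α β hα hβ n
  obtain ⟨k, hnk, hk⟩ := hV (2 * (n + 1)) n (by omega)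
  obtain ⟨R, M, hR, hM, hb⟩ := exists_norm_coord_le n
    (fun κ h0 h1 => hk κ h0 h1 K hK) hα hβ
  obtain ⟨C, hC⟩ := exists_norm_expansion_le hnk hK g hM
  refine ⟨C, R, by linarith, fun a ha ρ hρ θ hθ => ?_⟩
  have hρ1 : 1 ≤ ρ := hR.trans hρ
  have hρ0 : 0 < ρ := by linarith
  obtain ⟨hU, hPS⟩ := hb a ha ρ hρ θ hθ
  have hs1 := norm_small_polarLog_le_one hρ1 θ
  have hfac := hf k a (polarLog ρ θ)
  rw [exp_polarLog hρ0] at hfac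
  have hbig : ‖(big m (polarLog ρ θ) ^ 2)⁻¹‖ ≤ 1 := by
    rw [norm_inv, norm_pow]
    refine inv_le_one_of_one_le₀ (one_le_pow₀ ?_)
    refine (one_le_norm_big_mul_norm_small m hs1).trans ?_
    exact mul_le_of_le_one_right (norm_nonneg _) hs1
  have hQ' : ‖(big m (polarLog ρ θ) ^ 2)⁻¹ * Q k a (polarLog ρ θ)‖
      ≤ M * ‖small (polarLog ρ θ)‖ ^ (n + 1) := by
    rw [norm_mul]
    exact (mul_le_of_le_one_left (norm_nonneg _) hbig).trans ((hQ k a _).trans hPS)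
  have hmain := hC a ha _ hs1 _ _ hU hQ'
  rw [← hfac, norm_small_polarLog_pow hρ0] at hmain
  refine le_of_eq_of_le ?_ hmain
  rw [expPart_expoCoeff, polarPow, ← polarLog]
  congr 2
  rw [evalAt_trunc, Finset.sum_range_succ', PowerSeries.coeff_zero_eq_constantCoeff_apply, map_mul,
    constantCoeff_amplitudeSeries, hg, mul_one, map_one, one_mul, pow_zero, add_comm,
    Finset.range_eq_Ico, Finset.sum_Ico_add' (fun i => MvPolynomial.eval a (PowerSeries.coeff i
      (amplitudeSeries m * g)) * small (polarLog ρ θ) ^ i) 0 n 1]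
  congr 1
  refine Finset.sum_congr rfl fun N _ => ?_
  rw [polarPow_neg_div_three]

/-! ### The main theorem -/

theorem theoremA (m : ℕ) (hm : 2 ≤ m) :
    ∃ (y : ℂ → (Fin m → ℂ) → ℂ) (r : MvPolynomial (Fin m) ℂ)
      (A B C D : ℕ → MvPolynomial (Fin m) ℂ),
      -- `y` is a solution of `y''' = φ y`, for every coefficient vector `a`
      (∀ (a : Fin m → ℂ) (z : ℂ),
        iteratedDeriv 3 (fun w => y w a) z = monicPoly a z * y z a) ∧
      -- `y` is entire in `(z, a)` jointly
      Differentiable ℂ (fun p : ℂ × (Fin m → ℂ) => y p.1 p.2) ∧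
      -- asymptotics of `y`, `y'` and `y''`
      HasSectorExpansion (-(7 * Real.pi) / ((m : ℝ) + 3)) (Real.pi / ((m : ℝ) + 3))
        y (fun a => MvPolynomial.eval a r) B (expPart A) ∧
      HasSectorExpansion (-(7 * Real.pi) / ((m : ℝ) + 3)) (Real.pi / ((m : ℝ) + 3))
        (fun z a => deriv (fun w => y w a) z)
        (fun a => (m : ℂ) / 3 + MvPolynomial.eval a r) C (expPart A) ∧
      HasSectorExpansion (-(7 * Real.pi) / ((m : ℝ) + 3)) (Real.pi / ((m : ℝ) + 3))
        (fun z a => iteratedDeriv 2 (fun w => y w a) z)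
        (fun a => 2 * (m : ℂ) / 3 + MvPolynomial.eval a r) D (expPart A) := by
  obtain ⟨V, hV, hVd, hVe⟩ := exists_recessive_solution m
  have hd1 : ∀ a, deriv (fun w => V w a 0) = fun z => V z a 1 :=
    fun a => funext fun z => (hV a z).1.deriv
  have hd2 : ∀ a, iteratedDeriv 2 (fun w => V w a 0) = fun z => V z a 2 := by
    intro a
    rw [iteratedDeriv_succ, iteratedDeriv_one, hd1]
    exact funext fun z => (hV a z).2.1.deriv
  -- The three coefficient families are left to unification; they are the coefficients of the
  -- amplitude series times 1, σ and τ.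
  refine ⟨fun z a => V z a 0, expoLog m, expoCoeff m, _, _, _, fun a z => ?_, hVd 0,
    hasSectorExpansion_of_factor (g := 1) (Q := fun _ _ _ => 0) hVe (by simp) (fun k a ζ => ?_)
      (fun k a ζ => by rw [norm_zero]; positivity),
    hasSectorExpansion_of_factor (Q := fun k a ζ => coordP k a (fun z => V z a) ζ) hVe
      (constantCoeff_slopeSeries m) (fun k a ζ => ?_)
      (fun k a ζ => le_add_of_nonneg_right (norm_nonneg _)),
    hasSectorExpansion_of_factor (Q := fun k a ζ => coordS k a (fun z => V z a) ζ) hVe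
      (constantCoeff_bendSeries m) (fun k a ζ => ?_)
      (fun k a ζ => le_add_of_nonneg_left (norm_nonneg _))⟩
  · rw [iteratedDeriv_succ, hd2]
    exact (hV a z).2.2.deriv
  · have h1 : PowerSeries.trunc (m + 4 + k) (1 : PowerSeries (MvPolynomial (Fin m) ℂ)) = 1 :=
      PowerSeries.trunc_one (m + 3 + k) |> fun h => by
        rwa [show m + 3 + k + 1 = m + 4 + k by ring] at h
    have h2 : Complex.exp (-phase k a ζ)
        * Complex.exp (evalAt a (small ζ) (PowerSeries.trunc (k + 1) (tailSeries m)))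
        = Complex.exp (-MvPolynomial.eval a (expoLog m) * ζ) * Complex.exp (-expo a ζ) := by
      rw [← Complex.exp_add, ← Complex.exp_add, phase]
      congr 1; ring
    rw [h1, map_one, mul_zero, zero_add, one_mul, coordU, ← h2]
    ring
  -- The factor h^m is what adds m/3 to the exponent r_m; for y'' the factor h^{2m} adds 2m/3.
  · have h2 : small ζ ^ m * Complex.exp (-phase k a ζ)
        * Complex.exp (evalAt a (small ζ) (PowerSeries.trunc (k + 1) (tailSeries m)))
        = Complex.exp (-((m : ℂ) / 3 + MvPolynomial.eval a (expoLog m)) * ζ)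
          * Complex.exp (-expo a ζ) := by
      rw [small, ← Complex.exp_nat_mul, ← Complex.exp_add, ← Complex.exp_add, ← Complex.exp_add,
        ← small, phase]
      congr 1; ring
    have h3 := big_ne_zero m ζ
    rw [coordP, inv_mul_cancel_left₀ (pow_ne_zero 2 h3), sub_add_cancel, ← h2, hd1]
    ring
  · have h2 : small ζ ^ (2 * m) * Complex.exp (-phase k a ζ)
        * Complex.exp (evalAt a (small ζ) (PowerSeries.trunc (k + 1) (tailSeries m)))
        = Complex.exp (-(2 * (m : ℂ) / 3 + MvPolynomial.eval a (expoLog m)) * ζ)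
          * Complex.exp (-expo a ζ) := by
      rw [small, ← Complex.exp_nat_mul, ← Complex.exp_add, ← Complex.exp_add, ← Complex.exp_add,
        ← small, phase]
      congr 1; push_cast; ring
    have h3 := big_ne_zero m ζ
    rw [coordS, inv_mul_cancel_left₀ (pow_ne_zero 2 h3), sub_add_cancel, ← h2, hd2]
    ring
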